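/- Let $m\ge 1$, let $g:\mathbb S^1\to\mathbb S^1$ be a continuous $2m$-multimodal map of degree $d$ with lift $G$ (with respect to $t\mapsto e^{2\pi i t}$), turning points $c_1<\dots<c_{2m}<c_1+1$ of $G$, where $c_1$ is a local maximum, and type $\tau=(\tau_1,\dots,\tau_{2m-1})$, i.e. $$\tau_i=(-1)^i\min_{s\in\mathbb R}\#\big([G(c_i),G(c_{i+1})]\cap(s+\mathbb Z)\big),$$ where $[x,y]$ denotes the closed interval with endpoints $x,y$ in either order. Let $\kappa=(k_0,\dots,k_m)$ be positive integers that are above $\tau$: $k_j\ge-\tau_{2j-1}+2$ for $1\le j\le m$, with $k_0=d+\sum_{j=1}^m k_j$. For $\mu=(\eta_0,a_1,r_2,\eta_2,\dots,r_m,\eta_m)\in\mathbb R^{2m}$ put $r_1=a_1$, $\eta_1=0$, $a_j=r_je^{2\pi i\eta_j}$, assume $r_j>1$ for all $j$, and let $$B_\mu(z)=e^{2\pi i\eta_0}z^{k_0}\prod_{j=1}^m\Big(\frac{z-a_j}{1-\bar a_jz}\Big)^{k_j},\qquad F_\mu(t)=\eta_0+k_0t+\sum_{j=1}^mk_j(2\varphi_j(t)-t),$$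 where $\varphi_j$ is the continuous function with $e^{2\pi i\varphi_j(t)}=(e^{2\pi it}-a_j)/|e^{2\pi it}-a_j|$ and $\varphi_j(\eta_j)=\eta_j+\frac12$; $F_\mu$ is a lift of $f_\mu=B_\mu|_{\mathbb S^1}$. Let $\Delta$ be the set of those $\mu$ for which $f_\mu$ is $2m$-multimodal. For $\mu\in\Delta$ let $\hat D_j(\mu)$ be the connected component of $\{|z|>1,\ |B_\mu(z)|<1\}$ that contains $a_j$. A labelling of the turning points for $\mu$ consists of the turning points $C_1<\dots<C_{2m}<C_1+1$ of $F_\mu$, where $C_{2j-1}$ is a local maximum, $C_{2j}$ is a local minimum, and $e^{2\pi iC_{2j-1}},e^{2\pi iC_{2j}}\in\overline{\hat D_j(\mu)}$ for $j=1,\dots,m$. Let $\Delta^{\mathrm{ord}}\subset\Delta$ be the set of parameters for which a labelling exists (those for which $\hat D_1,\dots,\hat D_m$ lie around the circle in this cyclic order), and let $\Delta_\tau\subset\Delta^{\mathrm{ord}}$ be the set of those $\mu$ for which $F_\mu$ has type $\tau$ relative to the labelled maximum $C_1$. Then the following hold. 1. There is $M_\tau>0$ with $|F_\mu'(t)|<M_\tau$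 and $|F_\mu''(t)|<M_\tau$ for all $\mu\in\Delta_\tau$ and $t\in\mathbb R$. 2. There is $\delta>0$ with $r_j(\mu)>1+\delta$ for all $\mu\in\Delta_\tau$ and $1\le j\le m$. 3. The labelled turning points can be chosen as continuous functions $C_i:\Delta^{\mathrm{ord}}\to\mathbb R$. For every such choice let $\phi(\mu)=(F_\mu(C_1(\mu)),\dots,F_\mu(C_{2m}(\mu)))$ and $V_\tau=\phi(\Delta_\tau)$. Then $V_\tau$ is contained in $$V=\{v\in\mathbb R^{2m}:(-1)^i(v_{i+1}-v_i)>0\ (1\le i<2m),\ 0<v_{2j-1}-v_{2j}<k_j\ (1\le j\le m),\ v_{2m}<v_1+d\},$$ and $\phi$ restricts to a diffeomorphism of each connected component of $\Delta_\tau$ onto $V_\tau$ (it is a smooth diffeomorphism from an open neighbourhood of the component onto an open set, and it maps the component onto $V_\tau$). 4. $\Delta_\tau$ is non-empty, each connected component of $\Delta_\tau$ is simply connected, and for every connected component $cc(\Delta)$ of $\Delta$ that meets $\Delta^{\mathrm{ord}}$, the set $\Delta_\tau\cap cc(\Delta)$ is (non-empty and) simply connected. -/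

import Mathlib

open Set Filter Topology
open scoped ContDiff

noncomputable section

namespace BlaschkeMultimodal

/-! ### Multimodal circle maps, described by their lifts -/

/-- `G` is a lift, with respect to `t ↦ exp (2πit)`, of a continuous `2m`-multimodal circle map of
degree `d`, and `C 1 < C 2 < ⋯ < C (2m) < C 1 + 1` are its turning points, extended to all integer
indices by `C (i + 2m) = C i + 1`. The points of odd index are the local maxima, those of even
index the local minima. -/
structure IsMultimodalLift (m : ℕ) (d : ℤ) (G : ℝ → ℝ) (C : ℤ → ℝ) : Prop where
  continuous : Continuous G
  degree : ∀ t, G (t + 1) = G t + d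
  strictMono : StrictMono C
  periodic : ∀ i, C (i + 2 * m) = C i + 1
  decreasing : ∀ j : ℤ, StrictAntiOn G (Icc (C (2 * j - 1)) (C (2 * j)))
  increasing : ∀ j : ℤ, StrictMonoOn G (Icc (C (2 * j)) (C (2 * j + 1)))

/-- `τ = (τ_1, …, τ_{2m-1})` is the type of the lift `G` relative to its local maximum `C 1`:
`τ_i = (-1)^i min_s #([G(C_i), G(C_{i+1})] ∩ (s + ℤ))`. The entry `τ_{i+1}` is `τ i`. -/
def HasType (m : ℕ) (G : ℝ → ℝ) (C : ℤ → ℝ) (τ : Fin (2 * m - 1) → ℤ) : Prop :=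
  ∀ i : Fin (2 * m - 1),
    τ i = (-1) ^ ((i : ℕ) + 1) *
      ((sInf (range fun s : ℝ =>
        (uIcc (G (C ((i : ℤ) + 1))) (G (C ((i : ℤ) + 2))) ∩
          {x : ℝ | ∃ n : ℤ, x = s + n}).ncard) : ℕ) : ℤ)

/-! ### The parameters `μ = (η_0, a_1, r_2, η_2, …, r_m, η_m)`

The index `j : Fin m` stands for `j + 1` in the usual numbering `1, …, m`. -/

/-- The `i`-th coordinate of `μ`, counted from `0`. -/
def coord {m : ℕ} (μ : Fin (2 * m) → ℝ) (i : ℕ) : ℝ :=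
  if h : i < 2 * m then μ ⟨i, h⟩ else 0

/-- The modulus `r_j = |a_j|` (with `r_1 = a_1`). -/
def modulus {m : ℕ} (μ : Fin (2 * m) → ℝ) (j : Fin m) : ℝ :=
  if (j : ℕ) = 0 then coord μ 1 else coord μ (2 * j)

/-- The angle `η_j` (with `η_1 = 0`). -/
def angle {m : ℕ} (μ : Fin (2 * m) → ℝ) (j : Fin m) : ℝ :=
  if (j : ℕ) = 0 then 0 else coord μ (2 * j + 1)

/-- `e t = exp (2πit)`. -/
def e (t : ℝ) : ℂ := Complex.exp (2 * Real.pi * Complex.I * t)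

/-- `a_j = r_j exp (2πi η_j)`. -/
def zero {m : ℕ} (μ : Fin (2 * m) → ℝ) (j : Fin m) : ℂ := modulus μ j * e (angle μ j)

/-- The Blaschke-type product
`B(z) = exp (2πi η_0) z^{k_0} ∏_j ((z - a_j) / (1 - conj a_j z))^{k_j}`. -/
def blaschke {m : ℕ} (κ : Fin (m + 1) → ℕ) (μ : Fin (2 * m) → ℝ) (z : ℂ) : ℂ :=
  e (coord μ 0) * z ^ κ 0 *
    ∏ j : Fin m, ((z - zero μ j) / (1 - starRingEnd ℂ (zero μ j) * z)) ^ κ j.succ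

/-- The continuous function `φ_j` of `t` with `exp (2πi φ_j(t)) = (z - a_j) / |z - a_j|`,
`z = exp (2πit)`, and `φ_j(η_j) = η_j + 1/2`: here `z - a_j = -a_j (1 - z / a_j)`, and
`1 - z / a_j` has positive real part. -/
def phase {m : ℕ} (μ : Fin (2 * m) → ℝ) (j : Fin m) (t : ℝ) : ℝ :=
  angle μ j + 1 / 2 + Complex.arg (1 - e t / zero μ j) / (2 * Real.pi)

/-- The lift `F_μ(t) = η_0 + k_0 t + ∑_j k_j (2 φ_j(t) - t)` of the restriction of `B` to the unit
circle; it depends smoothly on `μ`. -/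
def lift {m : ℕ} (κ : Fin (m + 1) → ℕ) (μ : Fin (2 * m) → ℝ) (t : ℝ) : ℝ :=
  coord μ 0 + κ 0 * t + ∑ j : Fin m, (κ j.succ : ℝ) * (2 * phase μ j t - t)

/-- The degree `k_0 - ∑_j k_j` of the circle map. -/
def degree {m : ℕ} (κ : Fin (m + 1) → ℕ) : ℤ := (κ 0 : ℤ) - ∑ j : Fin m, (κ j.succ : ℤ)

/-- The set `Δ` of parameters whose circle map is `2m`-multimodal. -/
def Delta {m : ℕ} (κ : Fin (m + 1) → ℕ) : Set (Fin (2 * m) → ℝ) :=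
  {μ | (∀ j, 1 < modulus μ j) ∧ ∃ C, IsMultimodalLift m (degree κ) (lift κ μ) C}

/-! ### The labelling of the critical points -/

/-- The part outside the closed unit disk of the Jordan domain `D_j` bounded by the curve
`Γ_j ⊆ B⁻¹(𝕊¹)` that surrounds `a_j`: the component of `{|z| > 1, |B(z)| < 1}` containing `a_j`. -/
def outerDisk {m : ℕ} (κ : Fin (m + 1) → ℕ) (μ : Fin (2 * m) → ℝ) (j : Fin m) : Set ℂ :=
  connectedComponentIn {z : ℂ | 1 < ‖z‖ ∧ ‖blaschke κ μ z‖ < 1} (zero μ j)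

/-- `C 1 < ⋯ < C (2m) < C 1 + 1` are (lifts of) the critical points of the multimodal map with
parameter `μ`, in cyclic order, labelled such that `c_{2j-1}, c_{2j} ∈ Γ_j` for each `j`. A critical
point on the unit circle lies on `Γ_j` exactly if it is in the closure of `outerDisk κ μ j`. -/
structure IsLabelling {m : ℕ} (κ : Fin (m + 1) → ℕ) (μ : Fin (2 * m) → ℝ) (C : ℤ → ℝ) :
    Prop where
  one_lt_modulus : ∀ j, 1 < modulus μ j
  multimodal : IsMultimodalLift m (degree κ) (lift κ μ) C
  max_mem : ∀ j : Fin m, e (C (2 * (j : ℤ) + 1)) ∈ closure (outerDisk κ μ j)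
  min_mem : ∀ j : Fin m, e (C (2 * (j : ℤ) + 2)) ∈ closure (outerDisk κ μ j)

/-- The parameters in `Δ` for which such a labelling is possible, that is, for which
`Γ_1, …, Γ_m` follow each other in this cyclic order. -/
def OrderedDelta {m : ℕ} (κ : Fin (m + 1) → ℕ) : Set (Fin (2 * m) → ℝ) :=
  {μ | ∃ C, IsLabelling κ μ C}

/-- The set `Δ_τ` of parameters for which `F_μ` has type `τ` relative to the local maximum
`C 1` on `Γ_1`. -/
def DeltaTau {m : ℕ} (κ : Fin (m + 1) → ℕ) (τ : Fin (2 * m - 1) → ℤ) : Set (Fin (2 * m) → ℝ) :=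
  {μ | ∃ C, IsLabelling κ μ C ∧ HasType m (lift κ μ) C τ}

/-- A choice of the labelled critical points `C_i(μ)` as continuous functions of `μ`. -/
structure IsCriticalFamily {m : ℕ} (κ : Fin (m + 1) → ℕ) (C : (Fin (2 * m) → ℝ) → ℤ → ℝ) :
    Prop where
  isLabelling : ∀ μ ∈ OrderedDelta κ, IsLabelling κ μ (C μ)
  continuousOn : ∀ i, ContinuousOn (fun μ => C μ i) (OrderedDelta κ)

/-! ### Critical values -/

/-- The map `φ(μ) = (F_μ(C_1(μ)), …, F_μ(C_{2m}(μ)))`. -/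
def critValues {m : ℕ} (κ : Fin (m + 1) → ℕ) (C : (Fin (2 * m) → ℝ) → ℤ → ℝ)
    (μ : Fin (2 * m) → ℝ) : Fin (2 * m) → ℝ :=
  fun i => lift κ μ (C μ ((i : ℤ) + 1))

/-- The set `V` of vectors `(v_1, …, v_{2m})` with `(-1)^i (v_{i+1} - v_i) > 0` for `i < 2m`,
`0 < v_{2j-1} - v_{2j} < k_j`, and `v_{2m} < v_1 + d`. -/
def V {m : ℕ} (κ : Fin (m + 1) → ℕ) : Set (Fin (2 * m) → ℝ) :=
  {v | (∀ i i' : Fin (2 * m), (i' : ℕ) = i + 1 → 0 < (-1) ^ ((i : ℕ) + 1) * (v i' - v i)) ∧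
    (∀ j : Fin m, 0 < v ⟨2 * j, by omega⟩ - v ⟨2 * j + 1, by omega⟩ ∧
      v ⟨2 * j, by omega⟩ - v ⟨2 * j + 1, by omega⟩ < κ j.succ) ∧
    ∀ i i' : Fin (2 * m), (i : ℕ) = 0 → (i' : ℕ) + 1 = 2 * m → v i' < v i + degree κ}

/-- The set `V_τ`, the image of `Δ_τ` under `φ`. -/
def VTau {m : ℕ} (κ : Fin (m + 1) → ℕ) (τ : Fin (2 * m - 1) → ℤ)
    (C : (Fin (2 * m) → ℝ) → ℤ → ℝ) : Set (Fin (2 * m) → ℝ) :=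
  critValues κ C '' DeltaTau κ τ

/-- `f` restricts to a diffeomorphism of `K` onto `L`. As `K` and `L` need not be open, this means
that `f` is a smooth diffeomorphism of an open neighbourhood of `K` onto an open set, and maps
`K` onto `L`. -/
def IsDiffeoOnto {n : ℕ} (f : (Fin n → ℝ) → (Fin n → ℝ)) (K L : Set (Fin n → ℝ)) : Prop :=
  ∃ Φ : OpenPartialHomeomorph (Fin n → ℝ) (Fin n → ℝ),
    K ⊆ Φ.source ∧ EqOn f Φ Φ.source ∧ ContDiffOn ℝ ∞ Φ Φ.source ∧
      ContDiffOn ℝ ∞ Φ.symm Φ.target ∧ f '' K = L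

end BlaschkeMultimodal

end

open scoped ComplexConjugate

namespace BlaschkeMultimodal

/-! ### The map `e` -/

/-! Write `w_j = 1 / conj a_j` for the poles inside the disk. The derivative `F'` of the lift is a
constant plus imaginary parts of fractions with poles at the `1 / conj w_j`; cleared of denominators
it is a polynomial of degree at most `2m` in `z = e t`. So `F'` has at most `2m` zeros per period,
counted with multiplicity, unless it vanishes identically. A `2m`-multimodal map exhausts this
bound: its turning points are all the zeros of `F'`, they are nondegenerate, and the `w_j` are
distinct and nonzero. The same count makes the critical values local coordinates
(`eq_zero_of_liftDeriv`): if they all have the same derivative in a direction, then the variation of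
the lift, less that derivative and plus a suitable multiple of `F'`, has `2m + 1` zeros, so its
residues vanish, and only `η_0` can move because `η_1 = 0`.

The global part is properness. The maximum principle for `1 / B` puts a zero into every component of
`{|z| > 1, |B| < 1}`. Since `{|z| < 1, |B| < 1}` is connected and disjoint from the reflections of
these components, a crossing argument shows that no component touches two decreasing arcs of a
period (`not_touches_of_lt`). With `m` arcs and `m` zeros this is a bijection. The maximum principle
applied without the factor of `a_j` gives `F' + k_j P_j ≥ 0` on the arc of `a_j`, where `P_j` is the
Poisson kernel at `w_j`; hence the drop there is less than `k_j` (`drop_lt`). If `a_j` approaches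
the circle, then `P_j` concentrates and the drop approaches `k_j` (`drop_ge`). A pole tending to `0`
would leave too few poles for `2m` turning points. So the critical values, suitably normalized, are
a proper map to the convex open set `V`, up to integral translations of the angles
(`exists_convergent_subseq`).

A local homeomorphism with this properness has a section over `V` through each point
(`exists_section`), and the images of the sections are the components of `Δ` that meet `Δ^ord`. A
type prescribes the integral parts of the differences of the critical values, which cuts a convex
set `typeSet` out of `V`; it is nonempty because it contains the critical values of the given map.
The set `Δ_τ` meets each such component in the image of `typeSet`. Being above `τ` keeps the drops
at least `1` below `k_j`, whence the uniform bounds. Zeros at equidistant angles near the circle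
show that `Δ^ord` is nonempty. -/

lemma e_eq (t : ℝ) : e t = Complex.exp ((2 * Real.pi * t : ℝ) * Complex.I) := by
  unfold e; congr 1; push_cast; ring

@[simp] lemma norm_e (t : ℝ) : ‖e t‖ = 1 := by
  rw [e_eq]; exact Complex.norm_exp_ofReal_mul_I _

lemma e_add (s t : ℝ) : e (s + t) = e s * e t := by
  unfold e; rw [← Complex.exp_add]; congr 1; push_cast; ring

@[simp] lemma e_zero : e 0 = 1 := by simp [e]

lemma e_ne_zero (t : ℝ) : e t ≠ 0 := by unfold e; exact Complex.exp_ne_zero _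

@[simp] lemma e_int (n : ℤ) : e n = 1 := by
  unfold e; rw [Complex.exp_eq_one_iff]; exact ⟨n, by push_cast; ring⟩

lemma e_add_int (t : ℝ) (n : ℤ) : e (t + n) = e t := by rw [e_add, e_int, mul_one]

lemma e_eq_iff {s t : ℝ} : e s = e t ↔ ∃ n : ℤ, s = t + n := by
  constructor
  · intro h
    unfold e at h
    obtain ⟨n, hn⟩ := Complex.exp_eq_exp_iff_exists_int.1 h
    refine ⟨n, ?_⟩
    have : (2 * Real.pi * Complex.I : ℂ) ≠ 0 := by
      simp [Real.pi_ne_zero]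
    have h2 : (2 * Real.pi * Complex.I : ℂ) * s = (2 * Real.pi * Complex.I : ℂ) * ((t + n : ℝ) : ℂ) := by
      rw [hn]; push_cast; ring
    exact_mod_cast mul_left_cancel₀ this h2
  · rintro ⟨n, rfl⟩; exact e_add_int _ _

lemma conj_e (t : ℝ) : conj (e t) = (e t)⁻¹ := by
  rw [Complex.inv_def, Complex.normSq_eq_norm_sq, norm_e]; simp

lemma e_re (t : ℝ) : (e t).re = Real.cos (2 * Real.pi * t) := by
  rw [e_eq, Complex.exp_ofReal_mul_I_re]

lemma e_im (t : ℝ) : (e t).im = Real.sin (2 * Real.pi * t) := by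
  rw [e_eq, Complex.exp_ofReal_mul_I_im]

lemma hasDerivAt_e (t : ℝ) : HasDerivAt e (2 * Real.pi * Complex.I * e t) t := by
  have h : HasDerivAt (fun x : ℝ => (2 * Real.pi * Complex.I : ℂ) * (x : ℂ))
      (2 * Real.pi * Complex.I * 1) t := (Complex.ofRealCLM.hasDerivAt).const_mul _
  have := h.cexp
  refine this.congr_deriv ?_
  change _ = 2 * Real.pi * Complex.I * Complex.exp _
  ring

lemma contDiff_e {n : ℕ∞ω} : ContDiff ℝ n e := by
  unfold e
  exact (contDiff_const.mul Complex.ofRealCLM.contDiff).cexp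

lemma continuous_e : Continuous e := (contDiff_e (n := 0)).continuous

lemma injOn_e (x : ℝ) : InjOn e (Ico x (x + 1)) := by
  intro s hs t ht h
  obtain ⟨n, hn⟩ := e_eq_iff.1 h
  have h1 : (n : ℝ) < 1 := by linarith [hs.2, ht.1]
  have h2 : (-1 : ℝ) < n := by linarith [hs.1, ht.2]
  have h3 : n < 1 := by exact_mod_cast h1
  have h4 : -1 < n := by exact_mod_cast h2
  have : n = 0 := by omega
  simp [hn, this]

/-! ### Counting zeros on the circle of real rational functions -/

/-- A real function on the unit circle with simple poles at the points `1 / conj (w j)`. -/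
noncomputable def trigSum {ι : Type*} (s : Finset ι) (w Q : ι → ℂ) (c : ℝ) (z : ℂ) : ℝ :=
  c + ∑ j ∈ s, (Q j * z / (1 - conj (w j) * z)).im

open Polynomial in
/-- The numerator of `trigSum`. -/
noncomputable def trigPoly {ι : Type*} [DecidableEq ι] (s : Finset ι) (w Q : ι → ℂ) (c : ℝ) : ℂ[X] :=
  C (2 * Complex.I * c) * ∏ j ∈ s, ((1 - C (conj (w j)) * X) * (X - C (w j))) +
    ∑ j ∈ s, (C (Q j) * X * (X - C (w j)) - C (conj (Q j)) * (1 - C (conj (w j)) * X)) *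
      ∏ l ∈ s.erase j, ((1 - C (conj (w l)) * X) * (X - C (w l)))

lemma one_sub_conj_mul_ne_zero {w z : ℂ} (hw : ‖w‖ < 1) (hz : ‖z‖ ≤ 1) : 1 - conj w * z ≠ 0 := by
  intro h
  have : ‖conj w * z‖ = 1 := by rw [← sub_eq_zero.1 h]; simp
  rw [norm_mul, RCLike.norm_conj] at this
  nlinarith [norm_nonneg w, norm_nonneg z]

lemma sub_ne_zero_of_norm {w z : ℂ} (hw : ‖w‖ < 1) (hz : ‖z‖ = 1) : z - w ≠ 0 := by
  intro h; rw [sub_eq_zero.1 h] at hz; linarith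

section
variable {ι : Type*} {s : Finset ι} {w Q : ι → ℂ} {c : ℝ}

/-- The denominator of `trigSum`. -/
noncomputable def trigDenom (s : Finset ι) (w : ι → ℂ) (z : ℂ) : ℂ :=
  ∏ j ∈ s, ((1 - conj (w j) * z) * (z - w j))

lemma trigDenom_ne_zero (hw : ∀ j ∈ s, ‖w j‖ < 1) {z : ℂ} (hz : ‖z‖ = 1) :
    trigDenom s w z ≠ 0 :=
  Finset.prod_ne_zero_iff.2 fun j hj =>
    mul_ne_zero (one_sub_conj_mul_ne_zero (hw j hj) hz.le) (sub_ne_zero_of_norm (hw j hj) hz)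

lemma two_I_mul_im (x : ℂ) : 2 * Complex.I * (x.im : ℂ) = x - conj x := by
  rw [Complex.sub_conj]; push_cast; ring

variable [DecidableEq ι]

/-- On the circle `conj z = 1 / z`, so the conjugate of the `j`-th fraction is `conj (Q j) / (z - w
j)`, and `2i` times the imaginary part becomes a rational function of `z`. -/
lemma eval_trigPoly (hw : ∀ j ∈ s, ‖w j‖ < 1) {z : ℂ} (hz : ‖z‖ = 1) :
    (trigPoly s w Q c).eval z = 2 * Complex.I * trigSum s w Q c z * trigDenom s w z := by
  have hz0 : z ≠ 0 := by rintro rfl; simp at hz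
  have hzc : conj z = z⁻¹ := by
    rw [Complex.inv_def, Complex.normSq_eq_norm_sq, hz]; simp
  unfold trigPoly trigSum
  simp only [Polynomial.eval_add, Polynomial.eval_mul, Polynomial.eval_C, Polynomial.eval_prod,
    Polynomial.eval_sub, Polynomial.eval_one, Polynomial.eval_X, Polynomial.eval_finsetSum]
  push_cast
  rw [mul_add, add_mul, Finset.mul_sum, Finset.sum_mul]
  congr 1
  refine Finset.sum_congr rfl fun j hj => ?_
  rw [two_I_mul_im]
  unfold trigDenom
  rw [← Finset.mul_prod_erase s _ hj, ← mul_assoc]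
  congr 1
  have h1 := one_sub_conj_mul_ne_zero (hw j hj) hz.le
  have h2 := sub_ne_zero_of_norm (hw j hj) hz
  have h3 : conj (Q j * z / (1 - conj (w j) * z)) = conj (Q j) / (z - w j) := by
    simp only [map_div₀, map_mul, map_sub, map_one, Complex.conj_conj, hzc]
    have h4 : 1 - w j * z⁻¹ ≠ 0 := by
      intro h; apply h2; field_simp at h; simpa using h
    field_simp
  rw [h3]
  have e1 : Q j * z / (1 - conj (w j) * z) * ((1 - conj (w j) * z) * (z - w j)) =
      Q j * z * (z - w j) := by rw [← mul_assoc, div_mul_cancel₀ _ h1]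
  have e2 : conj (Q j) / (z - w j) * ((1 - conj (w j) * z) * (z - w j)) =
      conj (Q j) * (1 - conj (w j) * z) := by
    rw [mul_comm (1 - conj (w j) * z), ← mul_assoc, div_mul_cancel₀ _ h2]
  rw [sub_mul, e1, e2]

lemma natDegree_trigPoly_le : (trigPoly s w Q c).natDegree ≤ 2 * s.card := by
  have hf : ∀ j, ((1 - Polynomial.C (conj (w j)) * Polynomial.X) *
      (Polynomial.X - Polynomial.C (w j))).natDegree ≤ 2 := by
    intro j; compute_degree
  have hp : ∀ u : Finset ι, (∏ j ∈ u, ((1 - Polynomial.C (conj (w j)) * Polynomial.X) *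
      (Polynomial.X - Polynomial.C (w j)))).natDegree ≤ 2 * u.card := by
    intro u
    refine (Polynomial.natDegree_prod_le _ _).trans ?_
    rw [mul_comm, ← smul_eq_mul]
    exact Finset.sum_le_card_nsmul _ _ _ fun j _ => hf j
  unfold trigPoly
  refine Polynomial.natDegree_add_le_of_degree_le ?_ ?_
  · exact (Polynomial.natDegree_C_mul_le _ _).trans (hp s)
  · refine Polynomial.natDegree_sum_le_of_forall_le _ _ fun j hj => ?_
    refine (Polynomial.natDegree_mul_le).trans ?_
    have h1 : (Polynomial.C (Q j) * Polynomial.X * (Polynomial.X - Polynomial.C (w j)) -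
      Polynomial.C (conj (Q j)) * (1 - Polynomial.C (conj (w j)) * Polynomial.X)).natDegree ≤ 2 := by
      compute_degree
    have h2 := hp (s.erase j)
    have h3 := Finset.card_erase_add_one hj
    omega

lemma trigSum_eq_zero_of_trigPoly (hw : ∀ j ∈ s, ‖w j‖ < 1) (h : trigPoly s w Q c = 0)
    {z : ℂ} (hz : ‖z‖ = 1) : trigSum s w Q c z = 0 := by
  have h1 := eval_trigPoly (Q := Q) (c := c) hw hz
  rw [h, Polynomial.eval_zero] at h1
  have h2 := mul_eq_zero.1 h1.symm
  have h3 := h2.resolve_right (trigDenom_ne_zero hw hz)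
  have h4 := (mul_eq_zero.1 h3).resolve_left (by simp)
  exact_mod_cast h4

/-- A nonzero `trigSum` with `n` poles has at most `2n` zeros on the circle. -/
lemma trigSum_eq_zero_of_card (hw : ∀ j ∈ s, ‖w j‖ < 1) {T : Finset ℝ} {x : ℝ}
    (hT : ∀ t ∈ T, t ∈ Ico x (x + 1)) (hz : ∀ t ∈ T, trigSum s w Q c (e t) = 0)
    (hc : 2 * s.card < T.card) (t : ℝ) : trigSum s w Q c (e t) = 0 := by
  refine trigSum_eq_zero_of_trigPoly hw ?_ (norm_e t)
  refine Polynomial.eq_zero_of_natDegree_lt_card_of_eval_eq_zero' _ (T.image e) ?_ ?_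
  · intro z hzT
    obtain ⟨t, ht, rfl⟩ := Finset.mem_image.1 hzT
    rw [eval_trigPoly hw (norm_e t), hz t ht]; simp
  · rw [Finset.card_image_of_injOn fun a ha b hb h => injOn_e x (hT a ha) (hT b hb) h]
    exact natDegree_trigPoly_le.trans_lt hc

/-- The same count when one of the zeros is a double zero. -/
lemma trigSum_eq_zero_of_card_of_deriv (hw : ∀ j ∈ s, ‖w j‖ < 1) {T : Finset ℝ} {x : ℝ}
    (hT : ∀ t ∈ T, t ∈ Ico x (x + 1)) (hz : ∀ t ∈ T, trigSum s w Q c (e t) = 0)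
    (hc : 2 * s.card ≤ T.card) {t₀ : ℝ} (ht₀ : t₀ ∈ T)
    (hd : HasDerivAt (fun t => trigSum s w Q c (e t)) 0 t₀) (t : ℝ) :
    trigSum s w Q c (e t) = 0 := by
  refine trigSum_eq_zero_of_trigPoly hw ?_ (norm_e t)
  set P := trigPoly s w Q c with hP
  have hroot : ∀ t ∈ T, P.eval (e t) = 0 := fun t ht => by
    rw [hP, eval_trigPoly hw (norm_e t), hz t ht]; simp
  have hM : DifferentiableAt ℝ (fun t => trigDenom s w (e t)) t₀ := by
    unfold trigDenom
    have he := (hasDerivAt_e t₀).differentiableAt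
    fun_prop
  -- Both `trigSum` and its derivative vanish at `t₀`, so `e t₀` is a double root of `P`, whatever
  -- the denominator does.
  have hder : (Polynomial.derivative P).eval (e t₀) = 0 := by
    have h1 : HasDerivAt (fun t => P.eval (e t))
        ((Polynomial.derivative P).eval (e t₀) * (2 * Real.pi * Complex.I * e t₀)) t₀ :=
      (P.hasDerivAt (e t₀)).comp t₀ (hasDerivAt_e t₀)
    have h2 : HasDerivAt (fun t => 2 * Complex.I * (trigSum s w Q c (e t) : ℂ) *
        trigDenom s w (e t)) 0 t₀ := by
      have h3 := ((hd.ofReal_comp).const_mul (2 * Complex.I)).mul hM.hasDerivAt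
      refine h3.congr_deriv ?_
      rw [hz t₀ ht₀]; simp
    have h4 : (fun t => P.eval (e t)) = fun t => 2 * Complex.I * (trigSum s w Q c (e t) : ℂ) *
        trigDenom s w (e t) := by
      funext t; rw [hP, eval_trigPoly hw (norm_e t)]
    rw [h4] at h1
    have h5 := h1.unique h2
    exact (mul_eq_zero.1 h5).resolve_right (by simp [Real.pi_ne_zero, e_ne_zero])
  obtain ⟨R, hR⟩ := Polynomial.dvd_iff_isRoot.2 (hroot t₀ ht₀)
  -- Dividing by `X - e t₀` lowers the degree by one, but no root is lost: `R` still vanishes at `e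
  -- t₀` because that root is double.
  have hR0 : R = 0 := by
    by_contra hne
    have hdeg : P.natDegree = 1 + R.natDegree := by
      rw [hR, Polynomial.natDegree_mul (Polynomial.X_sub_C_ne_zero _) hne,
        Polynomial.natDegree_X_sub_C]
    apply hne
    refine Polynomial.eq_zero_of_natDegree_lt_card_of_eval_eq_zero' _ (T.image e) ?_ ?_
    · intro z hzT
      obtain ⟨t, ht, rfl⟩ := Finset.mem_image.1 hzT
      by_cases htt : t = t₀
      · subst htt
        rw [hR] at hder
        simpa using hder
      · have h6 := hroot t ht
        rw [hR, Polynomial.eval_mul] at h6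
        refine (mul_eq_zero.1 h6).resolve_left ?_
        simp only [Polynomial.eval_sub, Polynomial.eval_X, Polynomial.eval_C]
        intro h7
        exact htt (injOn_e x (hT t ht) (hT t₀ ht₀) (sub_eq_zero.1 h7))
    · rw [Finset.card_image_of_injOn fun a ha b hb h => injOn_e x (hT a ha) (hT b hb) h]
      have : P.natDegree ≤ 2 * s.card := natDegree_trigPoly_le
      omega
  rw [hR, hR0, mul_zero]

/-- The residues of a vanishing `trigSum` vanish. -/
lemma residue_eq_zero_of_trigSum (hw : ∀ j ∈ s, ‖w j‖ < 1) (hinj : InjOn w s)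
    (h : ∀ t, trigSum s w Q c (e t) = 0) {j : ι} (hj : j ∈ s) : Q j = 0 := by
  have hP : trigPoly s w Q c = 0 := by
    refine Polynomial.eq_zero_of_infinite_isRoot _ ?_
    refine Set.Infinite.mono (s := e '' Ico 0 (0 + 1)) ?_
      ((Ico_infinite (by norm_num)).image (injOn_e 0))
    rintro _ ⟨t, -, rfl⟩
    change Polynomial.eval _ _ = 0
    rw [eval_trigPoly hw (norm_e t), h t]; simp
  -- At `w j` every term contains a vanishing factor `X - w j`, except the one with `conj (Q j)`.
  -- Evaluation there isolates the residue.
  have h1 : (trigPoly s w Q c).eval (w j) = 0 := by rw [hP]; simp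
  unfold trigPoly at h1
  simp only [Polynomial.eval_add, Polynomial.eval_mul, Polynomial.eval_C, Polynomial.eval_prod,
    Polynomial.eval_sub, Polynomial.eval_one, Polynomial.eval_X, Polynomial.eval_finsetSum] at h1
  rw [Finset.prod_eq_zero hj (by simp), mul_zero, zero_add, Finset.sum_eq_single_of_mem j hj] at h1
  · have hprod : ∏ l ∈ s.erase j, ((1 - conj (w l) * w j) * (w j - w l)) ≠ 0 := by
      refine Finset.prod_ne_zero_iff.2 fun l hl => ?_
      have hl' := Finset.mem_erase.1 hl
      refine mul_ne_zero (one_sub_conj_mul_ne_zero (hw l hl'.2) (hw j hj).le) ?_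
      intro h2
      exact hl'.1 (hinj hl'.2 hj (sub_eq_zero.1 h2).symm)
    have h2 := (mul_eq_zero.1 h1).resolve_right hprod
    simp only [sub_self, mul_zero, zero_sub, neg_eq_zero] at h2
    have h3 := (mul_eq_zero.1 h2).resolve_right (one_sub_conj_mul_ne_zero (hw j hj) (hw j hj).le)
    simpa using h3
  · intro l hl hlj
    rw [Finset.prod_eq_zero (Finset.mem_erase.2 ⟨hlj.symm, hj⟩) (by simp), mul_zero]

end

/-- Terms with equal poles can be combined. -/
lemma trigSum_image {ι : Type*} [DecidableEq ℂ] (s : Finset ι) (w Q : ι → ℂ) (c : ℝ) (z : ℂ) :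
    trigSum s w Q c z =
      trigSum (s.image w) id (fun v => ∑ j ∈ s.filter (fun j => w j = v), Q j) c z := by
  unfold trigSum
  congr 1
  rw [← Finset.sum_fiberwise_of_maps_to (g := w) (t := s.image w)
    (fun j hj => Finset.mem_image_of_mem _ hj)]
  refine Finset.sum_congr rfl fun v hv => ?_
  rw [id, Finset.sum_mul, Finset.sum_div, Complex.im_sum]
  refine Finset.sum_congr rfl fun j hj => ?_
  rw [(Finset.mem_filter.1 hj).2]


/-! ### The lift in terms of the poles `w j` in the unit disk -/

section genLift
variable {m : ℕ}

/-- The lift of a quotient of Blaschke products with degree `D` and with poles `w j` of order `k j`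
in the unit disk. -/
noncomputable def genLift (k : Fin m → ℝ) (D θ : ℝ) (w : Fin m → ℂ) (t : ℝ) : ℝ :=
  θ + D * t + ∑ j, k j / Real.pi * Complex.arg (1 - conj (w j) * e t)

/-- The derivative of `genLift`. -/
noncomputable def genDeriv (k : Fin m → ℝ) (D : ℝ) (w : Fin m → ℂ) (t : ℝ) : ℝ :=
  trigSum Finset.univ w (fun j => -(2 * k j * Complex.I * conj (w j))) D (e t)

/-- The derivative of the logarithm of the modulus of a Blaschke factor. -/
noncomputable def poisson (w : ℂ) (t : ℝ) : ℝ := (1 - ‖w‖ ^ 2) / ‖1 - conj w * e t‖ ^ 2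

lemma one_sub_re_pos {w z : ℂ} (hw : ‖w‖ < 1) (hz : ‖z‖ ≤ 1) : 0 < (1 - conj w * z).re := by
  have h : ‖conj w * z‖ < 1 := by
    rw [norm_mul, RCLike.norm_conj]
    nlinarith [norm_nonneg w, norm_nonneg z]
  have := Complex.re_le_norm (conj w * z)
  simp only [Complex.sub_re, Complex.one_re]; linarith

lemma one_sub_mem_slitPlane {w z : ℂ} (hw : ‖w‖ < 1) (hz : ‖z‖ ≤ 1) :
    1 - conj w * z ∈ Complex.slitPlane := Or.inl (one_sub_re_pos hw hz)

/-- The Poisson kernel is the real part of `(1 + x) / (1 - x) = 1 + 2x / (1 - x)` with `x = conj w *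
e t`. -/
lemma poisson_eq {w : ℂ} (hw : ‖w‖ < 1) (t : ℝ) :
    poisson w t = 1 + 2 * (conj w * e t / (1 - conj w * e t)).re := by
  have h := one_sub_conj_mul_ne_zero hw (norm_e t).le
  have h1 : ‖conj w * e t‖ ^ 2 = ‖w‖ ^ 2 := by rw [norm_mul, RCLike.norm_conj, norm_e, mul_one]
  unfold poisson
  rw [← h1]
  set x := conj w * e t
  have h2 : Complex.normSq (1 - x) ≠ 0 := by simpa [Complex.normSq_eq_zero] using h
  rw [← Complex.normSq_eq_norm_sq, ← Complex.normSq_eq_norm_sq, Complex.div_re]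
  field_simp
  simp only [Complex.normSq_apply, Complex.sub_re, Complex.sub_im, Complex.one_re, Complex.one_im]
  ring

lemma poisson_pos {w : ℂ} (hw : ‖w‖ < 1) (t : ℝ) : 0 < poisson w t := by
  have h := one_sub_conj_mul_ne_zero hw (norm_e t).le
  unfold poisson
  have : 0 < ‖1 - conj w * e t‖ := norm_pos_iff.2 h
  have h3 : ‖w‖ ^ 2 < 1 := by nlinarith [norm_nonneg w]
  apply div_pos <;> [linarith; positivity]

/-- For the orders and the degree of a Blaschke quotient the constant `D + ∑ k j` is `k_0`, and each
pole lowers the derivative by a positive kernel. -/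
lemma genDeriv_eq {k : Fin m → ℝ} {D : ℝ} {w : Fin m → ℂ} (hw : ∀ j, ‖w j‖ < 1) (t : ℝ) :
    genDeriv k D w t = D + ∑ j, k j - ∑ j, k j * poisson (w j) t := by
  unfold genDeriv trigSum
  rw [add_sub_assoc, ← Finset.sum_sub_distrib]
  congr 1
  refine Finset.sum_congr rfl fun j _ => ?_
  rw [poisson_eq (hw j)]
  have : -(2 * (k j : ℂ) * Complex.I * conj (w j)) * e t / (1 - conj (w j) * e t) =
      ((-(2 * k j) : ℝ) : ℂ) * (Complex.I * (conj (w j) * e t / (1 - conj (w j) * e t))) := by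
    push_cast; ring
  rw [this, Complex.im_ofReal_mul, Complex.I_mul_im]
  ring

/-- The derivative of `genLift` along a curve of parameters. -/
lemma hasDerivAt_genLift_curve {k : Fin m → ℝ} {D : ℝ} {θ : ℝ → ℝ} {w : ℝ → Fin m → ℂ} {t : ℝ → ℝ}
    {s θ' t' : ℝ} {w' : Fin m → ℂ} (hθ : HasDerivAt θ θ' s)
    (hw : ∀ j, HasDerivAt (fun x => w x j) (w' j) s) (ht : HasDerivAt t t' s)
    (h : ∀ j, ‖w s j‖ < 1) :
    HasDerivAt (fun x => genLift k D (θ x) (w x) (t x))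
      (trigSum Finset.univ (w s) (fun j => -((k j / Real.pi : ℝ) * conj (w' j))) θ' (e (t s)) +
        genDeriv k D (w s) (t s) * t') s := by
  have h1 : ∀ j, HasDerivAt (fun x => k j / Real.pi * Complex.arg (1 - conj (w x j) * e (t x)))
      (k j / Real.pi * ((-(conj (w' j) * e (t s) + conj (w s j) *
        (t' • (2 * Real.pi * Complex.I * e (t s))))) / (1 - conj (w s j) * e (t s))).im) s := by
    intro j
    refine HasDerivAt.const_mul _ ?_
    have h2 : HasDerivAt (fun x => 1 - conj (w x j) * e (t x))
        (-(conj (w' j) * e (t s) + conj (w s j) *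
          (t' • (2 * Real.pi * Complex.I * e (t s))))) s := by
      have hc : HasDerivAt (fun x => conj (w x j)) (conj (w' j)) s := (hw j).star
      have he : HasDerivAt (fun x => e (t x)) (t' • (2 * Real.pi * Complex.I * e (t s))) s :=
        (hasDerivAt_e (t s)).scomp s ht
      exact (hc.mul he).const_sub 1
    -- The argument is differentiated as the imaginary part of the logarithm; `1 - conj w * z` has
    -- positive real part, which keeps it off the branch cut.
    have h3 := h2.clog_real (one_sub_mem_slitPlane (h j) (norm_e (t s)).le)
    have h4 := (Complex.imCLM.hasFDerivAt.comp_hasDerivAt s h3)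
    refine h4.congr_of_eventuallyEq (Eventually.of_forall fun x => ?_)
    simp [Complex.log_im]
  have h5 := (hθ.add (ht.const_mul D)).add (HasDerivAt.fun_sum (u := Finset.univ) fun j _ => h1 j)
  refine h5.congr_deriv ?_
  unfold genDeriv trigSum
  rw [add_mul, Finset.sum_mul, add_add_add_comm, ← Finset.sum_add_distrib]
  congr 1
  refine Finset.sum_congr rfl fun j _ => ?_
  rw [← Complex.im_ofReal_mul, mul_comm (Complex.im _) t', ← Complex.im_ofReal_mul, ← Complex.add_im]
  congr 1
  have := Real.pi_ne_zero
  have hπ : (Real.pi : ℂ) ≠ 0 := by exact_mod_cast this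
  rw [Complex.real_smul]
  have hne := one_sub_conj_mul_ne_zero (h j) (norm_e (t s)).le
  generalize hd : 1 - conj (w s j) * e (t s) = d
  rw [hd] at hne
  push_cast
  field_simp
  ring

lemma hasDerivAt_genLift {k : Fin m → ℝ} {D θ : ℝ} {w : Fin m → ℂ} (hw : ∀ j, ‖w j‖ < 1) (t : ℝ) :
    HasDerivAt (genLift k D θ w) (genDeriv k D w t) t := by
  have := hasDerivAt_genLift_curve (k := k) (D := D) (hasDerivAt_const t θ)
    (fun j => hasDerivAt_const t (w j)) (hasDerivAt_id t) hw
  refine this.congr_deriv ?_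
  simp [trigSum]

/-- `genLift` is smooth in all its variables. -/
lemma contDiffAt_genLift {k : Fin m → ℝ} {D : ℝ} {n : ℕ∞ω} {p : ℝ × (Fin m → ℂ) × ℝ}
    (h : ∀ j, ‖p.2.1 j‖ < 1) :
    ContDiffAt ℝ n (fun p : ℝ × (Fin m → ℂ) × ℝ => genLift k D p.1 p.2.1 p.2.2) p := by
  unfold genLift
  refine ContDiffAt.add (by fun_prop) (ContDiffAt.sum fun j _ => contDiffAt_const.mul ?_)
  have hw : ContDiffAt ℝ n (fun p : ℝ × (Fin m → ℂ) × ℝ => conj (p.2.1 j)) p :=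
    Complex.conjCLE.contDiff.contDiffAt.comp p (by fun_prop)
  have he : ContDiffAt ℝ n (fun p : ℝ × (Fin m → ℂ) × ℝ => e p.2.2) p :=
    contDiff_e.contDiffAt.comp p (by fun_prop)
  have h1 : ContDiffAt ℝ n (fun p : ℝ × (Fin m → ℂ) × ℝ => 1 - conj (p.2.1 j) * e p.2.2) p :=
    contDiffAt_const.sub (hw.mul he)
  have h2 : ContDiffAt ℝ n Complex.log (1 - conj (p.2.1 j) * e p.2.2) :=
    (Complex.contDiffAt_log (one_sub_mem_slitPlane (h j) (norm_e p.2.2).le)).restrict_scalars ℝ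
  refine (Complex.imCLM.contDiff.contDiffAt.comp p (h2.comp p h1)).congr_of_eventuallyEq
    (Eventually.of_forall fun x => ?_)
  simp [Complex.log_im]

/-- `genDeriv` is smooth in all its variables. -/
lemma contDiffAt_genDeriv {k : Fin m → ℝ} {D : ℝ} {n : ℕ∞ω} {p : (Fin m → ℂ) × ℝ}
    (h : ∀ j, ‖p.1 j‖ < 1) :
    ContDiffAt ℝ n (fun p : (Fin m → ℂ) × ℝ => genDeriv k D p.1 p.2) p := by
  unfold genDeriv trigSum
  refine contDiffAt_const.add (ContDiffAt.sum fun j _ => ?_)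
  have hw : ContDiffAt ℝ n (fun p : (Fin m → ℂ) × ℝ => conj (p.1 j)) p :=
    Complex.conjCLE.contDiff.contDiffAt.comp p (by fun_prop)
  have he : ContDiffAt ℝ n (fun p : (Fin m → ℂ) × ℝ => e p.2) p :=
    contDiff_e.contDiffAt.comp p (by fun_prop)
  have h1 : ContDiffAt ℝ n (fun p : (Fin m → ℂ) × ℝ => -(2 * k j * Complex.I * conj (p.1 j)) *
      e p.2 / (1 - conj (p.1 j) * e p.2)) p := by
    simp only [div_eq_mul_inv]
    exact (((contDiffAt_const.mul hw).neg).mul he).mul ((contDiffAt_const.sub (hw.mul he)).inv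
      (one_sub_conj_mul_ne_zero (h j) (norm_e p.2).le))
  exact Complex.imCLM.contDiff.contDiffAt.comp p h1

lemma contDiff_genDeriv {k : Fin m → ℝ} {D : ℝ} {n : ℕ∞ω} {w : Fin m → ℂ} (h : ∀ j, ‖w j‖ < 1) :
    ContDiff ℝ n (genDeriv k D w) :=
  contDiff_iff_contDiffAt.2 fun t =>
    (contDiffAt_genDeriv (p := (w, t)) h).comp t (contDiffAt_const.prodMk contDiffAt_id)

lemma continuous_genDeriv {k : Fin m → ℝ} {D : ℝ} {w : Fin m → ℂ} (h : ∀ j, ‖w j‖ < 1) :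
    Continuous (genDeriv k D w) := (contDiff_genDeriv (n := 0) h).continuous

lemma continuous_genLift {k : Fin m → ℝ} {D θ : ℝ} {w : Fin m → ℂ} (h : ∀ j, ‖w j‖ < 1) :
    Continuous (genLift k D θ w) :=
  continuous_iff_continuousAt.2 fun t => (hasDerivAt_genLift h t).continuousAt

lemma genLift_add_int (k : Fin m → ℝ) (D θ : ℝ) (w : Fin m → ℂ) (t : ℝ) (n : ℤ) :
    genLift k D θ w (t + n) = genLift k D θ w t + D * n := by
  unfold genLift; simp only [e_add_int]; ring

lemma genLift_add_one (k : Fin m → ℝ) (D θ : ℝ) (w : Fin m → ℂ) (t : ℝ) :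
    genLift k D θ w (t + 1) = genLift k D θ w t + D := by
  simpa using genLift_add_int k D θ w t 1

lemma genDeriv_add_int (k : Fin m → ℝ) (D : ℝ) (w : Fin m → ℂ) (t : ℝ) (n : ℤ) :
    genDeriv k D w (t + n) = genDeriv k D w t := by
  unfold genDeriv; rw [e_add_int]

end genLift

/-! ### The parameters -/

section param
variable {m : ℕ}

/-- The pole `1 / conj a_j` of the Blaschke product in the unit disk. -/
noncomputable def pole (μ : Fin (2 * m) → ℝ) (j : Fin m) : ℂ :=
  ((modulus μ j)⁻¹ : ℝ) * e (angle μ j)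

/-- The constant term of the lift. -/
noncomputable def shift (κ : Fin (m + 1) → ℕ) (μ : Fin (2 * m) → ℝ) : ℝ :=
  coord μ 0 + ∑ j : Fin m, (κ j.succ : ℝ) * (2 * angle μ j + 1)

/-- The orders of the poles as real numbers. -/
def order (κ : Fin (m + 1) → ℕ) (j : Fin m) : ℝ := κ j.succ

lemma norm_pole {μ : Fin (2 * m) → ℝ} {j : Fin m} (h : 1 < modulus μ j) :
    ‖pole μ j‖ = (modulus μ j)⁻¹ := by
  unfold pole
  rw [norm_mul, norm_e, mul_one, Complex.norm_real, Real.norm_of_nonneg (by positivity)]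

lemma norm_pole_lt {μ : Fin (2 * m) → ℝ} {j : Fin m} (h : 1 < modulus μ j) : ‖pole μ j‖ < 1 := by
  rw [norm_pole h]; exact inv_lt_one_of_one_lt₀ h

lemma zero_ne_zero {μ : Fin (2 * m) → ℝ} {j : Fin m} (h : 1 < modulus μ j) : zero μ j ≠ 0 := by
  unfold zero
  refine mul_ne_zero ?_ (e_ne_zero _)
  exact_mod_cast (by linarith : modulus μ j ≠ 0)

lemma norm_zero {μ : Fin (2 * m) → ℝ} {j : Fin m} (h : 1 < modulus μ j) :
    ‖zero μ j‖ = modulus μ j := by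
  unfold zero
  rw [norm_mul, norm_e, mul_one, Complex.norm_real, Real.norm_of_nonneg (by linarith)]

lemma conj_pole {μ : Fin (2 * m) → ℝ} {j : Fin m} : conj (pole μ j) = (zero μ j)⁻¹ := by
  unfold pole zero
  rw [map_mul, conj_e, Complex.conj_ofReal, mul_inv]; push_cast; rfl

lemma pole_eq {μ : Fin (2 * m) → ℝ} {j : Fin m} : pole μ j = (conj (zero μ j))⁻¹ := by
  rw [← map_inv₀, ← conj_pole, Complex.conj_conj]

/-- All later estimates use the poles instead of the zeros. The terms `-k_j t` turn `k_0` into the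
degree, and the constants `2 η_j + 1` are collected in `shift`. -/
lemma lift_eq_genLift (κ : Fin (m + 1) → ℕ) (μ : Fin (2 * m) → ℝ) :
    lift κ μ = genLift (order κ) (degree κ) (shift κ μ) (pole μ) := by
  funext t
  unfold lift genLift shift order phase degree
  simp only [conj_pole, Int.cast_sub, Int.cast_natCast, Int.cast_sum, div_eq_inv_mul (e t)]
  have h : ∀ j : Fin m, (κ j.succ : ℝ) * (2 * (angle μ j + 1 / 2 +
      Complex.arg (1 - (zero μ j)⁻¹ * e t) / (2 * Real.pi)) - t) =
      (κ j.succ : ℝ) * (2 * angle μ j + 1) + -(κ j.succ * t) +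
        κ j.succ / Real.pi * Complex.arg (1 - (zero μ j)⁻¹ * e t) := by
    intro j
    have := Real.pi_ne_zero
    field_simp
    ring
  rw [Finset.sum_congr rfl fun j _ => h j, Finset.sum_add_distrib, Finset.sum_add_distrib,
    Finset.sum_neg_distrib, ← Finset.sum_mul]
  ring

end param


/-! ### Turning points -/

section sequence
variable {m : ℕ} {C : ℤ → ℝ}

lemma periodic_nat (hp : ∀ i, C (i + 2 * m) = C i + 1) (i : ℤ) (n : ℕ) :
    C (i + 2 * m * n) = C i + n := by
  induction n with
  | zero => simp
  | succ n ih =>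
    have : i + 2 * m * ((n + 1 : ℕ) : ℤ) = (i + 2 * m * n) + 2 * m := by push_cast; ring
    rw [this, hp, ih]; push_cast; ring

lemma periodic_int (hp : ∀ i, C (i + 2 * m) = C i + 1) (i n : ℤ) :
    C (i + 2 * m * n) = C i + n := by
  obtain ⟨k, rfl | rfl⟩ := n.eq_nat_or_neg
  · exact_mod_cast periodic_nat hp i k
  · have := periodic_nat hp (i + 2 * m * (-k : ℤ)) k
    rw [show i + 2 * m * (-k : ℤ) + 2 * m * k = i by ring] at this
    rw [this]; push_cast; ring

lemma pos_of_periodic (hp : ∀ i, C (i + 2 * m) = C i + 1) : 0 < m := by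
  rcases Nat.eq_zero_or_pos m with rfl | h
  · have := hp 0; simp at this
  · exact h

lemma exists_mem_Ico (hC : StrictMono C) (hp : ∀ i, C (i + 2 * m) = C i + 1) (t : ℝ) :
    ∃ i, C i ≤ t ∧ t < C (i + 1) := by
  have h1 : ∃ i, C i ≤ t := by
    refine ⟨0 + 2 * m * (⌊t - C 0⌋), ?_⟩
    rw [periodic_int hp]
    linarith [Int.floor_le (t - C 0)]
  have h2 : ∃ b, ∀ i, C i ≤ t → i ≤ b := by
    refine ⟨0 + 2 * m * (⌊t - C 0⌋ + 1), fun i hi => ?_⟩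
    by_contra hlt
    have := hC (not_le.1 hlt)
    rw [periodic_int hp] at this
    have h3 := Int.lt_floor_add_one (t - C 0)
    push_cast at this
    linarith
  obtain ⟨i, hi, hmax⟩ := Int.exists_greatest_of_bdd h2 h1
  refine ⟨i, hi, ?_⟩
  by_contra h
  have := hmax _ (not_lt.1 h)
  omega

lemma sub_lt_of_periodic (hC : StrictMono C) (hp : ∀ i, C (i + 2 * m) = C i + 1) {i i' : ℤ}
    (h : i' < i + 2 * m) : C i' < C i + 1 := by
  rw [← hp]; exact hC h

/-- The sequence `C` consists of zeros of `g`, and `g` takes values of alternating signs between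
them. -/
structure Alternates (m : ℕ) (g : ℝ → ℝ) (C : ℤ → ℝ) : Prop where
  strictMono : StrictMono C
  periodic : ∀ i, C (i + 2 * m) = C i + 1
  zero : ∀ i, g (C i) = 0
  neg : ∀ j : ℤ, ∃ x ∈ Ioo (C (2 * j - 1)) (C (2 * j)), g x < 0
  pos : ∀ j : ℤ, ∃ x ∈ Ioo (C (2 * j)) (C (2 * j + 1)), 0 < g x

end sequence

/-! ### Turning points as the simple zeros of the derivative -/

section multimodal
variable {m : ℕ} {k : Fin m → ℝ} {D θ : ℝ} {d : ℤ} {w : Fin m → ℂ} {C : ℤ → ℝ}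

/-- Together with `Alternates.isMultimodalLift` this turns multimodality into a sign condition on
the derivative, in which the constant term `θ` no longer occurs. -/
lemma IsMultimodalLift.alternates (h : IsMultimodalLift m d (genLift k D θ w) C)
    (hw : ∀ j, ‖w j‖ < 1) : Alternates m (genDeriv k D w) C where
  strictMono := h.strictMono
  periodic := h.periodic
  zero i := by
    have hd := hasDerivAt_genLift (k := k) (D := D) (θ := θ) hw (C i)
    rcases Int.even_or_odd' i with ⟨j, rfl | rfl⟩
    · refine IsLocalMin.hasDerivAt_eq_zero ?_ hd
      have h1 : C (2 * j - 1) < C (2 * j) := h.strictMono (by omega)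
      have h2 : C (2 * j) < C (2 * j + 1) := h.strictMono (by omega)
      filter_upwards [Icc_mem_nhds h1 h2] with x hx
      rcases le_total x (C (2 * j)) with hle | hle
      · exact (h.decreasing j).antitoneOn ⟨hx.1, hle⟩ ⟨h1.le, le_rfl⟩ hle
      · exact (h.increasing j).monotoneOn ⟨le_rfl, h2.le⟩ ⟨hle, hx.2⟩ hle
    · refine IsLocalMax.hasDerivAt_eq_zero ?_ hd
      have h1 : C (2 * j) < C (2 * j + 1) := h.strictMono (by omega)
      have h2 : C (2 * j + 1) < C (2 * (j + 1)) := h.strictMono (by omega)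
      have hdec := h.decreasing (j + 1)
      rw [show 2 * (j + 1) - 1 = 2 * j + 1 by ring] at hdec
      filter_upwards [Icc_mem_nhds h1 h2] with x hx
      rcases le_total x (C (2 * j + 1)) with hle | hle
      · exact (h.increasing j).monotoneOn ⟨hx.1, hle⟩ ⟨h1.le, le_rfl⟩ hle
      · exact hdec.antitoneOn ⟨le_rfl, h2.le⟩ ⟨hle, hx.2⟩ hle
  neg j := by
    have h1 : C (2 * j - 1) < C (2 * j) := h.strictMono (by omega)
    obtain ⟨x, hx, hs⟩ := exists_hasDerivAt_eq_slope (genLift k D θ w) (genDeriv k D w) h1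
      (continuous_genLift hw).continuousOn (fun x _ => hasDerivAt_genLift hw x)
    refine ⟨x, hx, ?_⟩
    rw [hs]
    exact div_neg_of_neg_of_pos (sub_neg.2 (h.decreasing j ⟨le_rfl, h1.le⟩ ⟨h1.le, le_rfl⟩ h1))
      (sub_pos.2 h1)
  pos j := by
    have h1 : C (2 * j) < C (2 * j + 1) := h.strictMono (by omega)
    obtain ⟨x, hx, hs⟩ := exists_hasDerivAt_eq_slope (genLift k D θ w) (genDeriv k D w) h1
      (continuous_genLift hw).continuousOn (fun x _ => hasDerivAt_genLift hw x)
    refine ⟨x, hx, ?_⟩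
    rw [hs]
    exact div_pos (sub_pos.2 (h.increasing j ⟨le_rfl, h1.le⟩ ⟨h1.le, le_rfl⟩ h1)) (sub_pos.2 h1)

namespace Alternates

lemma m_pos (h : Alternates m (genDeriv k D w) C) : 0 < m := pos_of_periodic h.periodic

/-- The zeros of one period. -/
lemma finset_zeros {g : ℝ → ℝ} (h : Alternates m g C) :
    ∃ T : Finset ℝ, T.card = 2 * m ∧ (∀ t ∈ T, t ∈ Ico (C 1) (C 1 + 1)) ∧ (∀ t ∈ T, g t = 0) ∧
      ∀ i ∈ Icc (1 : ℤ) (2 * m), C i ∈ T := by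
  refine ⟨(Finset.Icc (1 : ℤ) (2 * m)).image C, ?_, ?_, ?_, ?_⟩
  · rw [Finset.card_image_of_injective _ h.strictMono.injective, Int.card_Icc]; omega
  · intro t ht
    obtain ⟨i, hi, rfl⟩ := Finset.mem_image.1 ht
    obtain ⟨h1, h2⟩ := Finset.mem_Icc.1 hi
    exact ⟨h.strictMono.monotone h1, sub_lt_of_periodic h.strictMono h.periodic (by omega)⟩
  · intro t ht
    obtain ⟨i, hi, rfl⟩ := Finset.mem_image.1 ht
    exact h.zero i
  · intro i hi
    exact Finset.mem_image_of_mem _ (Finset.mem_Icc.2 hi)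

lemma not_forall_zero {g : ℝ → ℝ} (h : Alternates m g C) : ¬ ∀ t, g t = 0 := by
  intro h0
  obtain ⟨x, _, hx⟩ := h.pos 0
  exact hx.ne' (h0 x)

/-- The turning points of one period already attain the maximal number of zeros. A further zero,
translated into the same period, would make the derivative vanish identically, against its
alternating signs. -/
lemma eq_of_zero (h : Alternates m (genDeriv k D w) C) (hw : ∀ j, ‖w j‖ < 1) {t : ℝ}
    (ht : genDeriv k D w t = 0) : ∃ i, t = C i := by
  classical
  obtain ⟨T, hcard, hT, hzero, -⟩ := h.finset_zeros
  by_contra hne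
  push Not at hne
  set n := ⌊t - C 1⌋
  set t' := t + ((-n : ℤ) : ℝ) with ht'
  have hmem : t' ∈ Ico (C 1) (C 1 + 1) := by
    have h1 := Int.floor_le (t - C 1)
    have h2 := Int.lt_floor_add_one (t - C 1)
    rw [ht']; push_cast
    constructor <;> linarith
  have hz' : genDeriv k D w t' = 0 := by rw [ht', genDeriv_add_int, ht]
  have hnot : t' ∉ (Finset.Icc (1 : ℤ) (2 * m)).image C := by
    intro hm
    obtain ⟨i, -, hi⟩ := Finset.mem_image.1 hm
    refine hne (i + 2 * m * n) ?_
    rw [periodic_int h.periodic, hi, ht']; push_cast; ring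
  refine h.not_forall_zero fun s => trigSum_eq_zero_of_card (fun j _ => hw j)
    (T := insert t' ((Finset.Icc (1 : ℤ) (2 * m)).image C)) (x := C 1) ?_ ?_ ?_ s
  · intro u hu
    rcases Finset.mem_insert.1 hu with rfl | hu
    · exact hmem
    · obtain ⟨i, hi, rfl⟩ := Finset.mem_image.1 hu
      obtain ⟨h1, h2⟩ := Finset.mem_Icc.1 hi
      exact ⟨h.strictMono.monotone h1, sub_lt_of_periodic h.strictMono h.periodic (by omega)⟩
  · intro u hu
    rcases Finset.mem_insert.1 hu with rfl | hu
    · exact hz'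
    · obtain ⟨i, -, rfl⟩ := Finset.mem_image.1 hu
      exact h.zero i
  · rw [Finset.card_insert_of_notMem hnot,
      Finset.card_image_of_injective _ h.strictMono.injective, Int.card_Icc, Finset.card_univ,
      Fintype.card_fin]
    omega

lemma not_zero_of_mem_Ioo (h : Alternates m (genDeriv k D w) C) (hw : ∀ j, ‖w j‖ < 1) {i : ℤ}
    {t : ℝ} (ht : t ∈ Ioo (C i) (C (i + 1))) : genDeriv k D w t ≠ 0 := by
  intro h0
  obtain ⟨l, rfl⟩ := h.eq_of_zero hw h0
  have h1 := h.strictMono.lt_iff_lt.1 ht.1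
  have h2 := h.strictMono.lt_iff_lt.1 ht.2
  omega

lemma same_sign (h : Alternates m (genDeriv k D w) C) (hw : ∀ j, ‖w j‖ < 1) {i : ℤ}
    {x y : ℝ} (hx : x ∈ Ioo (C i) (C (i + 1))) (hy : y ∈ Ioo (C i) (C (i + 1)))
    (hneg : genDeriv k D w x < 0) : genDeriv k D w y < 0 := by
  by_contra hge
  have hmem : (0 : ℝ) ∈ uIcc (genDeriv k D w x) (genDeriv k D w y) := by
    rw [uIcc_of_le (hneg.le.trans (not_lt.1 hge))]; exact ⟨hneg.le, not_lt.1 hge⟩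
  obtain ⟨z, hz, hz0⟩ := intermediate_value_uIcc (continuous_genDeriv hw).continuousOn hmem
  exact h.not_zero_of_mem_Ioo hw ((ordConnected_Ioo.uIcc_subset hx hy) hz) hz0

lemma neg_of_mem (h : Alternates m (genDeriv k D w) C) (hw : ∀ j, ‖w j‖ < 1) {j : ℤ}
    {t : ℝ} (ht : t ∈ Ioo (C (2 * j - 1)) (C (2 * j))) : genDeriv k D w t < 0 := by
  obtain ⟨x, hx, hx0⟩ := h.neg j
  have he : 2 * j = 2 * j - 1 + 1 := by ring
  rw [he] at hx ht
  rw [show 2 * j - 1 + 1 - 1 = 2 * j - 1 by ring] at hx ht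
  exact h.same_sign hw hx ht hx0

lemma pos_of_mem (h : Alternates m (genDeriv k D w) C) (hw : ∀ j, ‖w j‖ < 1) {j : ℤ}
    {t : ℝ} (ht : t ∈ Ioo (C (2 * j)) (C (2 * j + 1))) : 0 < genDeriv k D w t := by
  obtain ⟨x, hx, hx0⟩ := h.pos j
  by_contra hle
  have hne := h.not_zero_of_mem_Ioo hw ht
  exact absurd (h.same_sign hw ht hx (lt_of_le_of_ne (not_lt.1 hle) hne)) (not_lt.2 hx0.le)

lemma isMultimodalLift (h : Alternates m (genDeriv k d w) C) (hw : ∀ j, ‖w j‖ < 1) :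
    IsMultimodalLift m d (genLift k d θ w) C where
  continuous := continuous_genLift hw
  degree := genLift_add_one k d θ w
  strictMono := h.strictMono
  periodic := h.periodic
  decreasing j := by
    refine strictAntiOn_of_deriv_neg (convex_Icc _ _) (continuous_genLift hw).continuousOn ?_
    intro x hx
    rw [interior_Icc] at hx
    rw [(hasDerivAt_genLift hw x).deriv]
    exact h.neg_of_mem hw hx
  increasing j := by
    refine strictMonoOn_of_deriv_pos (convex_Icc _ _) (continuous_genLift hw).continuousOn ?_
    intro x hx
    rw [interior_Icc] at hx
    rw [(hasDerivAt_genLift hw x).deriv]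
    exact h.pos_of_mem hw hx

/-- The poles are distinct and nonzero. -/
lemma injective_pole (h : Alternates m (genDeriv k D w) C) (hw : ∀ j, ‖w j‖ < 1) :
    Function.Injective w ∧ ∀ j, w j ≠ 0 := by
  classical
  obtain ⟨T, hcard, hT, hzero, -⟩ := h.finset_zeros
  set s := (Finset.univ : Finset (Fin m)).filter (fun j => w j ≠ 0)
  have hs : ∀ t, genDeriv k D w t =
      trigSum s w (fun j => -(2 * k j * Complex.I * conj (w j))) D (e t) := by
    intro t
    unfold genDeriv trigSum
    congr 1
    symm
    refine Finset.sum_subset (Finset.filter_subset _ _) fun j _ hj => ?_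
    have : w j = 0 := by simpa [s] using hj
    simp [this]
  -- Terms with `w j = 0` vanish and terms with equal poles merge, so the bound on the zeros
  -- involves only the number of distinct nonzero poles.
  have hle : 2 * m ≤ 2 * (s.image w).card := by
    by_contra hlt
    refine h.not_forall_zero fun t => ?_
    rw [hs, trigSum_image]
    refine trigSum_eq_zero_of_card ?_ hT (fun u hu => ?_) (by omega) t
    · intro v hv
      obtain ⟨j, -, rfl⟩ := Finset.mem_image.1 hv
      exact hw j
    · rw [← trigSum_image, ← hs, hzero u hu]
  have h1 : (s.image w).card ≤ s.card := Finset.card_image_le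
  have h2 : s.card ≤ m := by simpa using Finset.card_le_univ s
  have h3 : s = Finset.univ := by
    rw [← Finset.card_eq_iff_eq_univ, Fintype.card_fin]; omega
  constructor
  · have h4 : (s.image w).card = s.card := by omega
    have := Finset.card_image_iff.1 h4
    rw [h3, Finset.coe_univ] at this
    exact injOn_univ.1 this
  · intro j
    have : j ∈ s := by rw [h3]; exact Finset.mem_univ j
    exact (Finset.mem_filter.1 this).2

/-- A degenerate turning point would count twice and raise the number of zeros above the bound. -/
lemma deriv_ne_zero (h : Alternates m (genDeriv k D w) C) (hw : ∀ j, ‖w j‖ < 1) (i : ℤ) :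
    deriv (genDeriv k D w) (C i) ≠ 0 := by
  intro h0
  classical
  have hm := h.m_pos
  have hd : HasDerivAt (genDeriv k D w) 0 (C i) := by
    rw [← h0]
    exact ((contDiff_genDeriv (n := 1) hw).differentiable (by norm_num)).differentiableAt.hasDerivAt
  have hcard : ((Finset.Ico i (i + 2 * m)).image C).card = 2 * m := by
    rw [Finset.card_image_of_injective _ h.strictMono.injective, Int.card_Ico]; omega
  refine h.not_forall_zero fun t => trigSum_eq_zero_of_card_of_deriv (fun j _ => hw j)
    (T := (Finset.Ico i (i + 2 * m)).image C) (x := C i) ?_ ?_ ?_ (t₀ := C i) ?_ hd t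
  · intro t ht
    obtain ⟨l, hl, rfl⟩ := Finset.mem_image.1 ht
    obtain ⟨h1, h2⟩ := Finset.mem_Ico.1 hl
    exact ⟨h.strictMono.monotone h1, sub_lt_of_periodic h.strictMono h.periodic h2⟩
  · intro t ht
    obtain ⟨l, hl, rfl⟩ := Finset.mem_image.1 ht
    exact h.zero l
  · rw [hcard]; simp
  · exact Finset.mem_image_of_mem _ (Finset.mem_Ico.2 ⟨le_rfl, by omega⟩)

lemma hasDerivAt_genDeriv (hw : ∀ j, ‖w j‖ < 1) (t : ℝ) :
    HasDerivAt (genDeriv k D w) (deriv (genDeriv k D w) t) t :=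
  ((contDiff_genDeriv (n := 1) hw).differentiable (by norm_num)).differentiableAt.hasDerivAt

lemma deriv_neg (h : Alternates m (genDeriv k D w) C) (hw : ∀ j, ‖w j‖ < 1) (j : ℤ) :
    deriv (genDeriv k D w) (C (2 * j - 1)) < 0 := by
  refine lt_of_le_of_ne ?_ (h.deriv_ne_zero hw _)
  by_contra hpos
  have h1 := (hasDerivAt_genDeriv (k := k) (D := D) hw (C (2 * j - 1))).tendsto_slope
  have h2 := h1.eventually (lt_mem_nhds (not_le.1 hpos))
  have h3 : ∀ᶠ x in 𝓝[>] (C (2 * j - 1)), 0 < slope (genDeriv k D w) (C (2 * j - 1)) x :=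
    h2.filter_mono (nhdsWithin_mono _ fun x hx => ne_of_gt hx)
  have h4 : C (2 * j - 1) < C (2 * j) := h.strictMono (by omega)
  obtain ⟨x, hx, hx'⟩ := (h3.and (Ioo_mem_nhdsGT h4)).exists
  have h5 := h.neg_of_mem hw hx'
  rw [slope_def_field, h.zero, sub_zero] at hx
  exact absurd hx (not_lt.2 (div_nonpos_of_nonpos_of_nonneg h5.le (sub_nonneg.2 hx'.1.le)))

lemma deriv_pos (h : Alternates m (genDeriv k D w) C) (hw : ∀ j, ‖w j‖ < 1) (j : ℤ) :
    0 < deriv (genDeriv k D w) (C (2 * j)) := by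
  refine lt_of_le_of_ne ?_ (h.deriv_ne_zero hw _).symm
  by_contra hneg
  have h1 := (hasDerivAt_genDeriv (k := k) (D := D) hw (C (2 * j))).tendsto_slope
  have h2 := h1.eventually (gt_mem_nhds (not_le.1 hneg))
  have h3 : ∀ᶠ x in 𝓝[>] (C (2 * j)), slope (genDeriv k D w) (C (2 * j)) x < 0 :=
    h2.filter_mono (nhdsWithin_mono _ fun x hx => ne_of_gt hx)
  have h4 : C (2 * j) < C (2 * j + 1) := h.strictMono (by omega)
  obtain ⟨x, hx, hx'⟩ := (h3.and (Ioo_mem_nhdsGT h4)).exists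
  have h5 := h.pos_of_mem hw hx'
  rw [slope_def_field, h.zero, sub_zero] at hx
  exact absurd hx (not_lt.2 (div_nonneg h5.le (sub_nonneg.2 hx'.1.le)))

/-- The turning points are unique up to a shift of the index. -/
lemma exists_shift {C' : ℤ → ℝ} (h : Alternates m (genDeriv k D w) C)
    (h' : Alternates m (genDeriv k D w) C') (hw : ∀ j, ‖w j‖ < 1) :
    ∃ l : ℤ, ∀ i, C' i = C (i + 2 * l) := by
  have hf : ∀ i, ∃ l, C' i = C l := fun i => h.eq_of_zero hw (h'.zero i)
  have hb : ∀ i, ∃ l, C i = C' l := fun i => h'.eq_of_zero hw (h.zero i)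
  choose f hf using hf
  have hmono : StrictMono f := by
    intro a b hab
    have := h'.strictMono hab
    rw [hf, hf] at this
    exact h.strictMono.lt_iff_lt.1 this
  have hstep : ∀ i, f (i + 1) = f i + 1 := by
    intro i
    by_contra hne
    have h1 := hmono (show i < i + 1 by omega)
    obtain ⟨l, hl⟩ := hb (f i + 1)
    have h2 : C' i < C' l := by rw [← hl, hf]; exact h.strictMono (by omega)
    have h3 : C' l < C' (i + 1) := by rw [← hl, hf]; exact h.strictMono (by omega)
    have h4 := h'.strictMono.lt_iff_lt.1 h2
    have h5 := h'.strictMono.lt_iff_lt.1 h3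
    omega
  have hlin : ∀ i, f i = f 0 + i := by
    intro i
    induction i using Int.induction_on with
    | zero => simp
    | succ n ih => rw [hstep, ih]; ring
    | pred n ih =>
      have := hstep (-n - 1)
      rw [show (-n - 1 + 1 : ℤ) = -n by ring, ih] at this
      omega
  -- An odd shift would exchange maxima and minima, which the sign of the second derivative forbids.
  have heven : Even (f 0) := by
    by_contra hodd
    obtain ⟨l, hl⟩ := Int.not_even_iff_odd.1 hodd
    have h1 := h.deriv_neg hw (l + 1)
    have h2 := h'.deriv_pos hw 0
    rw [mul_zero, hf, hl] at h2
    rw [show 2 * (l + 1) - 1 = 2 * l + 1 by ring] at h1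
    linarith
  obtain ⟨l, hl⟩ := heven
  refine ⟨l, fun i => ?_⟩
  rw [hf, hlin, hl]; congr 1; ring

lemma comp_shift {g : ℝ → ℝ} (h : Alternates m g C) (l : ℤ) :
    Alternates m g (fun i => C (i + 2 * l)) where
  strictMono := fun a b hab => h.strictMono (by omega)
  periodic i := by
    show C (i + 2 * m + 2 * l) = _
    rw [show i + 2 * m + 2 * l = i + 2 * l + 2 * m by ring, h.periodic]
  zero i := h.zero _
  neg j := by
    have := h.neg (j + l)
    rw [show 2 * (j + l) - 1 = 2 * j - 1 + 2 * l by ring, show 2 * (j + l) = 2 * j + 2 * l by ring]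
      at this
    exact this
  pos j := by
    have := h.pos (j + l)
    rw [show 2 * (j + l) + 1 = 2 * j + 1 + 2 * l by ring, show 2 * (j + l) = 2 * j + 2 * l by ring]
      at this
    exact this

end Alternates
end multimodal


/-! ### Crossing paths in the unit disk -/

lemma re_mul_conj_e_lt_one {z : ℂ} {c : ℝ} (hz : ‖z‖ ≤ 1) (hne : z ≠ e c) :
    (z * conj (e c)).re < 1 := by
  set x := z * conj (e c) with hx
  have hxn : ‖x‖ ≤ 1 := by rw [hx, norm_mul, RCLike.norm_conj, norm_e, mul_one]; exact hz
  refine lt_of_le_of_ne ((Complex.re_le_norm x).trans hxn) fun h1 => hne ?_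
  have h2 : Complex.normSq x ≤ 1 := by
    rw [Complex.normSq_eq_norm_sq]; nlinarith [norm_nonneg x]
  rw [Complex.normSq_apply, h1] at h2
  have h3 : x.im = 0 := by nlinarith [mul_self_nonneg x.im]
  have h4 : x = 1 := Complex.ext (by simpa using h1) (by simpa using h3)
  rw [hx, conj_e] at h4
  field_simp [e_ne_zero] at h4
  exact h4

/-- An angle that stays within a quarter turn of `c` modulo `1` keeps its nearest integer: passing
to another one would require `|g - c - n| = 1 / 4`, where the cosine vanishes. -/
lemma exists_int_abs_sub_lt {g : unitInterval → ℝ} (hg : Continuous g) {c : ℝ}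
    (h : ∀ y, 0 < Real.cos (2 * Real.pi * (g y - c))) : ∃ n : ℤ, ∀ y, |g y - c - n| < 1 / 4 := by
  have hcos : ∀ (n : ℤ) y, 0 < Real.cos (2 * Real.pi * |g y - c - n|) := by
    intro n y
    have h1 : Real.cos (2 * Real.pi * |g y - c - n|) = Real.cos (2 * Real.pi * (g y - c - n)) := by
      rw [← Real.cos_abs (2 * Real.pi * (g y - c - n)), abs_mul,
        abs_of_pos (by positivity : 0 < 2 * Real.pi)]
    rw [h1, mul_sub, mul_comm _ (n : ℝ), Real.cos_sub_int_mul_two_pi]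
    exact h y
  set n := round (g 0 - c)
  refine ⟨n, ?_⟩
  have h0 : |g 0 - c - n| < 1 / 4 := by
    have h1 := abs_sub_round (g 0 - c)
    by_contra hge
    have h2 := hcos n 0
    have h3 : Real.cos (2 * Real.pi * |g 0 - c - n|) ≤ 0 := by
      apply Real.cos_nonpos_of_pi_div_two_le_of_le <;> nlinarith [Real.pi_pos, not_lt.1 hge]
    linarith
  intro y
  by_contra hge
  have hc : Continuous fun y => |g y - c - n| := by fun_prop
  obtain ⟨z, hz⟩ := mem_range_of_exists_le_of_exists_ge hc ⟨0, h0.le⟩ ⟨y, not_lt.1 hge⟩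
  have h2 := hcos n z
  have hz' : |g z - c - n| = 1 / 4 := hz
  rw [hz', show 2 * Real.pi * (1 / 4) = Real.pi / 2 by ring, Real.cos_pi_div_two] at h2
  exact lt_irrefl _ h2

lemma int_eq_of_abs {x : ℝ} {n : ℤ} (h : |x + n| < 1 / 2) (l : ℤ) (h1 : -1 / 2 < x + l)
    (h2 : x + l < 1 / 2) : n = l := by
  have h3 := abs_lt.1 h
  have h4 : (n : ℝ) < l + 1 := by linarith
  have h5 : (l : ℝ) < n + 1 := by linarith
  have h6 : n < l + 1 := by exact_mod_cast h4
  have h7 : l < n + 1 := by exact_mod_cast h5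
  omega

/-- Paths in the closed unit disk whose end points on the circle are interlaced must meet. -/
lemma not_joinedIn_of_interlaced {S₁ S₂ : Set ℂ} {a b p q : ℝ} (hap : a < p) (hpb : p < b)
    (hbq : b < q) (hqa : q < a + 1) (hS₁ : ∀ z ∈ S₁, ‖z‖ ≤ 1) (hS₂ : ∀ z ∈ S₂, ‖z‖ ≤ 1)
    (hd : Disjoint S₁ S₂) (h₁ : JoinedIn S₁ (e a) (e b)) (h₂ : JoinedIn S₂ (e p) (e q)) :
    False := by
  obtain ⟨α, hα⟩ := h₁
  obtain ⟨β, hβ⟩ := h₂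
  have hne : ∀ x y, α x ≠ β y := fun x y h => disjoint_left.1 hd (hα x) (h ▸ hβ y)
  -- If the paths do not meet, `α x - β y` has no zero on the square and therefore a continuous
  -- angle `g`. On each side of the square one path rests at an end point on the circle; as the
  -- other path stays in the disk, the difference stays in an open half plane, whose axis is at the
  -- angle `a`, `p - 1/2`, `b` or `q - 1/2`.
  let f : C(unitInterval × unitInterval, ℂ) :=
    ⟨fun z => α z.1 - β z.2, by fun_prop⟩
  have hf : ∀ z, f z ∈ ({0}ᶜ : Set ℂ) := fun z => sub_ne_zero.2 (hne z.1 z.2)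
  have hI : ContractibleSpace unitInterval :=
    (convex_Icc (0 : ℝ) 1).contractibleSpace (nonempty_Icc.2 zero_le_one)
  have hI2 : LocallyPathConnectedSpace unitInterval :=
    (convex_Icc (0 : ℝ) 1).locallyPathConnectedSpace
  obtain ⟨L, ⟨-, hL⟩, -⟩ := Complex.isCoveringMapOn_exp.existsUnique_continuousMap_lifts f
    (a₀ := (0, 0)) (e₀ := Complex.log (f (0, 0))) (Complex.exp_log (hf (0, 0))) hf
  set g : unitInterval × unitInterval → ℝ := fun z => (L z).im / (2 * Real.pi) with hg
  have hgc : Continuous g := by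
    rw [hg]; exact (Complex.continuous_im.comp L.continuous).div_const _
  have hfg : ∀ z, f z = (Real.exp (L z).re : ℂ) * e (g z) := by
    intro z
    have h1 : f z = Complex.exp (L z) := (congrFun hL z).symm
    have hπ := Real.pi_ne_zero
    rw [h1, e_eq, hg]
    have h2 : 2 * Real.pi * ((L z).im / (2 * Real.pi)) = (L z).im := by field_simp
    rw [h2, Complex.ofReal_exp, ← Complex.exp_add, Complex.re_add_im]
  have hcos : ∀ z c, 0 < (f z * conj (e c)).re → 0 < Real.cos (2 * Real.pi * (g z - c)) := by
    intro z c h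
    rw [hfg, conj_e, mul_assoc, Complex.re_ofReal_mul] at h
    have h1 : e (g z) * (e c)⁻¹ = e (g z - c) := by
      rw [mul_inv_eq_iff_eq_mul₀ (e_ne_zero c), ← e_add]; congr 1; ring
    rw [h1, e_re] at h
    exact (mul_pos_iff_of_pos_left (Real.exp_pos _)).1 h
  have hee : ∀ c, e c * conj (e c) = 1 := fun c => by
    rw [conj_e, mul_inv_cancel₀ (e_ne_zero c)]
  have hhalf : ∀ c : ℝ, e (c - 1 / 2) = -e c := by
    intro c
    have h1 : e (1 / 2) = -1 := by
      rw [e_eq, show 2 * Real.pi * (1 / 2) = Real.pi by ring, Complex.exp_pi_mul_I]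
    have h2 : e c = e (c - 1 / 2) * e (1 / 2) := by rw [← e_add]; congr 1; ring
    rw [h2, h1]; ring
  have key₁ : ∀ (c : ℝ) (z : ℂ), ‖z‖ ≤ 1 → z ≠ e c → 0 < ((e c - z) * conj (e c)).re := by
    intro c z hz hzc
    have := re_mul_conj_e_lt_one hz hzc
    rw [sub_mul, hee, Complex.sub_re, Complex.one_re]; linarith
  have key₂ : ∀ (c : ℝ) (z : ℂ), ‖z‖ ≤ 1 → z ≠ e c →
      0 < ((z - e c) * conj (e (c - 1 / 2))).re := by
    intro c z hz hzc
    have := key₁ c z hz hzc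
    rw [hhalf, map_neg, mul_neg, ← neg_mul, neg_sub]; exact this
  obtain ⟨n₁, hn₁⟩ := exists_int_abs_sub_lt (g := fun y => g (0, y)) (by fun_prop) (c := a)
    fun y => hcos _ _ (by
      change 0 < ((α 0 - β y) * _).re
      rw [α.source]; exact key₁ a _ (hS₂ _ (hβ y)) (by rw [← α.source]; exact (hne 0 y).symm))
  obtain ⟨n₂, hn₂⟩ := exists_int_abs_sub_lt (g := fun x => g (x, 0)) (by fun_prop) (c := p - 1 / 2)
    fun x => hcos _ _ (by
      change 0 < ((α x - β 0) * _).re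
      rw [β.source]; exact key₂ p _ (hS₁ _ (hα x)) (by rw [← β.source]; exact hne x 0))
  obtain ⟨n₃, hn₃⟩ := exists_int_abs_sub_lt (g := fun y => g (1, y)) (by fun_prop) (c := b)
    fun y => hcos _ _ (by
      change 0 < ((α 1 - β y) * _).re
      rw [α.target]; exact key₁ b _ (hS₂ _ (hβ y)) (by rw [← α.target]; exact (hne 1 y).symm))
  obtain ⟨n₄, hn₄⟩ := exists_int_abs_sub_lt (g := fun x => g (x, 1)) (by fun_prop) (c := q - 1 / 2)
    fun x => hcos _ _ (by
      change 0 < ((α x - β 1) * _).re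
      rw [β.target]; exact key₂ q _ (hS₁ _ (hα x)) (by rw [← β.target]; exact hne x 1))
  have tri : ∀ {x u v : ℝ} {n l : ℤ}, |x - u - n| < 1 / 4 → |x - v - l| < 1 / 4 →
      |v - u + ((l - n : ℤ) : ℝ)| < 1 / 2 := by
    intro x u v n l h h'
    have h1 := abs_lt.1 h
    have h2 := abs_lt.1 h'
    push_cast
    rw [abs_lt]; constructor <;> linarith
  -- The sides are compared at the four corners. Interlacing makes the integers agree at three
  -- corners and differ by one at the fourth, so the angle would change by a full turn around the
  -- boundary of the square.
  have e₁ := int_eq_of_abs (tri (hn₁ 0) (hn₂ 0)) 0 (by push_cast; linarith) (by push_cast; linarith)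
  have e₂ := int_eq_of_abs (tri (hn₂ 1) (hn₃ 0)) (-1) (by push_cast; linarith)
    (by push_cast; linarith)
  have e₃ := int_eq_of_abs (tri (hn₁ 1) (hn₄ 0)) 0 (by push_cast; linarith) (by push_cast; linarith)
  have e₄ := int_eq_of_abs (tri (hn₃ 1) (hn₄ 1)) 0 (by push_cast; linarith) (by push_cast; linarith)
  omega


/-! ### The modulus of the Blaschke product near the circle -/

section smooth
variable {m : ℕ}

lemma contDiff_coord {n : ℕ∞ω} (i : ℕ) : ContDiff ℝ n (fun μ : Fin (2 * m) → ℝ => coord μ i) := by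
  unfold coord; split_ifs <;> fun_prop

lemma contDiff_modulus {n : ℕ∞ω} (j : Fin m) :
    ContDiff ℝ n (fun μ : Fin (2 * m) → ℝ => modulus μ j) := by
  unfold modulus; split_ifs <;> exact contDiff_coord _

lemma contDiff_angle {n : ℕ∞ω} (j : Fin m) :
    ContDiff ℝ n (fun μ : Fin (2 * m) → ℝ => angle μ j) := by
  unfold angle; split_ifs
  · exact contDiff_const
  · exact contDiff_coord _

lemma continuous_modulus (j : Fin m) : Continuous (fun μ : Fin (2 * m) → ℝ => modulus μ j) :=
  (contDiff_modulus (n := 0) j).continuous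

lemma continuous_angle (j : Fin m) : Continuous (fun μ : Fin (2 * m) → ℝ => angle μ j) :=
  (contDiff_angle (n := 0) j).continuous

lemma continuous_zero (j : Fin m) : Continuous (fun μ : Fin (2 * m) → ℝ => zero μ j) := by
  unfold zero
  exact (Complex.continuous_ofReal.comp (continuous_modulus j)).mul
    (continuous_e.comp (continuous_angle j))

lemma isOpen_one_lt_modulus : IsOpen {μ : Fin (2 * m) → ℝ | ∀ j, 1 < modulus μ j} := by
  simp only [ofPred_forall]
  exact isOpen_iInter_of_finite fun j => isOpen_lt continuous_const (continuous_modulus j)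

end smooth

/-- The square of `‖ρ e(x) - r e(η)‖`. -/
noncomputable def numSq (r η ρ x : ℝ) : ℝ :=
  ρ ^ 2 + r ^ 2 - 2 * ρ * r * Real.cos (2 * Real.pi * (x - η))

/-- The square of `‖1 - conj (r e(η)) ρ e(x)‖`. -/
noncomputable def denSq (r η ρ x : ℝ) : ℝ :=
  1 + ρ ^ 2 * r ^ 2 - 2 * ρ * r * Real.cos (2 * Real.pi * (x - η))

lemma normSq_sub_e (s t x y : ℝ) :
    ‖(s : ℂ) * e x - t * e y‖ ^ 2 = s ^ 2 + t ^ 2 - 2 * s * t * Real.cos (2 * Real.pi * (x - y)) := by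
  rw [← Complex.normSq_eq_norm_sq, Complex.normSq_apply]
  simp only [Complex.sub_re, Complex.sub_im, Complex.re_ofReal_mul, Complex.im_ofReal_mul, e_re,
    e_im]
  rw [mul_sub (2 * Real.pi) x y, Real.cos_sub]
  have h1 := Real.sin_sq_add_cos_sq (2 * Real.pi * x)
  have h2 := Real.sin_sq_add_cos_sq (2 * Real.pi * y)
  linear_combination s ^ 2 * h1 + t ^ 2 * h2

lemma numSq_pos {r η ρ x : ℝ} (hρ : 0 < ρ) (h : ρ < r) : 0 < numSq r η ρ x := by
  unfold numSq
  have h1 := Real.cos_le_one (2 * Real.pi * (x - η))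
  have h2 : 0 < ρ * r := mul_pos hρ (hρ.trans h)
  nlinarith [mul_pos (sub_pos.2 h) (sub_pos.2 h)]

lemma denSq_pos {r η ρ x : ℝ} (hρ : 1 ≤ ρ) (h : 1 < r) : 0 < denSq r η ρ x := by
  unfold denSq
  have h1 := Real.cos_le_one (2 * Real.pi * (x - η))
  have h2 : 1 < ρ * r := by nlinarith
  nlinarith [mul_pos (sub_pos.2 h2) (sub_pos.2 h2)]

section blaschke
variable {m : ℕ} {κ : Fin (m + 1) → ℕ} {μ : Fin (2 * m) → ℝ}

lemma norm_blaschke (κ : Fin (m + 1) → ℕ) (μ : Fin (2 * m) → ℝ) (z : ℂ) :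
    ‖blaschke κ μ z‖ = ‖z‖ ^ κ 0 *
      ∏ j : Fin m, (‖z - zero μ j‖ / ‖1 - conj (zero μ j) * z‖) ^ κ j.succ := by
  unfold blaschke
  rw [norm_mul, norm_mul, norm_e, one_mul, norm_pow, norm_prod]
  simp only [norm_pow, norm_div]

lemma norm_sub_zero_sq (j : Fin m) (ρ x : ℝ) :
    ‖(ρ : ℂ) * e x - zero μ j‖ ^ 2 = numSq (modulus μ j) (angle μ j) ρ x := by
  unfold zero numSq; rw [normSq_sub_e]

lemma norm_one_sub_sq (j : Fin m) (ρ x : ℝ) :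
    ‖1 - conj (zero μ j) * ((ρ : ℂ) * e x)‖ ^ 2 = denSq (modulus μ j) (angle μ j) ρ x := by
  have h1 : 1 - conj (zero μ j) * ((ρ : ℂ) * e x) =
      -(((ρ * modulus μ j : ℝ) : ℂ) * e (x - angle μ j) - ((1 : ℝ) : ℂ) * e 0) := by
    unfold zero
    rw [map_mul, Complex.conj_ofReal, conj_e, e_zero, sub_eq_add_neg x, e_add]
    have : e (-angle μ j) = (e (angle μ j))⁻¹ := by
      refine eq_inv_of_mul_eq_one_left ?_; rw [← e_add]; simp
    rw [this]; push_cast; ring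
  rw [h1, norm_neg, normSq_sub_e]
  unfold denSq
  rw [sub_zero]; ring

/-- The logarithm of the modulus of the Blaschke product, near the circle. -/
noncomputable def logNorm (κ : Fin (m + 1) → ℕ) (μ : Fin (2 * m) → ℝ) (ρ x : ℝ) : ℝ :=
  κ 0 * Real.log ρ + ∑ j : Fin m, (κ j.succ : ℝ) *
    ((Real.log (numSq (modulus μ j) (angle μ j) ρ x) -
      Real.log (denSq (modulus μ j) (angle μ j) ρ x)) / 2)

/-- The radial derivative of `logNorm`. -/
noncomputable def radial (κ : Fin (m + 1) → ℕ) (μ : Fin (2 * m) → ℝ) (ρ x : ℝ) : ℝ :=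
  κ 0 * ρ⁻¹ + ∑ j : Fin m, (κ j.succ : ℝ) *
    ((ρ - modulus μ j * Real.cos (2 * Real.pi * (x - angle μ j))) /
      numSq (modulus μ j) (angle μ j) ρ x -
    (ρ * modulus μ j ^ 2 - modulus μ j * Real.cos (2 * Real.pi * (x - angle μ j))) /
      denSq (modulus μ j) (angle μ j) ρ x)

/-- The angular derivative of `logNorm` divided by `ρ ^ 2 - 1`. -/
noncomputable def angular (κ : Fin (m + 1) → ℕ) (μ : Fin (2 * m) → ℝ) (ρ x : ℝ) : ℝ :=
  ∑ j : Fin m, (κ j.succ : ℝ) *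
    (2 * Real.pi * ρ * modulus μ j * (modulus μ j ^ 2 - 1) *
      Real.sin (2 * Real.pi * (x - angle μ j)) /
      (numSq (modulus μ j) (angle μ j) ρ x * denSq (modulus μ j) (angle μ j) ρ x))

lemma zero_eq_iff {j : Fin m} {ρ x : ℝ} (hρ : 1 ≤ ρ) (h : ρ < modulus μ j) :
    (ρ : ℂ) * e x - zero μ j ≠ 0 := by
  intro h0
  have := norm_sub_zero_sq (μ := μ) j ρ x
  rw [h0] at this
  have h2 := numSq_pos (η := angle μ j) (x := x) (by linarith) h
  simp at this; linarith

lemma one_sub_conj_zero_ne_zero {j : Fin m} {z : ℂ} (hz : 1 ≤ ‖z‖) (h : 1 < modulus μ j) :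
    1 - conj (zero μ j) * z ≠ 0 := by
  intro h0
  have h1 : ‖conj (zero μ j) * z‖ = 1 := by rw [← sub_eq_zero.1 h0]; simp
  rw [norm_mul, RCLike.norm_conj, norm_zero h] at h1
  nlinarith

lemma norm_blaschke_pos {z : ℂ} (hz : 1 ≤ ‖z‖) (h : ∀ j, 1 < modulus μ j)
    (hne : ∀ j, z ≠ zero μ j) : 0 < ‖blaschke κ μ z‖ := by
  rw [norm_blaschke]
  refine mul_pos (pow_pos (by linarith) _) (Finset.prod_pos fun j _ => pow_pos (div_pos ?_ ?_) _)
  · exact norm_pos_iff.2 (sub_ne_zero.2 (hne j))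
  · exact norm_pos_iff.2 (one_sub_conj_zero_ne_zero hz (h j))

lemma norm_ofReal_mul_e {ρ x : ℝ} (h : 0 ≤ ρ) : ‖(ρ : ℂ) * e x‖ = ρ := by
  rw [norm_mul, norm_e, mul_one, Complex.norm_real, Real.norm_of_nonneg h]

lemma log_norm_blaschke {ρ : ℝ} (x : ℝ) (hρ : 1 ≤ ρ) (h : ∀ j, ρ < modulus μ j) :
    Real.log ‖blaschke κ μ (ρ * e x)‖ = logNorm κ μ ρ x := by
  have hr := fun j => hρ.trans_lt (h j)
  have hz : ‖(ρ : ℂ) * e x‖ = ρ := norm_ofReal_mul_e (by linarith)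
  have h1 : ∀ j, ‖(ρ : ℂ) * e x - zero μ j‖ ≠ 0 := fun j =>
    norm_ne_zero_iff.2 (zero_eq_iff hρ (h j))
  have h2 : ∀ j, ‖1 - conj (zero μ j) * ((ρ : ℂ) * e x)‖ ≠ 0 := fun j =>
    norm_ne_zero_iff.2 (one_sub_conj_zero_ne_zero (by rw [hz]; exact hρ) (hr j))
  rw [norm_blaschke, hz, Real.log_mul (by positivity)
    (Finset.prod_ne_zero_iff.2 fun j _ => pow_ne_zero _ (div_ne_zero (h1 j) (h2 j))), Real.log_pow,
    Real.log_prod fun j _ => pow_ne_zero _ (div_ne_zero (h1 j) (h2 j))]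
  unfold logNorm
  congr 1
  refine Finset.sum_congr rfl fun j _ => ?_
  rw [Real.log_pow, Real.log_div (h1 j) (h2 j), ← norm_sub_zero_sq, ← norm_one_sub_sq, Real.log_pow,
    Real.log_pow]
  push_cast; ring

lemma blaschke_norm_pos {ρ : ℝ} (x : ℝ) (hρ : 1 ≤ ρ) (h : ∀ j, ρ < modulus μ j) :
    0 < ‖blaschke κ μ (ρ * e x)‖ :=
  norm_blaschke_pos (by rw [norm_ofReal_mul_e (by linarith)]; exact hρ)
    (fun j => hρ.trans_lt (h j)) fun j => sub_ne_zero.1 (zero_eq_iff hρ (h j))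

lemma logNorm_one (x : ℝ) : logNorm κ μ 1 x = 0 := by
  unfold logNorm
  simp only [Real.log_one, mul_zero, zero_add]
  refine Finset.sum_eq_zero fun j _ => ?_
  have : numSq (modulus μ j) (angle μ j) 1 x = denSq (modulus μ j) (angle μ j) 1 x := by
    unfold numSq denSq; ring
  rw [this]; simp

lemma hasDerivAt_logNorm_radial {ρ : ℝ} (x : ℝ) (hρ : 1 ≤ ρ) (h : ∀ j, ρ < modulus μ j) :
    HasDerivAt (fun ρ => logNorm κ μ ρ x) (radial κ μ ρ x) ρ := by
  unfold logNorm radial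
  refine ((Real.hasDerivAt_log (by linarith)).const_mul _).add
    (HasDerivAt.fun_sum fun j _ => HasDerivAt.const_mul _ ?_)
  have h1 := numSq_pos (η := angle μ j) (x := x) (by linarith : 0 < ρ) (h j)
  have h2 := denSq_pos (η := angle μ j) (x := x) hρ (hρ.trans_lt (h j))
  have d1 : HasDerivAt (fun ρ => numSq (modulus μ j) (angle μ j) ρ x)
      (2 * (ρ - modulus μ j * Real.cos (2 * Real.pi * (x - angle μ j)))) ρ := by
    unfold numSq
    have := (((hasDerivAt_id ρ).pow 2).add_const (modulus μ j ^ 2)).sub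
      ((hasDerivAt_id ρ).const_mul (2 * modulus μ j * Real.cos (2 * Real.pi * (x - angle μ j))))
    refine (this.congr_deriv (by simp; ring)).congr_of_eventuallyEq
      (Eventually.of_forall fun y => ?_)
    simp; ring
  have d2 : HasDerivAt (fun ρ => denSq (modulus μ j) (angle μ j) ρ x)
      (2 * (ρ * modulus μ j ^ 2 - modulus μ j * Real.cos (2 * Real.pi * (x - angle μ j)))) ρ := by
    unfold denSq
    have := ((((hasDerivAt_id ρ).pow 2).mul_const (modulus μ j ^ 2)).const_add 1).sub
      ((hasDerivAt_id ρ).const_mul (2 * modulus μ j * Real.cos (2 * Real.pi * (x - angle μ j))))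
    refine (this.congr_deriv (by simp; ring)).congr_of_eventuallyEq
      (Eventually.of_forall fun y => ?_)
    simp; ring
  refine (((d1.log h1.ne').sub (d2.log h2.ne')).div_const 2).congr_deriv ?_
  ring

lemma hasDerivAt_logNorm_angular {ρ : ℝ} (x : ℝ) (hρ : 1 ≤ ρ) (h : ∀ j, ρ < modulus μ j) :
    HasDerivAt (fun x => logNorm κ μ ρ x) ((ρ ^ 2 - 1) * angular κ μ ρ x) x := by
  unfold logNorm angular
  rw [Finset.mul_sum]
  refine HasDerivAt.const_add _ (HasDerivAt.fun_sum fun j _ => ?_)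
  have h1 := numSq_pos (η := angle μ j) (x := x) (by linarith : 0 < ρ) (h j)
  have h2 := denSq_pos (η := angle μ j) (x := x) hρ (hρ.trans_lt (h j))
  have hc : HasDerivAt (fun x => 2 * ρ * modulus μ j * Real.cos (2 * Real.pi * (x - angle μ j)))
      (-(4 * Real.pi * ρ * modulus μ j * Real.sin (2 * Real.pi * (x - angle μ j)))) x := by
    have := ((((hasDerivAt_id x).sub_const (angle μ j)).const_mul (2 * Real.pi)).cos).const_mul
      (2 * ρ * modulus μ j)
    refine this.congr_deriv ?_
    simp; ring
  have d1 := (hc.const_sub (ρ ^ 2 + modulus μ j ^ 2)).log h1.ne'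
  have d2 := (hc.const_sub (1 + ρ ^ 2 * modulus μ j ^ 2)).log h2.ne'
  refine (((d1.sub d2).div_const 2).const_mul (κ j.succ : ℝ)).congr_deriv ?_
  change (κ j.succ : ℝ) * ((_ / numSq (modulus μ j) (angle μ j) ρ x -
    _ / denSq (modulus μ j) (angle μ j) ρ x) / 2) = _
  -- This identity produces the factor `ρ ^ 2 - 1`. It reflects that `log |B|` is constant on the
  -- circle itself, so that only the quotient has a useful limit there.
  have h3 : denSq (modulus μ j) (angle μ j) ρ x =
      numSq (modulus μ j) (angle μ j) ρ x + (ρ ^ 2 - 1) * (modulus μ j ^ 2 - 1) := by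
    unfold numSq denSq; ring
  rw [h3] at h2 ⊢
  field_simp
  ring

lemma order_degree_sum (κ : Fin (m + 1) → ℕ) :
    (degree κ : ℝ) + ∑ j, order κ j = κ 0 := by
  unfold degree order; push_cast; ring

lemma poisson_pole {j : Fin m} (h : 1 < modulus μ j) (x : ℝ) :
    poisson (pole μ j) x = (modulus μ j ^ 2 - 1) / numSq (modulus μ j) (angle μ j) 1 x := by
  unfold poisson
  have h0 := zero_ne_zero h
  have h1 : 1 - conj (pole μ j) * e x = -((((1 : ℝ) : ℂ) * e x - zero μ j) / zero μ j) := by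
    rw [conj_pole]; push_cast; field_simp; ring
  rw [h1, norm_neg, norm_div, div_pow, norm_sub_zero_sq, norm_zero h, norm_pole h]
  have := numSq_pos (η := angle μ j) (x := x) one_pos h
  have h3 : modulus μ j ≠ 0 := by linarith
  field_simp

/-- These are the Cauchy–Riemann equations for `log B`: on the circle the radial derivative of `log
|B|` is the angular derivative of the argument. So `F' < 0` means that `|B| < 1` just outside the
circle. -/
lemma radial_one (hr : ∀ j, 1 < modulus μ j) (x : ℝ) :
    radial κ μ 1 x = genDeriv (order κ) (degree κ) (pole μ) x := by
  rw [genDeriv_eq (fun j => norm_pole_lt (hr j)), order_degree_sum]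
  unfold radial order
  rw [inv_one, mul_one, sub_eq_add_neg, ← Finset.sum_neg_distrib]
  congr 1
  refine Finset.sum_congr rfl fun j _ => ?_
  have h1 := numSq_pos (η := angle μ j) (x := x) one_pos (hr j)
  have : denSq (modulus μ j) (angle μ j) 1 x = numSq (modulus μ j) (angle μ j) 1 x := by
    unfold numSq denSq; ring
  rw [this, poisson_pole (hr j)]
  field_simp
  ring

/-- To first order `log |B|` is `(ρ - 1) F'(x)` near the circle; its derivative in `x` is divided by
`ρ ^ 2 - 1`, which is about `2 (ρ - 1)`. -/
lemma angular_one (hr : ∀ j, 1 < modulus μ j) (x : ℝ) :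
    angular κ μ 1 x = deriv (genDeriv (order κ) (degree κ) (pole μ)) x / 2 := by
  have hg : genDeriv (order κ) (degree κ) (pole μ) = fun x => (κ 0 : ℝ) - ∑ j : Fin m,
      (κ j.succ : ℝ) * ((modulus μ j ^ 2 - 1) / numSq (modulus μ j) (angle μ j) 1 x) := by
    funext x
    rw [genDeriv_eq (fun j => norm_pole_lt (hr j)), order_degree_sum]
    congr 1
    exact Finset.sum_congr rfl fun j _ => by rw [poisson_pole (hr j)]; rfl
  have hd : HasDerivAt (fun x => (κ 0 : ℝ) - ∑ j : Fin m,
      (κ j.succ : ℝ) * ((modulus μ j ^ 2 - 1) / numSq (modulus μ j) (angle μ j) 1 x))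
      (2 * angular κ μ 1 x) x := by
    unfold angular
    rw [Finset.mul_sum, ← neg_neg (∑ _, _), ← Finset.sum_neg_distrib]
    refine HasDerivAt.const_sub _ (HasDerivAt.fun_sum fun j _ => ?_)
    have h1 := numSq_pos (η := angle μ j) (x := x) one_pos (hr j)
    have hc : HasDerivAt (fun x => numSq (modulus μ j) (angle μ j) 1 x)
        (4 * Real.pi * modulus μ j * Real.sin (2 * Real.pi * (x - angle μ j))) x := by
      unfold numSq
      have := (((((hasDerivAt_id x).sub_const (angle μ j)).const_mul (2 * Real.pi)).cos).const_mul
        (2 * 1 * modulus μ j)).const_sub (1 ^ 2 + modulus μ j ^ 2)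
      refine this.congr_deriv ?_
      simp; ring
    refine (((hasDerivAt_const x (modulus μ j ^ 2 - 1)).fun_div hc h1.ne').const_mul
      (κ j.succ : ℝ)).congr_deriv ?_
    have h2 : denSq (modulus μ j) (angle μ j) 1 x = numSq (modulus μ j) (angle μ j) 1 x := by
      unfold numSq denSq; ring
    rw [h2]
    field_simp
    ring
  rw [hg, hd.deriv]; ring

lemma continuousAt_radial (hr : ∀ j, 1 < modulus μ j) (x : ℝ) :
    ContinuousAt (fun p : (Fin (2 * m) → ℝ) × ℝ × ℝ => radial κ p.1 p.2.1 p.2.2) (μ, 1, x) := by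
  unfold radial numSq denSq
  have hm : ∀ j, Continuous fun p : (Fin (2 * m) → ℝ) × ℝ × ℝ => modulus p.1 j :=
    fun j => (continuous_modulus j).comp continuous_fst
  have ha : ∀ j, Continuous fun p : (Fin (2 * m) → ℝ) × ℝ × ℝ => angle p.1 j :=
    fun j => (continuous_angle j).comp continuous_fst
  refine ContinuousAt.add (continuousAt_const.mul (ContinuousAt.inv₀ (by fun_prop) one_ne_zero)) ?_
  refine tendsto_finsetSum _ fun j _ => ?_
  have hm := hm j
  have ha := ha j
  refine Tendsto.mul tendsto_const_nhds (Tendsto.sub (Tendsto.div ?_ ?_ ?_) (Tendsto.div ?_ ?_ ?_))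
  · exact Continuous.continuousAt (by fun_prop)
  · exact Continuous.continuousAt (by fun_prop)
  · exact (numSq_pos (η := angle μ j) (x := x) one_pos (hr j)).ne'
  · exact Continuous.continuousAt (by fun_prop)
  · exact Continuous.continuousAt (by fun_prop)
  · exact (denSq_pos (η := angle μ j) (x := x) le_rfl (hr j)).ne'

lemma continuousAt_angular (hr : ∀ j, 1 < modulus μ j) (x : ℝ) :
    ContinuousAt (fun p : ℝ × ℝ => angular κ μ p.1 p.2) (1, x) := by
  unfold angular
  refine tendsto_finsetSum _ fun j _ => ?_
  refine Tendsto.mul tendsto_const_nhds (Tendsto.div ?_ ?_ ?_)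
  · exact Continuous.continuousAt (by fun_prop)
  · unfold numSq denSq
    exact Continuous.continuousAt (by fun_prop)
  · exact (mul_pos (numSq_pos (η := angle μ j) (x := x) one_pos (hr j))
      (denSq_pos (η := angle μ j) (x := x) le_rfl (hr j))).ne'

end blaschke


/-! ### Components of the sublevel set of the Blaschke product outside the disk -/

/-- The part of the sublevel set `|B| < 1` outside the closed unit disk. -/
def region {m : ℕ} (κ : Fin (m + 1) → ℕ) (μ : Fin (2 * m) → ℝ) : Set ℂ :=
  {z : ℂ | 1 < ‖z‖ ∧ ‖blaschke κ μ z‖ < 1}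

lemma mem_component_of_isPreconnected {F S : Set ℂ} {p x y : ℂ} (hS : IsPreconnected S) (hSF : S ⊆ F)
    (hxS : x ∈ S) (hx : x ∈ connectedComponentIn F p) (hy : y ∈ S) :
    y ∈ connectedComponentIn F p := by
  rw [connectedComponentIn_eq hx]
  exact hS.subset_connectedComponentIn hxS hSF hy

lemma closure_component_inter {F : Set ℂ} (hF : IsOpen F) {p z : ℂ}
    (hz : z ∈ closure (connectedComponentIn F p)) (hzF : z ∈ F) : z ∈ connectedComponentIn F p := by
  have h1 : connectedComponentIn F z ∈ 𝓝 z :=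
    hF.connectedComponentIn.mem_nhds (mem_connectedComponentIn hzF)
  obtain ⟨y, hy, hyp⟩ := mem_closure_iff_nhds.1 hz _ h1
  rw [connectedComponentIn_eq hyp, ← connectedComponentIn_eq hy]
  exact mem_connectedComponentIn hzF

/-- The maximum principle on a component of a bounded open set. -/
lemma norm_le_one_on_component {F : Set ℂ} (hF : IsOpen F) (hb : Bornology.IsBounded F) {p : ℂ}
    {h : ℂ → ℂ} (hd : ∀ z ∈ closure (connectedComponentIn F p), DifferentiableAt ℂ h z)
    (hfr : ∀ z ∈ closure (connectedComponentIn F p), z ∉ F → ‖h z‖ ≤ 1) {z : ℂ}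
    (hz : z ∈ connectedComponentIn F p) : ‖h z‖ ≤ 1 := by
  refine Complex.norm_le_of_forall_mem_frontier_norm_le
    (hb.subset (connectedComponentIn_subset F p)) ?_ ?_ (subset_closure hz)
  · exact DifferentiableOn.diffContOnCl fun z hz => (hd z hz).differentiableWithinAt
  · intro z hz
    refine hfr z hz.1 fun hzF => hz.2 ?_
    rw [hF.connectedComponentIn.interior_eq]
    exact closure_component_inter hF hz.1 hzF

section region
variable {m : ℕ} {κ : Fin (m + 1) → ℕ} {μ : Fin (2 * m) → ℝ}

lemma continuousAt_blaschke {z : ℂ} (h : ∀ j, 1 < modulus μ j) (hz : 1 ≤ ‖z‖) :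
    ContinuousAt (fun p : (Fin (2 * m) → ℝ) × ℂ => blaschke κ p.1 p.2) (μ, z) := by
  unfold blaschke
  have hc : Continuous fun p : (Fin (2 * m) → ℝ) × ℂ => e (coord p.1 0) :=
    continuous_e.comp ((contDiff_coord (n := 0) 0).continuous.comp continuous_fst)
  have hzero : ∀ j, Continuous fun p : (Fin (2 * m) → ℝ) × ℂ => zero p.1 j :=
    fun j => (continuous_zero j).comp continuous_fst
  have hconj : ∀ j, Continuous fun p : (Fin (2 * m) → ℝ) × ℂ => conj (zero p.1 j) :=
    fun j => Complex.continuous_conj.comp (hzero j)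
  refine ContinuousAt.mul (ContinuousAt.mul hc.continuousAt (by fun_prop)) ?_
  refine tendsto_finsetProd _ fun j _ => Tendsto.pow (Tendsto.div ?_ ?_ ?_) _
  · exact (continuous_snd.sub (hzero j)).continuousAt
  · exact (continuous_const.sub ((hconj j).mul continuous_snd)).continuousAt
  · exact one_sub_conj_zero_ne_zero hz (h j)

lemma continuousAt_norm_blaschke {z : ℂ} (h : ∀ j, 1 < modulus μ j) (hz : 1 ≤ ‖z‖) :
    ContinuousAt (fun z => ‖blaschke κ μ z‖) z :=
  (ContinuousAt.comp (f := fun z => (μ, z)) (continuousAt_blaschke h hz)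
    (by fun_prop)).norm

lemma differentiableAt_blaschke {z : ℂ} (h : ∀ j, 1 < modulus μ j) (hz : 1 ≤ ‖z‖) :
    DifferentiableAt ℂ (blaschke κ μ) z := by
  unfold blaschke
  refine DifferentiableAt.mul (by fun_prop) (DifferentiableAt.fun_finsetProd fun j _ => ?_)
  have hd : DifferentiableAt ℂ (fun z => 1 - conj (zero μ j) * z) z :=
    (differentiableAt_id.const_mul (conj (zero μ j))).const_sub 1
  exact (DifferentiableAt.fun_div (by fun_prop) hd
    (one_sub_conj_zero_ne_zero hz (h j))).pow _

lemma isOpen_region (h : ∀ j, 1 < modulus μ j) : IsOpen (region κ μ) := by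
  rw [isOpen_iff_mem_nhds]
  intro z hz
  filter_upwards [(isOpen_lt continuous_const continuous_norm).mem_nhds hz.1,
    (continuousAt_norm_blaschke h hz.1.le).eventually (gt_mem_nhds hz.2)] with y h1 h2
  exact ⟨h1, h2⟩

lemma norm_factor_identity (a z : ℂ) :
    ‖1 - conj a * z‖ ^ 2 - ‖z - a‖ ^ 2 = (‖z‖ ^ 2 - 1) * (‖a‖ ^ 2 - 1) := by
  simp only [← Complex.normSq_eq_norm_sq, Complex.normSq_apply, Complex.sub_re, Complex.sub_im,
    Complex.one_re, Complex.one_im, Complex.mul_re, Complex.mul_im, Complex.conj_re,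
    Complex.conj_im]
  ring

lemma norm_factor_le_one {j : Fin m} {z : ℂ} (h : 1 < modulus μ j) (hz : 1 ≤ ‖z‖) :
    ‖z - zero μ j‖ / ‖1 - conj (zero μ j) * z‖ ≤ 1 := by
  have h0 := norm_pos_iff.2 (one_sub_conj_zero_ne_zero hz h)
  rw [div_le_one h0]
  have h1 := norm_factor_identity (zero μ j) z
  rw [norm_zero h] at h1
  have h2 : 0 ≤ (‖z‖ ^ 2 - 1) * (modulus μ j ^ 2 - 1) := by
    apply mul_nonneg <;> nlinarith
  exact (sq_le_sq₀ (norm_nonneg _) (norm_nonneg _)).1 (by linarith)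

lemma norm_factor_eq_one {j : Fin m} {z : ℂ} (h : 1 < modulus μ j) (hz : ‖z‖ = 1) :
    ‖z - zero μ j‖ / ‖1 - conj (zero μ j) * z‖ = 1 := by
  have h0 := norm_pos_iff.2 (one_sub_conj_zero_ne_zero hz.ge h)
  rw [div_eq_one_iff_eq h0.ne']
  have h1 := norm_factor_identity (zero μ j) z
  rw [hz] at h1
  exact (sq_eq_sq₀ (norm_nonneg _) (norm_nonneg _)).1 (by linarith)

lemma norm_blaschke_of_norm_one {z : ℂ} (h : ∀ j, 1 < modulus μ j) (hz : ‖z‖ = 1) :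
    ‖blaschke κ μ z‖ = 1 := by
  rw [norm_blaschke, hz, one_pow, one_mul]
  exact Finset.prod_eq_one fun j _ => by rw [norm_factor_eq_one (h j) hz, one_pow]

/-- Far out each factor has modulus at least `1 / (2 r_j)`, and `z ^ k_0` with `k_0 > 0` outgrows
the inverse of the product of these bounds. -/
lemma isBounded_region (h : ∀ j, 1 < modulus μ j) (h0 : 0 < κ 0) :
    Bornology.IsBounded (region κ μ) := by
  set c : ℝ := ∏ j : Fin m, (1 / (2 * modulus μ j)) ^ κ j.succ with hc
  have hcpos : 0 < c := Finset.prod_pos fun j _ =>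
    pow_pos (div_pos one_pos (by linarith [h j])) _
  set R : ℝ := 1 + ∑ j, 2 * modulus μ j + 1 / c with hR
  refine (Metric.isBounded_closedBall (x := (0 : ℂ)) (r := R)).subset fun z hz => ?_
  rw [mem_closedBall_zero_iff]
  by_contra hlt
  have hlt := not_le.1 hlt
  have hsum : ∀ j, 2 * modulus μ j ≤ ∑ j, 2 * modulus μ j := fun j =>
    Finset.single_le_sum (f := fun j => 2 * modulus μ j) (fun l _ => by linarith [h l])
      (Finset.mem_univ j)
  have hcinv : 0 < 1 / c := by positivity
  have h1 : ∀ j, 1 / (2 * modulus μ j) ≤ ‖z - zero μ j‖ / ‖1 - conj (zero μ j) * z‖ := by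
    intro j
    have hj := h j
    have hz1 := hz.1
    have hsj := hsum j
    have hpos := norm_pos_iff.2 (one_sub_conj_zero_ne_zero hz1.le hj)
    rw [div_le_div_iff₀ (by linarith) hpos]
    have h2 : ‖z‖ - modulus μ j ≤ ‖z - zero μ j‖ := by
      rw [← norm_zero hj]; exact norm_sub_norm_le _ _
    have h3 : ‖1 - conj (zero μ j) * z‖ ≤ 1 + modulus μ j * ‖z‖ := by
      refine (norm_sub_le _ _).trans ?_
      rw [norm_one, norm_mul, RCLike.norm_conj, norm_zero hj]
    have h4 : 1 + 2 * modulus μ j < ‖z‖ := by linarith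
    nlinarith
  have h2 : ‖z‖ * c ≤ ‖blaschke κ μ z‖ := by
    rw [norm_blaschke]
    refine mul_le_mul ?_ ?_ hcpos.le (by positivity)
    · exact le_self_pow₀ hz.1.le (by omega)
    · refine Finset.prod_le_prod (fun j _ => ?_) fun j _ => ?_
      · have := h j; positivity
      · have := h j; exact pow_le_pow_left₀ (by positivity) (h1 j) _
  have hsum0 : 0 ≤ ∑ j, 2 * modulus μ j := Finset.sum_nonneg fun j _ => by linarith [h j]
  have h3 : 1 / c < ‖z‖ := by linarith
  rw [div_lt_iff₀ hcpos] at h3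
  linarith [hz.2]

lemma norm_of_mem_closure_component {p z : ℂ}
    (hz : z ∈ closure (connectedComponentIn (region κ μ) p)) : 1 ≤ ‖z‖ := by
  have : closure (connectedComponentIn (region κ μ) p) ⊆ {z : ℂ | 1 ≤ ‖z‖} :=
    closure_minimal (fun z hz => (connectedComponentIn_subset _ _ hz).1.le)
      (isClosed_le continuous_const continuous_norm)
  exact this hz

lemma norm_blaschke_of_mem_closure_component (h : ∀ j, 1 < modulus μ j) {p z : ℂ}
    (hz : z ∈ closure (connectedComponentIn (region κ μ) p)) (hzF : z ∉ region κ μ) :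
    ‖blaschke κ μ z‖ = 1 := by
  have h1 := norm_of_mem_closure_component hz
  rcases h1.eq_or_lt with h1 | h1
  · exact norm_blaschke_of_norm_one h h1.symm
  · refine le_antisymm ?_ (not_lt.1 fun hlt => hzF ⟨h1, hlt⟩)
    by_contra hlt
    have h2 := (continuousAt_norm_blaschke (κ := κ) h h1.le).eventually (lt_mem_nhds (not_le.1 hlt))
    obtain ⟨y, hy, hyp⟩ := mem_closure_iff_nhds.1 hz _ h2
    exact absurd (connectedComponentIn_subset _ _ hyp).2 (not_lt.2 hy.le)

lemma blaschke_zero (j : Fin m) (hk : 0 < κ j.succ) : blaschke κ μ (zero μ j) = 0 := by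
  unfold blaschke
  rw [Finset.prod_eq_zero (Finset.mem_univ j), mul_zero]
  rw [sub_self, zero_div, zero_pow (by omega)]

lemma zero_mem_region (h : ∀ j, 1 < modulus μ j) (j : Fin m) (hk : 0 < κ j.succ) :
    zero μ j ∈ region κ μ :=
  ⟨by rw [norm_zero (h j)]; exact h j, by rw [blaschke_zero j hk]; simp⟩

lemma zero_mem_outerDisk (h : ∀ j, 1 < modulus μ j) (j : Fin m) (hk : 0 < κ j.succ) :
    zero μ j ∈ outerDisk κ μ j := mem_connectedComponentIn (zero_mem_region h j hk)

/-- If `B'` has no zeros in a component of the region of `B`, and `|B'| ≥ 1` on its boundary, then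
`|B'| ≥ 1` on the component. -/
lemma one_le_norm_blaschke_on_component {κ' : Fin (m + 1) → ℕ} (h : ∀ j, 1 < modulus μ j)
    (hκ : ∀ i, 0 < κ i) {p : ℂ}
    (hzero : ∀ j, zero μ j ∈ connectedComponentIn (region κ μ) p → κ' j.succ = 0)
    (hfr : ∀ z, 1 ≤ ‖z‖ → ‖blaschke κ μ z‖ = 1 → 1 ≤ ‖blaschke κ' μ z‖) {z : ℂ}
    (hz : z ∈ connectedComponentIn (region κ μ) p) : 1 ≤ ‖blaschke κ' μ z‖ := by
  have hne : ∀ z ∈ closure (connectedComponentIn (region κ μ) p), blaschke κ' μ z ≠ 0 := by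
    intro z hz h0
    have hz1 := norm_of_mem_closure_component hz
    unfold blaschke at h0
    rcases mul_eq_zero.1 h0 with h0 | h0
    · rcases mul_eq_zero.1 h0 with h0 | h0
      · exact e_ne_zero _ h0
      · have := eq_zero_of_pow_eq_zero h0
        rw [this] at hz1; norm_num at hz1
    · obtain ⟨j, -, hj⟩ := Finset.prod_eq_zero_iff.1 h0
      have hk : κ' j.succ ≠ 0 := by rintro h1; rw [h1] at hj; simp at hj
      have hj' := (div_eq_zero_iff.1 (eq_zero_of_pow_eq_zero hj)).resolve_right
        (one_sub_conj_zero_ne_zero hz1 (h j))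
      have hzj := sub_eq_zero.1 hj'
      subst hzj
      exact hk (hzero j (closure_component_inter (isOpen_region h) hz
        (zero_mem_region h j (hκ _))))
  -- The maximum principle is applied to `1 / B'`. It is holomorphic on the closure: a zero `a_j` in
  -- the closure already lies in the component, and there `B'` has exponent `0`.
  have key := norm_le_one_on_component (isOpen_region h) (isBounded_region h (hκ 0)) (p := p)
    (h := fun z => (blaschke κ' μ z)⁻¹)
    (fun z hz => (differentiableAt_blaschke h (norm_of_mem_closure_component hz)).inv (hne z hz))
    (fun z hz hzF => by
      rw [norm_inv]
      exact inv_le_one_of_one_le₀ (hfr z (norm_of_mem_closure_component hz)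
        (norm_blaschke_of_mem_closure_component h hz hzF))) hz
  rw [norm_inv] at key
  exact (inv_le_one₀ (norm_pos_iff.2 (hne z (subset_closure hz)))).1 key

/-- Every component contains one of the zeros. -/
lemma exists_mem_outerDisk (h : ∀ j, 1 < modulus μ j) (hκ : ∀ i, 0 < κ i) {p : ℂ}
    (hp : p ∈ region κ μ) : ∃ j, p ∈ outerDisk κ μ j := by
  by_contra hne
  push Not at hne
  have h1 : ∀ j, zero μ j ∉ connectedComponentIn (region κ μ) p := by
    intro j hj
    apply hne j
    have := connectedComponentIn_eq hj
    change p ∈ connectedComponentIn (region κ μ) (zero μ j)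
    rw [← this]
    exact mem_connectedComponentIn hp
  have h2 := one_le_norm_blaschke_on_component (κ' := κ) h hκ (p := p)
    (fun j hj => absurd hj (h1 j)) (fun z _ hz => hz.ge) (mem_connectedComponentIn hp)
  exact absurd hp.2 (not_lt.2 h2)

lemma outerDisk_subset (j : Fin m) : outerDisk κ μ j ⊆ region κ μ :=
  connectedComponentIn_subset _ _

/-! ### Boxes at the circle -/

/-- Near a point of the circle where the derivative does not vanish, the modulus of the Blaschke
product lies on one side of `1`, locally uniformly in the parameters. -/
lemma exists_box (h : ∀ j, 1 < modulus μ j) {σ x₀ : ℝ}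
    (hx : 0 < σ * genDeriv (order κ) (degree κ) (pole μ) x₀) :
    ∃ ε > 0, ∀ᶠ μ' in 𝓝 μ, (∀ j, 1 + ε < modulus μ' j) ∧ ∀ x, |x - x₀| < ε →
      ∀ ρ ∈ Ioo 1 (1 + ε), 0 < σ * Real.log ‖blaschke κ μ' (ρ * e x)‖ := by
  have h1 : ∀ᶠ p : (Fin (2 * m) → ℝ) × ℝ × ℝ in 𝓝 (μ, 1, x₀),
      0 < σ * radial κ p.1 p.2.1 p.2.2 := by
    refine (continuousAt_const.mul (continuousAt_radial h x₀)).eventually (lt_mem_nhds ?_)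
    change 0 < σ * radial κ μ 1 x₀
    rw [radial_one h]; exact hx
  have h2 : ∀ᶠ p : (Fin (2 * m) → ℝ) × ℝ × ℝ in 𝓝 (μ, 1, x₀), ∀ j, p.2.1 < modulus p.1 j := by
    rw [eventually_all]
    intro j
    exact (Continuous.continuousAt (by fun_prop)).eventually_lt
      ((continuous_modulus j).comp continuous_fst).continuousAt (h j)
  obtain ⟨ε, hε, hball⟩ := Metric.eventually_nhds_iff.1 (h1.and h2)
  refine ⟨ε / 2, by linarith, ?_⟩
  filter_upwards [Metric.ball_mem_nhds μ hε] with μ' hμ'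
  have hpt : ∀ x ρ, |x - x₀| < ε / 2 → ρ ∈ Icc 1 (1 + ε / 2) →
      0 < σ * radial κ μ' ρ x ∧ ∀ j, ρ < modulus μ' j := by
    intro x ρ hx hρ
    refine hball (y := (μ', ρ, x)) ?_
    rw [Prod.dist_eq, Prod.dist_eq]
    refine max_lt hμ' (max_lt ?_ ?_)
    · rw [Real.dist_eq, abs_of_nonneg (by linarith [hρ.1])]; linarith [hρ.2]
    · rw [Real.dist_eq]; linarith
  refine ⟨(hpt x₀ (1 + ε / 2) (by simpa using hε) ⟨by linarith, le_rfl⟩).2, fun x hx ρ hρ => ?_⟩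
  have hr : ∀ s ∈ Icc 1 ρ, 0 < σ * radial κ μ' s x ∧ ∀ j, s < modulus μ' j :=
    fun s hs => hpt x s hx ⟨hs.1, hs.2.trans hρ.2.le⟩
  have hder : ∀ s ∈ Icc 1 ρ, HasDerivAt (fun s => σ * logNorm κ μ' s x)
      (σ * radial κ μ' s x) s := fun s hs =>
    (hasDerivAt_logNorm_radial x hs.1 (hr s hs).2).const_mul σ
  have hmono : StrictMonoOn (fun s => σ * logNorm κ μ' s x) (Icc 1 ρ) := by
    refine strictMonoOn_of_deriv_pos (convex_Icc _ _)
      (fun s hs => (hder s hs).continuousAt.continuousWithinAt) fun s hs => ?_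
    have hs' := interior_subset hs
    rw [(hder s hs').deriv]; exact (hr s hs').1
  have := hmono ⟨le_rfl, hρ.1.le⟩ ⟨hρ.1.le, le_rfl⟩ hρ.1
  simp only [logNorm_one, mul_zero] at this
  rw [log_norm_blaschke x hρ.1.le (hr ρ ⟨hρ.1.le, le_rfl⟩).2]
  exact this

/-- Next to a critical point where the second derivative is negative, the modulus of the Blaschke
product decreases along circles. -/
lemma exists_box_antitone (h : ∀ j, 1 < modulus μ j) {x₀ : ℝ}
    (hx : deriv (genDeriv (order κ) (degree κ) (pole μ)) x₀ < 0) :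
    ∃ ε > 0, ∀ ρ ∈ Ioo (1 : ℝ) (1 + ε), ∀ x y, x₀ - ε < x → x ≤ y → y < x₀ + ε →
      ‖blaschke κ μ (ρ * e y)‖ ≤ ‖blaschke κ μ (ρ * e x)‖ := by
  have h1 : ∀ᶠ p : ℝ × ℝ in 𝓝 (1, x₀), angular κ μ p.1 p.2 < 0 := by
    refine (continuousAt_angular h x₀).eventually (gt_mem_nhds ?_)
    change angular κ μ 1 x₀ < 0
    rw [angular_one h]; linarith
  have h2 : ∀ᶠ p : ℝ × ℝ in 𝓝 (1, x₀), ∀ j, p.1 < modulus μ j := by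
    rw [eventually_all]
    intro j
    exact continuousAt_fst.eventually (gt_mem_nhds (h j))
  obtain ⟨ε, hε, hball⟩ := Metric.eventually_nhds_iff.1 (h1.and h2)
  refine ⟨ε, hε, fun ρ hρ x y hx hxy hy => ?_⟩
  have hpt : ∀ s ∈ Icc x y, angular κ μ ρ s < 0 ∧ ∀ j, ρ < modulus μ j := by
    intro s hs
    refine hball (y := (ρ, s)) ?_
    rw [Prod.dist_eq]
    refine max_lt ?_ ?_
    · rw [Real.dist_eq, abs_of_nonneg (by linarith [hρ.1])]; linarith [hρ.2]
    · rw [Real.dist_eq, abs_lt]; constructor <;> linarith [hs.1, hs.2]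
  have hρm := (hpt x ⟨le_rfl, hxy⟩).2
  have hder : ∀ s, HasDerivAt (fun s => logNorm κ μ ρ s) ((ρ ^ 2 - 1) * angular κ μ ρ s) s :=
    fun s => hasDerivAt_logNorm_angular s hρ.1.le hρm
  have hanti : AntitoneOn (fun s => logNorm κ μ ρ s) (Icc x y) := by
    refine antitoneOn_of_deriv_nonpos (convex_Icc _ _)
      (fun s _ => (hder s).continuousAt.continuousWithinAt)
      (fun s _ => (hder s).differentiableAt.differentiableWithinAt) fun s hs => ?_
    rw [(hder s).deriv]
    exact mul_nonpos_of_nonneg_of_nonpos (by nlinarith [hρ.1]) (hpt s (interior_subset hs)).1.le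
  have := hanti ⟨le_rfl, hxy⟩ ⟨hxy, le_rfl⟩ hxy
  simp only [← log_norm_blaschke _ hρ.1.le hρm] at this
  exact (Real.log_le_log_iff (blaschke_norm_pos _ hρ.1.le hρm)
    (blaschke_norm_pos _ hρ.1.le hρm)).1 this

end region


/-! ### The arcs on which the circle map decreases, and the disks around the zeros -/

/-- The disk around `a_j` contains the points just outside the circle at the angle `x`. -/
def Collar {m : ℕ} (κ : Fin (m + 1) → ℕ) (μ : Fin (2 * m) → ℝ) (j : Fin m) (x : ℝ) : Prop :=
  ∀ᶠ ρ : ℝ in 𝓝[>] 1, (ρ : ℂ) * e x ∈ outerDisk κ μ j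

/-- The part of the sublevel set of the Blaschke product inside the unit disk, with the quotient
cleared. -/
def innerRegion {m : ℕ} (κ : Fin (m + 1) → ℕ) (μ : Fin (2 * m) → ℝ) : Set ℂ :=
  {z : ℂ | ‖z‖ < 1 ∧ ‖z ^ κ 0 * ∏ j : Fin m, (z - zero μ j) ^ κ j.succ‖ <
    ‖∏ j : Fin m, (1 - conj (zero μ j) * z) ^ κ j.succ‖}

section collar
variable {m : ℕ} {κ : Fin (m + 1) → ℕ} {μ : Fin (2 * m) → ℝ}

lemma isPreconnected_box (ε x₀ : ℝ) :
    IsPreconnected ((fun p : ℝ × ℝ => (p.1 : ℂ) * e p.2) ''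
      (Ioo 1 (1 + ε) ×ˢ Ioo (x₀ - ε) (x₀ + ε))) :=
  (isPreconnected_Ioo.prod isPreconnected_Ioo).image _
    (((Complex.continuous_ofReal.comp continuous_fst).mul
      (continuous_e.comp continuous_snd)).continuousOn)

lemma exists_box_region (h : ∀ j, 1 < modulus μ j) {x₀ : ℝ}
    (hx : genDeriv (order κ) (degree κ) (pole μ) x₀ < 0) :
    ∃ ε > 0, ∀ x, |x - x₀| < ε → ∀ ρ ∈ Ioo (1 : ℝ) (1 + ε), (ρ : ℂ) * e x ∈ region κ μ := by
  obtain ⟨ε, hε, hev⟩ := exists_box (κ := κ) h (σ := -1) (x₀ := x₀) (by linarith)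
  obtain ⟨hm, hbox⟩ := hev.self_of_nhds
  refine ⟨ε, hε, fun x hx ρ hρ => ⟨?_, ?_⟩⟩
  · rw [norm_ofReal_mul_e (by linarith [hρ.1])]; exact hρ.1
  · have hρm : ∀ j, ρ < modulus μ j := fun j => hρ.2.trans (hm j)
    refine (Real.log_neg_iff (blaschke_norm_pos x hρ.1.le hρm)).1 ?_
    have := hbox x hx ρ hρ
    linarith

/-- A box at the circle lies in at most one component. -/
lemma exists_box_outerDisk (h : ∀ j, 1 < modulus μ j) {x₀ : ℝ}
    (hx : genDeriv (order κ) (degree κ) (pole μ) x₀ < 0) :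
    ∃ ε > 0, ∀ (j : Fin m) (x ρ : ℝ), |x - x₀| < ε → ρ ∈ Ioo 1 (1 + ε) →
      (ρ : ℂ) * e x ∈ outerDisk κ μ j → ∀ x', |x' - x₀| < ε → ∀ ρ' ∈ Ioo 1 (1 + ε),
      (ρ' : ℂ) * e x' ∈ outerDisk κ μ j := by
  obtain ⟨ε, hε, hbox⟩ := exists_box_region h hx
  refine ⟨ε, hε, fun j x ρ hx hρ hmem x' hx' ρ' hρ' => ?_⟩
  refine mem_component_of_isPreconnected (isPreconnected_box ε x₀) ?_
    (mem_image_of_mem _ (mk_mem_prod hρ ?_)) hmem (mem_image_of_mem _ (mk_mem_prod hρ' ?_))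
  · rintro _ ⟨⟨s, y⟩, ⟨hs, hy⟩, rfl⟩
    exact hbox y (by rw [abs_lt]; constructor <;> linarith [hy.1, hy.2]) s hs
  · have := abs_lt.1 hx; constructor <;> linarith
  · have := abs_lt.1 hx'; constructor <;> linarith

lemma exists_of_collar {j : Fin m} {x : ℝ} (hc : Collar κ μ j x) {ε : ℝ} (hε : 0 < ε) :
    ∃ ρ ∈ Ioo (1 : ℝ) (1 + ε), (ρ : ℂ) * e x ∈ outerDisk κ μ j :=
  let ⟨ρ, h1, h2⟩ := (hc.and (Ioo_mem_nhdsGT (by linarith : (1 : ℝ) < 1 + ε))).exists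
  ⟨ρ, h2, h1⟩

lemma collar_of_forall {j : Fin m} {x ε : ℝ} (hε : 0 < ε)
    (h : ∀ ρ ∈ Ioo (1 : ℝ) (1 + ε), (ρ : ℂ) * e x ∈ outerDisk κ μ j) : Collar κ μ j x := by
  filter_upwards [Ioo_mem_nhdsGT (by linarith : (1 : ℝ) < 1 + ε)] with ρ hρ using h ρ hρ

lemma collar_eventually (h : ∀ j, 1 < modulus μ j) {x₀ : ℝ}
    (hx : genDeriv (order κ) (degree κ) (pole μ) x₀ < 0) :
    ∀ᶠ x in 𝓝 x₀, ∀ j, Collar κ μ j x₀ ↔ Collar κ μ j x := by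
  obtain ⟨ε, hε, hbox⟩ := exists_box_outerDisk h hx
  filter_upwards [Metric.ball_mem_nhds x₀ hε] with x hxb j
  rw [Metric.mem_ball, Real.dist_eq] at hxb
  constructor
  · intro hc
    obtain ⟨ρ, hρ, hmem⟩ := exists_of_collar hc hε
    exact collar_of_forall hε (hbox j x₀ ρ (by simpa using hε) hρ hmem x hxb)
  · intro hc
    obtain ⟨ρ, hρ, hmem⟩ := exists_of_collar hc hε
    exact collar_of_forall hε (hbox j x ρ hxb hρ hmem x₀ (by simpa using hε))

lemma exists_collar (h : ∀ j, 1 < modulus μ j) (hκ : ∀ i, 0 < κ i) {x₀ : ℝ}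
    (hx : genDeriv (order κ) (degree κ) (pole μ) x₀ < 0) : ∃ j, Collar κ μ j x₀ := by
  obtain ⟨ε, hε, hreg⟩ := exists_box_region h hx
  obtain ⟨ε', hε', hbox⟩ := exists_box_outerDisk h hx
  have hmin : 0 < min ε ε' := lt_min hε hε'
  have hle := min_le_left ε ε'
  have hle' := min_le_right ε ε'
  obtain ⟨j, hj⟩ := exists_mem_outerDisk h hκ (hreg x₀ (by simpa using hε) (1 + min ε ε' / 2)
    ⟨by linarith, by linarith⟩)
  exact ⟨j, collar_of_forall hε' (hbox j x₀ _ (by simpa using hε') ⟨by linarith, by linarith⟩ hj x₀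
    (by simpa using hε'))⟩

/-- Where the derivative is negative, belonging to the collar is locally constant in the angle,
hence constant on the whole arc. -/
lemma collar_of_mem_Ioo {C : ℤ → ℝ} (h : ∀ j, 1 < modulus μ j)
    (hC : Alternates m (genDeriv (order κ) (degree κ) (pole μ)) C) {i : ℤ} {j : Fin m} {x y : ℝ}
    (hx : x ∈ Ioo (C (2 * i - 1)) (C (2 * i))) (hy : y ∈ Ioo (C (2 * i - 1)) (C (2 * i)))
    (hc : Collar κ μ j x) : Collar κ μ j y := by
  have := isPreconnected_Ioo.induction₂ (fun x y => Collar κ μ j x ↔ Collar κ μ j y)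
    (fun x hx => ((collar_eventually h (hC.neg_of_mem (fun j => norm_pole_lt (h j)) hx)).filter_mono
      nhdsWithin_le_nhds).mono fun y hy => hy j)
    (fun x y z _ _ _ h1 h2 => h1.trans h2) (fun x y _ _ h => h.symm) hx hy
  exact this.1 hc

/-! ### Reflection in the circle -/

lemma isOpen_innerRegion : IsOpen (innerRegion κ μ) := by
  have h2 : Continuous fun z : ℂ => ‖∏ j : Fin m, (1 - conj (zero μ j) * z) ^ κ j.succ‖ := by
    refine (continuous_finsetProd _ fun j _ => ?_).norm
    exact (continuous_const.sub (continuous_const.mul continuous_id)).pow _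
  have h1 : IsOpen {z : ℂ | ‖z ^ κ 0 * ∏ j : Fin m, (z - zero μ j) ^ κ j.succ‖ <
      ‖∏ j : Fin m, (1 - conj (zero μ j) * z) ^ κ j.succ‖} := isOpen_lt (by fun_prop) h2
  exact (isOpen_lt continuous_norm continuous_const).inter h1

lemma isBounded_innerRegion : Bornology.IsBounded (innerRegion κ μ) :=
  (Metric.isBounded_ball (x := (0 : ℂ)) (r := 1)).subset fun z hz => by
    rw [mem_ball_zero_iff]; exact hz.1

lemma zero_mem_innerRegion (h0 : 0 < κ 0) : (0 : ℂ) ∈ innerRegion κ μ := by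
  refine ⟨by simp, ?_⟩
  rw [zero_pow (by omega), zero_mul]; simp

lemma num_ne_zero (h : ∀ j, 1 < modulus μ j) {z : ℂ} (hz : ‖z‖ ≤ 1) (hz0 : z ≠ 0) :
    z ^ κ 0 * ∏ j : Fin m, (z - zero μ j) ^ κ j.succ ≠ 0 := by
  refine mul_ne_zero (pow_ne_zero _ hz0) (Finset.prod_ne_zero_iff.2 fun j _ => pow_ne_zero _ ?_)
  intro h0
  rw [sub_eq_zero.1 h0, norm_zero (h j)] at hz
  linarith [h j]

lemma norm_num_eq_of_norm_one (h : ∀ j, 1 < modulus μ j) {z : ℂ} (hz : ‖z‖ = 1) :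
    ‖∏ j : Fin m, (1 - conj (zero μ j) * z) ^ κ j.succ‖ =
      ‖z ^ κ 0 * ∏ j : Fin m, (z - zero μ j) ^ κ j.succ‖ := by
  rw [norm_mul, norm_pow, hz, one_pow, one_mul, norm_prod, norm_prod]
  refine Finset.prod_congr rfl fun j _ => ?_
  rw [norm_pow, norm_pow]
  have h0 := norm_pos_iff.2 (one_sub_conj_zero_ne_zero hz.ge (h j))
  rw [(div_eq_one_iff_eq h0.ne').1 (norm_factor_eq_one (h j) hz)]

/-- The component of the inner region of each of its points contains the origin. -/
lemma zero_mem_component (h : ∀ j, 1 < modulus μ j) (h0 : 0 < κ 0) {p : ℂ}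
    (hp : p ∈ innerRegion κ μ) : (0 : ℂ) ∈ connectedComponentIn (innerRegion κ μ) p := by
  by_contra hnot
  have hcl : ∀ z ∈ closure (connectedComponentIn (innerRegion κ μ) p), ‖z‖ ≤ 1 ∧ z ≠ 0 := by
    intro z hz
    refine ⟨?_, ?_⟩
    · have : closure (connectedComponentIn (innerRegion κ μ) p) ⊆ {z : ℂ | ‖z‖ ≤ 1} :=
        closure_minimal (fun z hz => (connectedComponentIn_subset _ _ hz).1.le)
          (isClosed_le continuous_norm continuous_const)
      exact this hz
    · rintro rfl
      exact hnot (closure_component_inter isOpen_innerRegion hz (zero_mem_innerRegion h0))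
  -- A component that avoids the origin contains no zero of `B`, as all `a_j` lie outside the disk.
  -- The maximum principle for `1 / B` would then give `|B| ≥ 1` on it.
  have key := norm_le_one_on_component isOpen_innerRegion isBounded_innerRegion (p := p)
    (h := fun z => (∏ j : Fin m, (1 - conj (zero μ j) * z) ^ κ j.succ) /
      (z ^ κ 0 * ∏ j : Fin m, (z - zero μ j) ^ κ j.succ)) (fun z hz => ?_) (fun z hz hzF => ?_)
      (mem_connectedComponentIn hp)
  · have hpcl := hcl p (subset_closure (mem_connectedComponentIn hp))
    rw [norm_div, div_le_one (norm_pos_iff.2 (num_ne_zero h hpcl.1 hpcl.2))] at key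
    exact absurd hp.2 (not_lt.2 key)
  · refine DifferentiableAt.fun_div ?_ (by fun_prop) (num_ne_zero h (hcl z hz).1 (hcl z hz).2)
    refine DifferentiableAt.fun_finsetProd fun j _ => DifferentiableAt.fun_pow ?_ _
    exact (differentiableAt_id.const_mul (conj (zero μ j))).const_sub 1
  · rw [norm_div, div_le_one (norm_pos_iff.2 (num_ne_zero h (hcl z hz).1 (hcl z hz).2))]
    rcases (hcl z hz).1.eq_or_lt with h1 | h1
    · exact (norm_num_eq_of_norm_one h h1).le
    · exact not_lt.1 fun hlt => hzF ⟨h1, hlt⟩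

/-- Reflection in the unit circle exchanges `|B| > 1` and `|B| < 1`. -/
lemma reflect_mem_innerRegion_iff (h : ∀ j, 1 < modulus μ j) {z : ℂ} (hz : 1 < ‖z‖) :
    (conj z)⁻¹ ∈ innerRegion κ μ ↔ 1 < ‖blaschke κ μ z‖ := by
  have hz0 : z ≠ 0 := by rintro rfl; simp at hz; linarith
  have hzn : 0 < ‖z‖ := by linarith
  have hcz : conj z ≠ 0 := (map_ne_zero _).2 hz0
  have h1 : ∀ a : ℂ, ‖(conj z)⁻¹ - a‖ = ‖1 - conj a * z‖ / ‖z‖ := by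
    intro a
    have : (conj z)⁻¹ - a = conj (1 - conj a * z) / conj z := by
      simp only [map_sub, map_one, map_mul, Complex.conj_conj]
      field_simp
    rw [this, norm_div, RCLike.norm_conj, RCLike.norm_conj]
  have h2 : ∀ a : ℂ, ‖1 - conj a * (conj z)⁻¹‖ = ‖z - a‖ / ‖z‖ := by
    intro a
    have : 1 - conj a * (conj z)⁻¹ = conj (z - a) / conj z := by
      simp only [map_sub]
      field_simp
    rw [this, norm_div, RCLike.norm_conj, RCLike.norm_conj]
  have h3 : ∀ j, 0 < ‖1 - conj (zero μ j) * z‖ := fun j =>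
    norm_pos_iff.2 (one_sub_conj_zero_ne_zero hz.le (h j))
  have hinv : ‖(conj z)⁻¹‖ < 1 := by
    rw [norm_inv, RCLike.norm_conj]; exact inv_lt_one_of_one_lt₀ hz
  change _ ∧ _ ↔ _
  rw [and_iff_right hinv, norm_mul, norm_pow, norm_prod, norm_prod, norm_inv,
    RCLike.norm_conj, norm_blaschke]
  simp only [norm_pow, h1, h2, div_pow, Finset.prod_div_distrib]
  have hA : 0 < ∏ j : Fin m, ‖1 - conj (zero μ j) * z‖ ^ κ j.succ :=
    Finset.prod_pos fun j _ => pow_pos (h3 j) _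
  have hP : 0 < ∏ j : Fin m, ‖z‖ ^ κ j.succ := Finset.prod_pos fun j _ => pow_pos hzn _
  have hK : 0 < ‖z‖ ^ κ 0 := pow_pos hzn _
  rw [inv_pow, ← mul_div_assoc, div_lt_div_iff_of_pos_right hP, inv_mul_lt_iff₀ hK,
    ← mul_div_assoc, lt_div_iff₀ hA, one_mul]

/-- This is the reflection of a box outside the circle in which `|B| > 1`, available because the
derivative is positive. -/
lemma exists_box_innerRegion (h : ∀ j, 1 < modulus μ j) {x₀ : ℝ}
    (hx : 0 < genDeriv (order κ) (degree κ) (pole μ) x₀) :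
    ∃ δ : ℝ, 0 < δ ∧ δ < 1 ∧ ∀ ρ ∈ Ico (1 - δ) 1, (ρ : ℂ) * e x₀ ∈ innerRegion κ μ := by
  obtain ⟨ε, hε, hev⟩ := exists_box (κ := κ) h (σ := 1) (x₀ := x₀) (by linarith)
  obtain ⟨hm, hbox⟩ := hev.self_of_nhds
  have h1 : Tendsto (fun ρ : ℝ => ρ⁻¹) (𝓝 1) (𝓝 1) := by
    simpa using (tendsto_inv₀ (one_ne_zero : (1 : ℝ) ≠ 0))
  have h2 := h1.eventually (gt_mem_nhds (by linarith : (1 : ℝ) < 1 + ε))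
  obtain ⟨δ, hδ, hball⟩ := Metric.eventually_nhds_iff.1 h2
  refine ⟨min (δ / 2) (1 / 2), by positivity, by
    linarith [min_le_right (δ / 2) (1 / 2)], fun ρ hρ => ?_⟩
  have h3 := min_le_left (δ / 2) (1 / 2)
  have h4 := min_le_right (δ / 2) (1 / 2)
  have hρ0 : 0 < ρ := by linarith [hρ.1]
  have hρ1 : 1 < ρ⁻¹ := (one_lt_inv₀ hρ0).2 hρ.2
  have hρ2 : ρ⁻¹ < 1 + ε := hball (by
    rw [Real.dist_eq, abs_lt]; constructor <;> linarith [hρ.1, hρ.2])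
  have hb := hbox x₀ (by simpa using hε) ρ⁻¹ ⟨hρ1, hρ2⟩
  rw [one_mul] at hb
  have hb' := (Real.log_pos_iff (norm_nonneg _)).1 hb
  have hrefl := (reflect_mem_innerRegion_iff (κ := κ) h
    (by rw [norm_ofReal_mul_e (by positivity)]; exact hρ1)).2 hb'
  convert hrefl using 1
  rw [map_mul, Complex.conj_ofReal, conj_e, mul_inv, inv_inv]; push_cast; rw [inv_inv]

end collar


/-! ### The bijection between the disks and the decreasing arcs -/

/-- The disk around `a_j` touches the circle along the arc from `C (2i - 1)` to `C (2i)`. -/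
def Touches {m : ℕ} (κ : Fin (m + 1) → ℕ) (μ : Fin (2 * m) → ℝ) (C : ℤ → ℝ) (i : ℤ) (j : Fin m) :
    Prop :=
  ∃ x ∈ Ioo (C (2 * i - 1)) (C (2 * i)), Collar κ μ j x

section touches
variable {m : ℕ} {κ : Fin (m + 1) → ℕ} {μ : Fin (2 * m) → ℝ} {C : ℤ → ℝ}

lemma segment_radial (x a b : ℝ) {z : ℂ} (hz : z ∈ segment ℝ ((a : ℂ) * e x) ((b : ℂ) * e x)) :
    ∃ c ∈ segment ℝ a b, z = (c : ℂ) * e x := by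
  obtain ⟨s, t, hs, ht, hst, rfl⟩ := hz
  refine ⟨s * a + t * b, ⟨s, t, hs, ht, hst, rfl⟩, ?_⟩
  simp only [Complex.real_smul]; push_cast; ring

lemma ofReal_mul_e_eq_iff {x y : ℝ} (h : e x = e y) (hxy : |x - y| < 1) : x = y := by
  obtain ⟨n, hn⟩ := e_eq_iff.1 h
  have h1 : |(n : ℝ)| < 1 := by rw [hn] at hxy; simpa using hxy
  have h2 : |n| < 1 := by exact_mod_cast h1
  rw [Int.abs_lt_one_iff.1 h2] at hn
  simpa using hn

/-- A component touches at most one of the arcs on which the circle map decreases. -/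
lemma not_touches_of_lt (h : ∀ j, 1 < modulus μ j) (hκ : ∀ i, 0 < κ i)
    (hC : Alternates m (genDeriv (order κ) (degree κ) (pole μ)) C) {i i' : ℤ} (hlt : i < i')
    (hlt' : i' < i + m) {j : Fin m} (hi : Touches κ μ C i j) (hi' : Touches κ μ C i' j) :
    False := by
  obtain ⟨x, hx, hcx⟩ := hi
  obtain ⟨x', hx', hcx'⟩ := hi'
  have hw := fun j => norm_pole_lt (h j)
  -- The points `p` and `q` lie on the increasing arcs that follow the two decreasing ones, so they
  -- interlace with `x` and `x'`.
  obtain ⟨p, hp⟩ := nonempty_Ioo.2 (hC.strictMono (show 2 * i < 2 * i + 1 by omega))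
  obtain ⟨q, hq⟩ := nonempty_Ioo.2 (hC.strictMono (show 2 * i' < 2 * i' + 1 by omega))
  have o1 : x < p := hx.2.trans hp.1
  have o2 : p < x' := hp.2.trans_le ((hC.strictMono.monotone (by omega)).trans hx'.1.le)
  have o3 : x' < q := hx'.2.trans hq.1
  have o4 : q < x + 1 := by
    have h1 : C (2 * i' + 1) ≤ C (2 * i - 1 + 2 * m) := hC.strictMono.monotone (by omega)
    rw [hC.periodic] at h1
    linarith [hq.2, hx.1]
  -- Inside the disk, `S₁` joins `e x` to `e x'` through the reflected disk, where `|B| > 1`, and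
  -- `S₂` joins `e p` to `e q` through the origin, where `|B| < 1`. They are disjoint, which
  -- contradicts the interlacing.
  set S₁ : Set ℂ := (fun z => (conj z)⁻¹) '' outerDisk κ μ j ∪ {e x, e x'} with hS₁
  set S₂ : Set ℂ := innerRegion κ μ ∪ {e p, e q} with hS₂
  have hreg : ∀ z ∈ outerDisk κ μ j, 1 < ‖z‖ ∧ ‖blaschke κ μ z‖ < 1 := fun z hz =>
    outerDisk_subset j hz
  have hn₁ : ∀ z ∈ (fun z => (conj z)⁻¹) '' outerDisk κ μ j, ‖z‖ < 1 := by
    rintro _ ⟨z, hz, rfl⟩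
    rw [norm_inv, RCLike.norm_conj]; exact inv_lt_one_of_one_lt₀ (hreg z hz).1
  have hradial : ∀ y, Collar κ μ j y → e y ∈ S₁ →
      ∃ z ∈ outerDisk κ μ j, JoinedIn S₁ (e y) (conj z)⁻¹ := by
    intro y hc hy
    obtain ⟨b, hb1, hb⟩ := mem_nhdsGT_iff_exists_Ioc_subset.1 hc
    have hb1 : (1 : ℝ) < b := hb1
    have hb0 : 0 < b := by linarith
    refine ⟨(b : ℂ) * e y, hb ⟨hb1, le_rfl⟩, ?_⟩
    have hrefl : ∀ c : ℝ, (conj ((c : ℂ) * e y))⁻¹ = ((c⁻¹ : ℝ) : ℂ) * e y := by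
      intro c
      rw [map_mul, Complex.conj_ofReal, conj_e, mul_inv, inv_inv]; push_cast; rfl
    rw [hrefl]
    refine JoinedIn.of_segment_subset fun z hz => ?_
    obtain ⟨c, hc, rfl⟩ := segment_radial y 1 b⁻¹ (by simpa using hz)
    rw [segment_symm, segment_eq_Icc (inv_le_one_of_one_le₀ hb1.le)] at hc
    rcases hc.2.eq_or_lt with h1 | h1
    · rw [h1]; simpa using hy
    · left
      have hc0 : 0 < c := lt_of_lt_of_le (inv_pos.2 hb0) hc.1
      refine ⟨((c⁻¹ : ℝ) : ℂ) * e y, hb ⟨(one_lt_inv₀ hc0).2 h1, ?_⟩, ?_⟩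
      · exact inv_le_of_inv_le₀ hb0 hc.1
      · simp only [hrefl, inv_inv]
  have hconn₁ : ∀ z ∈ outerDisk κ μ j, ∀ z' ∈ outerDisk κ μ j,
      JoinedIn S₁ (conj z)⁻¹ (conj z')⁻¹ := by
    intro z hz z' hz'
    have ho : IsOpen (outerDisk κ μ j) := (isOpen_region h).connectedComponentIn
    have hpc : IsPathConnected (outerDisk κ μ j) := by
      refine (ho.isConnected_iff_isPathConnected).1 ⟨⟨z, hz⟩, isPreconnected_connectedComponentIn⟩
    have himg : IsPathConnected ((fun z => (conj z)⁻¹) '' outerDisk κ μ j) := by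
      refine hpc.image' fun y hy => ContinuousAt.continuousWithinAt ?_
      refine Complex.continuous_conj.continuousAt.inv₀ ((map_ne_zero _).2 ?_)
      rintro rfl
      have := (hreg 0 hy).1
      simp at this; linarith
    exact (himg.joinedIn _ (mem_image_of_mem _ hz) _ (mem_image_of_mem _ hz')).mono
      subset_union_left
  have hJ₁ : JoinedIn S₁ (e x) (e x') := by
    obtain ⟨z, hz, hj⟩ := hradial x hcx (Or.inr (Or.inl rfl))
    obtain ⟨z', hz', hj'⟩ := hradial x' hcx' (Or.inr (Or.inr rfl))
    exact (hj.trans (hconn₁ z hz z' hz')).trans hj'.symm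
  have hrad₂ : ∀ y, 0 < genDeriv (order κ) (degree κ) (pole μ) y → e y ∈ S₂ →
      JoinedIn S₂ (e y) 0 := by
    intro y hy hmem
    obtain ⟨δ, hδ, hδ1, hin⟩ := exists_box_innerRegion h hy
    have h1 : JoinedIn S₂ (e y) (((1 - δ : ℝ) : ℂ) * e y) := by
      refine JoinedIn.of_segment_subset fun z hz => ?_
      obtain ⟨c, hc, rfl⟩ := segment_radial y 1 (1 - δ) (by simpa using hz)
      rw [segment_symm, segment_eq_Icc (by linarith)] at hc
      rcases hc.2.eq_or_lt with h1 | h1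
      · rw [h1]; simpa using hmem
      · exact Or.inl (hin c ⟨hc.1, h1⟩)
    have h2 := hin (1 - δ) ⟨le_rfl, by linarith⟩
    have h3 := zero_mem_component h (hκ 0) h2
    have hpc : IsPathConnected (connectedComponentIn (innerRegion κ μ) (((1 - δ : ℝ) : ℂ) * e y)) :=
      (isOpen_innerRegion.connectedComponentIn.isConnected_iff_isPathConnected).1
        ⟨⟨0, h3⟩, isPreconnected_connectedComponentIn⟩
    exact h1.trans ((hpc.joinedIn _ (mem_connectedComponentIn h2) _ h3).mono
      ((connectedComponentIn_subset _ _).trans subset_union_left))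
  have hJ₂ : JoinedIn S₂ (e p) (e q) :=
    (hrad₂ p (hC.pos_of_mem hw hp) (Or.inr (Or.inl rfl))).trans
      (hrad₂ q (hC.pos_of_mem hw hq) (Or.inr (Or.inr rfl))).symm
  refine not_joinedIn_of_interlaced o1 o2 o3 o4 ?_ ?_ ?_ hJ₁ hJ₂
  · rintro z (hz | rfl | rfl)
    · exact (hn₁ z hz).le
    · simp
    · simp
  · rintro z (hz | rfl | rfl)
    · exact hz.1.le
    · simp
    · simp
  · rw [disjoint_left]
    rintro z (hz | hz) (hz' | hz')
    · obtain ⟨y, hy, rfl⟩ := hz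
      have := (reflect_mem_innerRegion_iff h (hreg y hy).1).1 hz'
      linarith [(hreg y hy).2]
    · have h1 := hn₁ z hz
      rcases hz' with rfl | rfl <;> simp at h1
    · have h1 := hz'.1
      rcases hz with rfl | rfl <;> simp at h1
    · rcases hz with rfl | rfl <;> rcases hz' with hz' | hz' <;>
        · have := ofReal_mul_e_eq_iff hz' (by rw [abs_lt]; constructor <;> linarith)
          linarith

lemma collar_add_int {j : Fin m} {x : ℝ} (n : ℤ) : Collar κ μ j (x + n) ↔ Collar κ μ j x := by
  unfold Collar; rw [e_add_int]

lemma touches_add (hp : ∀ i, C (i + 2 * m) = C i + 1) {i : ℤ} {j : Fin m} (n : ℤ) :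
    Touches κ μ C (i + m * n) j ↔ Touches κ μ C i j := by
  have h1 : C (2 * (i + m * n) - 1) = C (2 * i - 1) + n := by
    rw [← periodic_int hp]; congr 1; ring
  have h2 : C (2 * (i + m * n)) = C (2 * i) + n := by
    rw [← periodic_int hp]; congr 1; ring
  unfold Touches
  rw [h1, h2]
  constructor
  · rintro ⟨x, hx, hc⟩
    refine ⟨x + ((-n : ℤ) : ℝ), ?_, (collar_add_int _).2 hc⟩
    push_cast
    exact ⟨by linarith [hx.1], by linarith [hx.2]⟩
  · rintro ⟨x, hx, hc⟩
    exact ⟨x + n, ⟨by linarith [hx.1], by linarith [hx.2]⟩, (collar_add_int _).2 hc⟩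

lemma touches_inj (h : ∀ j, 1 < modulus μ j) (hκ : ∀ i, 0 < κ i)
    (hC : Alternates m (genDeriv (order κ) (degree κ) (pole μ)) C) {i i' : ℤ} {j : Fin m}
    (hi : Touches κ μ C i j) (hi' : Touches κ μ C i' j) : ∃ n : ℤ, i' = i + m * n := by
  have hm : (0 : ℤ) < m := by exact_mod_cast hC.m_pos
  refine ⟨(i' - i) / m, ?_⟩
  have h1 := Int.emod_nonneg (i' - i) hm.ne'
  have h2 := Int.emod_lt_of_pos (i' - i) hm
  have h3 := Int.emod_add_mul_ediv (i' - i) m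
  set r := (i' - i) % m
  set n := (i' - i) / m
  have h4 : Touches κ μ C (i + m * n) j := (touches_add hC.periodic n).2 hi
  rcases h1.eq_or_lt with h0 | h0
  · omega
  · exact (not_touches_of_lt h hκ hC (by omega) (by omega) h4 hi').elim

lemma exists_touches (h : ∀ j, 1 < modulus μ j) (hκ : ∀ i, 0 < κ i)
    (hC : Alternates m (genDeriv (order κ) (degree κ) (pole μ)) C) (i : ℤ) :
    ∃ j, Touches κ μ C i j := by
  obtain ⟨x, hx, hneg⟩ := hC.neg i
  obtain ⟨j, hj⟩ := exists_collar h hκ hneg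
  exact ⟨j, x, hx, hj⟩

lemma touches_of_outerDisk_eq {i : ℤ} {j l : Fin m} (ht : Touches κ μ C i j)
    (hjl : outerDisk κ μ j = outerDisk κ μ l) : Touches κ μ C i l := by
  obtain ⟨x, hx, hc⟩ := ht
  refine ⟨x, hx, ?_⟩
  unfold Collar at hc ⊢
  rwa [← hjl]

/-- Each disk touches exactly one arc in a period, and different disks touch different arcs. -/
lemma exists_perm_touches (h : ∀ j, 1 < modulus μ j) (hκ : ∀ i, 0 < κ i)
    (hC : Alternates m (genDeriv (order κ) (degree κ) (pole μ)) C) :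
    ∃ f : Fin m → Fin m, Function.Bijective f ∧ ∀ i : Fin m, Touches κ μ C ((i : ℤ) + 1) (f i) := by
  choose f hf using fun i : Fin m => exists_touches h hκ hC ((i : ℤ) + 1)
  refine ⟨f, Finite.injective_iff_bijective.1 fun a b hab => ?_, hf⟩
  have h1 := hf b
  rw [← hab] at h1
  obtain ⟨n, hn⟩ := touches_inj h hκ hC (hf a) h1
  have ha := a.2
  have hb := b.2
  have hn0 : n = 0 := by
    by_contra hne
    rcases lt_or_gt_of_ne hne with h2 | h2 <;> nlinarith
  rw [hn0] at hn
  exact Fin.ext (by omega)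

/-- Different zeros are matched with different arcs of a period, while a common disk would touch
both arcs. -/
lemma eq_of_outerDisk_eq (h : ∀ j, 1 < modulus μ j) (hκ : ∀ i, 0 < κ i)
    (hC : Alternates m (genDeriv (order κ) (degree κ) (pole μ)) C) {j l : Fin m}
    (hjl : outerDisk κ μ j = outerDisk κ μ l) : j = l := by
  obtain ⟨f, hf, hft⟩ := exists_perm_touches h hκ hC
  obtain ⟨a, rfl⟩ := hf.2 j
  obtain ⟨b, rfl⟩ := hf.2 l
  obtain ⟨n, hn⟩ := touches_inj h hκ hC (touches_of_outerDisk_eq (hft a) hjl) (hft b)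
  have ha := a.2
  have hb := b.2
  have hn0 : n = 0 := by
    by_contra hne
    rcases lt_or_gt_of_ne hne with h2 | h2 <;> nlinarith
  rw [hn0] at hn
  have : a = b := Fin.ext (by omega)
  rw [this]

lemma touches_unique (h : ∀ j, 1 < modulus μ j) (hκ : ∀ i, 0 < κ i)
    (hC : Alternates m (genDeriv (order κ) (degree κ) (pole μ)) C) {i : ℤ} {j l : Fin m}
    (hj : Touches κ μ C i j) (hl : Touches κ μ C i l) : j = l := by
  obtain ⟨x, hx, hcx⟩ := hj
  obtain ⟨y, hy, hcy⟩ := hl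
  have hcx' := collar_of_mem_Ioo h hC hx hy hcx
  obtain ⟨ρ, h1, h2⟩ := (hcx'.and hcy).exists
  refine eq_of_outerDisk_eq h hκ hC ?_
  exact (connectedComponentIn_eq h1).trans (connectedComponentIn_eq h2).symm

/-- The disk around a zero contains no other zero. -/
lemma eq_of_zero_mem_outerDisk (h : ∀ j, 1 < modulus μ j) (hκ : ∀ i, 0 < κ i)
    (hC : Alternates m (genDeriv (order κ) (degree κ) (pole μ)) C) {j l : Fin m}
    (hl : zero μ l ∈ outerDisk κ μ j) : l = j :=
  (eq_of_outerDisk_eq h hκ hC (connectedComponentIn_eq hl)).symm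

/-! ### Labellings -/

lemma mem_closure_of_touches (h : ∀ j, 1 < modulus μ j)
    (hC : Alternates m (genDeriv (order κ) (degree κ) (pole μ)) C) {i : ℤ} {j : Fin m}
    (ht : Touches κ μ C i j) {y : ℝ} (hy : y ∈ Icc (C (2 * i - 1)) (C (2 * i))) :
    e y ∈ closure (outerDisk κ μ j) := by
  obtain ⟨x, hx, hc⟩ := ht
  have hlt : C (2 * i - 1) < C (2 * i) := hx.1.trans hx.2
  have h1 : e '' Ioo (C (2 * i - 1)) (C (2 * i)) ⊆ closure (outerDisk κ μ j) := by
    rintro _ ⟨z, hz, rfl⟩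
    have hcz := collar_of_mem_Ioo h hC hx hz hc
    have ht : Tendsto (fun ρ : ℝ => (ρ : ℂ) * e z) (𝓝[>] 1) (𝓝 (e z)) := by
      have : Tendsto (fun ρ : ℝ => (ρ : ℂ) * e z) (𝓝 1) (𝓝 (((1 : ℝ) : ℂ) * e z)) :=
        (Complex.continuous_ofReal.mul continuous_const).continuousAt
      simp only [Complex.ofReal_one, one_mul] at this
      exact this.mono_left nhdsWithin_le_nhds
    exact mem_closure_of_tendsto ht hcz
  have h2 : e y ∈ closure (e '' Ioo (C (2 * i - 1)) (C (2 * i))) := by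
    rw [← closure_Ioo hlt.ne] at hy
    exact image_closure_subset_closure_image continuous_e (mem_image_of_mem e hy)
  exact closure_minimal h1 isClosed_closure h2

lemma exists_polar_near (x₀ : ℝ) {ε : ℝ} (hε : 0 < ε) :
    ∀ᶠ z : ℂ in 𝓝 (e x₀), ∃ x, |x - x₀| < ε ∧ |‖z‖ - 1| < ε ∧ z = (‖z‖ : ℂ) * e x := by
  have h0 : e x₀ / e x₀ = 1 := div_self (e_ne_zero _)
  have hcont : ContinuousAt (fun z : ℂ => Complex.arg (z / e x₀) / (2 * Real.pi)) (e x₀) := by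
    refine ContinuousAt.div_const ?_ _
    refine ContinuousAt.comp (g := Complex.arg) ?_ (by fun_prop)
    rw [h0]; exact Complex.continuousAt_arg Complex.one_mem_slitPlane
  have h1 : ∀ᶠ z : ℂ in 𝓝 (e x₀), |Complex.arg (z / e x₀) / (2 * Real.pi)| < ε := by
    refine hcont.abs.eventually (gt_mem_nhds ?_)
    dsimp only
    rw [h0]; simpa using hε
  have h2 : ∀ᶠ z : ℂ in 𝓝 (e x₀), |‖z‖ - 1| < ε := by
    have : ContinuousAt (fun z : ℂ => |‖z‖ - 1|) (e x₀) := by fun_prop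
    refine this.eventually (gt_mem_nhds ?_)
    simpa using hε
  filter_upwards [h1, h2] with z hz1 hz2
  refine ⟨x₀ + Complex.arg (z / e x₀) / (2 * Real.pi), by simpa using hz1, hz2, ?_⟩
  have hπ := Real.pi_ne_zero
  have h3 : e (Complex.arg (z / e x₀) / (2 * Real.pi)) =
      Complex.exp (Complex.arg (z / e x₀) * Complex.I) := by
    rw [e_eq]; congr 3; field_simp
  have h4 := Complex.norm_mul_exp_arg_mul_I (z / e x₀)
  rw [norm_div, norm_e, div_one] at h4
  rw [e_add, h3, mul_left_comm, h4, mul_div_cancel₀ _ (e_ne_zero x₀)]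

/-- Near the maximum the second derivative is negative, so `|B|` decreases along circles in the
direction of the arc. A point of the disk close to the turning point can therefore be moved along
its circle to a place above the arc without leaving the disk. -/
lemma touches_of_mem_closure (h : ∀ j, 1 < modulus μ j)
    (hC : Alternates m (genDeriv (order κ) (degree κ) (pole μ)) C) {i : ℤ} {j : Fin m}
    (hcl : e (C (2 * i - 1)) ∈ closure (outerDisk κ μ j)) : Touches κ μ C i j := by
  have hw := fun j => norm_pole_lt (h j)
  obtain ⟨ε, hε, hanti⟩ := exists_box_antitone h (hC.deriv_neg hw i)
  have hlt : C (2 * i - 1) < C (2 * i) := hC.strictMono (by omega)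
  set x₁ := C (2 * i - 1) + min ε (C (2 * i) - C (2 * i - 1)) / 2 with hx₁
  have hmin : 0 < min ε (C (2 * i) - C (2 * i - 1)) := lt_min hε (sub_pos.2 hlt)
  have hm1 := min_le_left ε (C (2 * i) - C (2 * i - 1))
  have hm2 := min_le_right ε (C (2 * i) - C (2 * i - 1))
  have hx₁mem : x₁ ∈ Ioo (C (2 * i - 1)) (C (2 * i)) := ⟨by linarith, by linarith⟩
  obtain ⟨ε', hε', hbox⟩ := exists_box_outerDisk h (hC.neg_of_mem hw hx₁mem)
  have hη : 0 < min (min ε ε') (x₁ - C (2 * i - 1)) :=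
    lt_min (lt_min hε hε') (sub_pos.2 hx₁mem.1)
  obtain ⟨z, ⟨x, hx, hzn, hz⟩, hzD⟩ := mem_closure_iff_nhds.1 hcl _
    (exists_polar_near (C (2 * i - 1)) hη)
  have hn1 := min_le_left (min ε ε') (x₁ - C (2 * i - 1))
  have hn2 := min_le_right (min ε ε') (x₁ - C (2 * i - 1))
  have hn3 := min_le_left ε ε'
  have hn4 := min_le_right ε ε'
  have hzr := outerDisk_subset j hzD
  have hz1 : 1 < ‖z‖ := hzr.1
  have hx' := abs_lt.1 hx
  have hzn' := abs_lt.1 hzn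
  set ρ := ‖z‖ with hρ
  have hxx₁ : x ≤ x₁ := by linarith
  have hmem₁ : (ρ : ℂ) * e x₁ ∈ outerDisk κ μ j := by
    refine mem_component_of_isPreconnected (S := (fun y : ℝ => (ρ : ℂ) * e y) '' Icc x x₁)
      (isPreconnected_Icc.image _ (continuous_const.mul continuous_e).continuousOn) ?_
      (mem_image_of_mem _ ⟨le_rfl, hxx₁⟩) (hz ▸ hzD) (mem_image_of_mem _ ⟨hxx₁, le_rfl⟩)
    rintro _ ⟨y, hy, rfl⟩
    refine ⟨?_, ?_⟩
    · change 1 < ‖(ρ : ℂ) * e y‖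
      rw [norm_ofReal_mul_e (by linarith)]; exact hz1
    · refine lt_of_le_of_lt (hanti ρ ⟨hz1, by linarith⟩ x y (by linarith) hy.1 (by linarith [hy.2]))
        ?_
      rw [← hz]; exact hzr.2
  exact ⟨x₁, hx₁mem, collar_of_forall hε' (hbox j x₁ ρ (by simpa using hε')
    ⟨hz1, by linarith⟩ hmem₁ x₁ (by simpa using hε'))⟩

/-- The closure conditions at the turning points are traded for `Touches`, a condition at interior
points of the arcs, which survives small changes of the parameters. -/
lemma isLabelling_iff : IsLabelling κ μ C ↔ (∀ j, 1 < modulus μ j) ∧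
    Alternates m (genDeriv (order κ) (degree κ) (pole μ)) C ∧
    ∀ j : Fin m, Touches κ μ C ((j : ℤ) + 1) j := by
  constructor
  · intro hL
    have hC := hL.multimodal
    rw [lift_eq_genLift] at hC
    have hA := hC.alternates fun j => norm_pole_lt (hL.one_lt_modulus j)
    refine ⟨hL.one_lt_modulus, hA, fun j => touches_of_mem_closure hL.one_lt_modulus hA ?_⟩
    have := hL.max_mem j
    rwa [show 2 * ((j : ℤ) + 1) - 1 = 2 * j + 1 by ring]
  · rintro ⟨h, hA, ht⟩
    have hlt : ∀ j : Fin m, C (2 * ((j : ℤ) + 1) - 1) ≤ C (2 * ((j : ℤ) + 1)) :=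
      fun j => hA.strictMono.monotone (by omega)
    refine ⟨h, ?_, fun j => ?_, fun j => ?_⟩
    · rw [lift_eq_genLift]; exact hA.isMultimodalLift fun j => norm_pole_lt (h j)
    · have := mem_closure_of_touches h hA (ht j) ⟨le_rfl, hlt j⟩
      rwa [show 2 * ((j : ℤ) + 1) - 1 = 2 * j + 1 by ring] at this
    · have := mem_closure_of_touches h hA (ht j) ⟨hlt j, le_rfl⟩
      rwa [show 2 * ((j : ℤ) + 1) = 2 * j + 2 by ring] at this

end touches


/-! ### Estimates for the variation on the decreasing arcs -/

/-- An antiderivative of the Poisson kernel. -/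
noncomputable def poissonInt (w : ℂ) (t : ℝ) : ℝ :=
  genLift (fun _ : Fin 1 => -1) 1 0 (fun _ => w) t

/-- With `D = 1` and the single order `-1`, `genDeriv_eq` reads `1 - 1 + P`. -/
lemma hasDerivAt_poissonInt {w : ℂ} (hw : ‖w‖ < 1) (t : ℝ) :
    HasDerivAt (poissonInt w) (poisson w t) t := by
  have := hasDerivAt_genLift (k := fun _ : Fin 1 => -1) (D := 1) (θ := 0) (w := fun _ => w)
    (fun _ => hw) t
  rw [genDeriv_eq fun _ => hw] at this
  refine this.congr_deriv ?_
  simp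

lemma poissonInt_add_one (w : ℂ) (t : ℝ) : poissonInt w (t + 1) = poissonInt w t + 1 :=
  genLift_add_one _ _ _ _ _

lemma strictMono_poissonInt {w : ℂ} (hw : ‖w‖ < 1) : StrictMono (poissonInt w) := by
  refine strictMono_of_deriv_pos fun t => ?_
  rw [(hasDerivAt_poissonInt hw t).deriv]; exact poisson_pos hw t

section estimates
variable {m : ℕ} {κ : Fin (m + 1) → ℕ} {μ : Fin (2 * m) → ℝ} {C : ℤ → ℝ}

lemma genDeriv_eq_sub (h : ∀ j, 1 < modulus μ j) (x : ℝ) :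
    genDeriv (order κ) (degree κ) (pole μ) x =
      κ 0 - ∑ j, order κ j * poisson (pole μ j) x := by
  rw [genDeriv_eq (fun j => norm_pole_lt (h j)), order_degree_sum]

/-- On the arc touched by the disk around `a_j`, the decrease is at most that of the factor with the
zero `a_j`. -/
lemma genDeriv_add_nonneg (h : ∀ j, 1 < modulus μ j) (hκ : ∀ i, 0 < κ i)
    (hC : Alternates m (genDeriv (order κ) (degree κ) (pole μ)) C) {i : ℤ} {j : Fin m}
    (ht : Touches κ μ C i j) {x : ℝ} (hx : x ∈ Ioo (C (2 * i - 1)) (C (2 * i))) :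
    0 ≤ genDeriv (order κ) (degree κ) (pole μ) x + order κ j * poisson (pole μ j) x := by
  obtain ⟨y, hy, hcy⟩ := ht
  have hcx := collar_of_mem_Ioo h hC hy hx hcy
  -- Let `B'` be `B` without the factor of `a_j`. It has no zero in the disk around `a_j`, and `|B'|
  -- ≥ |B| = 1` on the boundary because the omitted factor has modulus at most `1`. Hence `|B'| ≥ 1`
  -- in the disk, and the radial derivative of `log |B'|` at `e x`, which is `F' + k_j P_j`, cannot
  -- be negative.
  set κ' : Fin (m + 1) → ℕ := Function.update κ j.succ 0 with hκ'
  have hj : κ' j.succ = 0 := by simp [hκ']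
  have hl : ∀ l, l ≠ j → κ' l.succ = κ l.succ := fun l hl => by
    rw [hκ', Function.update_of_ne]; simpa using hl
  have h0 : κ' 0 = κ 0 := by rw [hκ', Function.update_of_ne]; exact (Fin.succ_ne_zero j).symm
  have hg : genDeriv (order κ') (degree κ') (pole μ) x =
      genDeriv (order κ) (degree κ) (pole μ) x + order κ j * poisson (pole μ j) x := by
    rw [genDeriv_eq_sub h, genDeriv_eq_sub h, h0,
      ← Finset.add_sum_erase _ (fun l => order κ' l * poisson (pole μ l) x) (Finset.mem_univ j),
      ← Finset.add_sum_erase _ (fun l => order κ l * poisson (pole μ l) x) (Finset.mem_univ j)]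
    have h1 : ∑ l ∈ Finset.univ.erase j, order κ' l * poisson (pole μ l) x =
        ∑ l ∈ Finset.univ.erase j, order κ l * poisson (pole μ l) x :=
      Finset.sum_congr rfl fun l hl' => by
        unfold order; rw [hl l (Finset.ne_of_mem_erase hl')]
    rw [h1]
    have h2 : order κ' j = 0 := by unfold order; rw [hj]; simp
    rw [h2]; ring
  rw [← hg]
  by_contra hneg
  obtain ⟨ε, hε, hev⟩ := exists_box (κ := κ') h (σ := -1) (x₀ := x) (by linarith [not_le.1 hneg])
  obtain ⟨hm, hbox⟩ := hev.self_of_nhds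
  obtain ⟨ρ, hρ, hmem⟩ := exists_of_collar hcx hε
  have hlog := hbox x (by simpa using hε) ρ hρ
  have hρm : ∀ l, ρ < modulus μ l := fun l => hρ.2.trans (hm l)
  have hlt : ‖blaschke κ' μ (ρ * e x)‖ < 1 :=
    (Real.log_neg_iff (blaschke_norm_pos x hρ.1.le hρm)).1 (by linarith)
  refine absurd hlt (not_lt.2 ?_)
  refine one_le_norm_blaschke_on_component h hκ (p := zero μ j) (fun l hlm => ?_)
    (fun z hz hz1 => ?_) hmem
  · rw [eq_of_zero_mem_outerDisk h hκ hC hlm, hj]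
  · rw [← hz1, norm_blaschke, norm_blaschke, h0]
    refine mul_le_mul_of_nonneg_left (Finset.prod_le_prod (fun l _ => by positivity) fun l _ => ?_)
      (by positivity)
    by_cases hlj : l = j
    · rw [hlj, hj, pow_zero]
      exact pow_le_one₀ (by positivity) (norm_factor_le_one (h j) hz)
    · rw [hl l hlj]

/-- The function decreases by less than `k_j` on the arc touched by the disk around `a_j`. -/
lemma drop_lt (h : ∀ j, 1 < modulus μ j) (hκ : ∀ i, 0 < κ i)
    (hC : Alternates m (genDeriv (order κ) (degree κ) (pole μ)) C) {i : ℤ} {j : Fin m}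
    (ht : Touches κ μ C i j) :
    lift κ μ (C (2 * i - 1)) - lift κ μ (C (2 * i)) < κ j.succ := by
  have hw := fun j => norm_pole_lt (h j)
  have hlt : C (2 * i - 1) < C (2 * i) := hC.strictMono (by omega)
  have hder : ∀ x, HasDerivAt (fun x => lift κ μ x + order κ j * poissonInt (pole μ j) x)
      (genDeriv (order κ) (degree κ) (pole μ) x + order κ j * poisson (pole μ j) x) x := by
    intro x
    rw [lift_eq_genLift]
    exact (hasDerivAt_genLift hw x).add ((hasDerivAt_poissonInt (hw j) x).const_mul _)
  have hmono : MonotoneOn (fun x => lift κ μ x + order κ j * poissonInt (pole μ j) x)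
      (Icc (C (2 * i - 1)) (C (2 * i))) := by
    refine monotoneOn_of_deriv_nonneg (convex_Icc _ _)
      (fun x _ => (hder x).continuousAt.continuousWithinAt)
      (fun x _ => (hder x).differentiableAt.differentiableWithinAt) fun x hx => ?_
    rw [interior_Icc] at hx
    rw [(hder x).deriv]
    exact genDeriv_add_nonneg h hκ hC ht hx
  have h1 := hmono ⟨le_rfl, hlt.le⟩ ⟨hlt.le, le_rfl⟩ hlt.le
  -- The Poisson kernel has mass `1` over a period and is positive, and the arc is shorter than a
  -- period.
  have h2 : poissonInt (pole μ j) (C (2 * i)) < poissonInt (pole μ j) (C (2 * i - 1)) + 1 := by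
    rw [← poissonInt_add_one]
    refine strictMono_poissonInt (hw j) (sub_lt_of_periodic hC.strictMono hC.periodic ?_)
    have := hC.m_pos
    omega
  have hk : 0 < order κ j := by unfold order; exact_mod_cast hκ _
  dsimp only at h1
  have h3 : order κ j * poissonInt (pole μ j) (C (2 * i)) <
      order κ j * (poissonInt (pole μ j) (C (2 * i - 1)) + 1) := mul_lt_mul_of_pos_left h2 hk
  have h4 : order κ j = κ j.succ := rfl
  rw [← h4]
  linarith

lemma poisson_le_of_le {j : Fin m} (h : 1 < modulus μ j) {s t : ℝ}
    (hst : |s - angle μ j| ≤ |t - angle μ j|) (ht : |t - angle μ j| ≤ 1 / 2) :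
    poisson (pole μ j) t ≤ poisson (pole μ j) s := by
  rw [poisson_pole h, poisson_pole h]
  refine div_le_div_of_nonneg_left (by nlinarith) (numSq_pos one_pos h) ?_
  unfold numSq
  have hcos : Real.cos (2 * Real.pi * (t - angle μ j)) ≤ Real.cos (2 * Real.pi * (s - angle μ j)) := by
    have habs : ∀ x, |2 * Real.pi * x| = 2 * Real.pi * |x| := fun x => by
      rw [abs_mul, abs_of_pos (by positivity : 0 < 2 * Real.pi)]
    rw [← Real.cos_abs, ← Real.cos_abs (2 * Real.pi * (s - angle μ j)), habs, habs]
    have hπ := Real.pi_pos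
    refine Real.cos_le_cos_of_nonneg_of_le_pi (by positivity) ?_ ?_ <;> nlinarith
  have : 0 < 2 * 1 * modulus μ j := by linarith
  nlinarith

/-- The mass of the Poisson kernel near its centre. -/
lemma poissonInt_sub_ge {j : Fin m} (h : 1 < modulus μ j) {a : ℝ} (ha : 0 < a) (ha' : a ≤ 1 / 2) :
    1 - (modulus μ j ^ 2 - 1) / (2 * (1 - Real.cos (2 * Real.pi * a))) ≤
      poissonInt (pole μ j) (angle μ j + a) - poissonInt (pole μ j) (angle μ j - a) := by
  set A := poissonInt (pole μ j)
  set η := angle μ j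
  set c := (modulus μ j ^ 2 - 1) / (2 * (1 - Real.cos (2 * Real.pi * a))) with hc
  have hπ := Real.pi_pos
  have hcos : Real.cos (2 * Real.pi * a) < 1 := by
    refine lt_of_le_of_ne (Real.cos_le_one _) fun h1 => ?_
    have h2 := (Real.cos_eq_one_iff_of_lt_of_lt (by nlinarith) (by nlinarith)).1 h1
    nlinarith
  have hP : ∀ t, a ≤ |t - η| → |t - η| ≤ 1 / 2 → poisson (pole μ j) t ≤ c := by
    intro t h1 h2
    have h3 := poisson_le_of_le h (s := η + a) (t := t) (by
      rw [add_sub_cancel_left, abs_of_pos ha]; exact h1) h2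
    refine h3.trans ?_
    rw [poisson_pole h, hc]
    refine div_le_div_of_nonneg_left (by nlinarith) (by linarith) ?_
    unfold numSq
    rw [add_sub_cancel_left]
    nlinarith [sq_nonneg (modulus μ j - 1)]
  have hanti : ∀ x y, x ≤ y → (∀ t ∈ Ioo x y, poisson (pole μ j) t ≤ c) →
      A y - A x ≤ c * (y - x) := by
    intro x y hxy hb
    rcases hxy.eq_or_lt with rfl | hxy
    · simp
    obtain ⟨t, ht, hs⟩ := exists_hasDerivAt_eq_slope A (poisson (pole μ j)) hxy
      (fun x _ => (hasDerivAt_poissonInt (norm_pole_lt h) x).continuousAt.continuousWithinAt)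
      (fun x _ => hasDerivAt_poissonInt (norm_pole_lt h) x)
    have := hb t ht
    rwa [hs, div_le_iff₀ (sub_pos.2 hxy)] at this
  -- The kernel has total mass `1`. Between the distances `a` and `1/2` from its centre it is at
  -- most `c`, and these two intervals have total length at most `1`.
  have h1 := hanti (η + a) (η + 1 / 2) (by linarith) fun t ht => hP t
    (by rw [abs_of_pos] <;> linarith [ht.1]) (by rw [abs_of_pos] <;> linarith [ht.1, ht.2])
  have h2 := hanti (η - 1 / 2) (η - a) (by linarith) fun t ht => hP t
    (by rw [abs_of_neg] <;> linarith [ht.2]) (by rw [abs_of_neg] <;> linarith [ht.1, ht.2])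
  have h3 : A (η + 1 / 2) = A (η - 1 / 2) + 1 := by
    rw [← poissonInt_add_one]; congr 1; ring
  have hc0 : 0 ≤ c := div_nonneg (by nlinarith) (by linarith)
  nlinarith

lemma lift_add_int (n : ℤ) (t : ℝ) : lift κ μ (t + n) = lift κ μ t + degree κ * n := by
  rw [lift_eq_genLift, genLift_add_int]

/-- A lower bound for the decrease on the arc that belongs to a zero near the circle. -/
lemma drop_ge (h : ∀ j, 1 < modulus μ j) (hκ : ∀ i, 0 < κ i)
    (hC : Alternates m (genDeriv (order κ) (degree κ) (pole μ)) C) {i₀ : ℤ} {j : Fin m}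
    (ht₀ : Touches κ μ C i₀ j) (hr : (κ 0 : ℝ) * (modulus μ j - 1) < 2) {a : ℝ} (ha : 0 < a)
    (ha' : a ≤ 1 / 2) :
    κ j.succ * (1 - (modulus μ j ^ 2 - 1) / (2 * (1 - Real.cos (2 * Real.pi * a)))) -
      4 * κ 0 * a ≤ lift κ μ (C (2 * i₀ - 1)) - lift κ μ (C (2 * i₀)) := by
  have hw := fun j => norm_pole_lt (h j)
  set A := poissonInt (pole μ j) with hA
  set η := angle μ j with hη
  set K := order κ j with hK
  have hk : 1 ≤ K := by rw [hK]; unfold order; exact_mod_cast hκ _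
  have hk0 : 0 < (κ 0 : ℝ) := by exact_mod_cast hκ 0
  -- The peak of the kernel is `(r + 1) / (r - 1)`, which exceeds `k_0` when `k_0 (r - 1) < 2`. So
  -- the derivative is negative at the angle of `a_j`.
  have hPη : (κ 0 : ℝ) < K * poisson (pole μ j) η := by
    have h1 : poisson (pole μ j) η = (modulus μ j ^ 2 - 1) / (modulus μ j - 1) ^ 2 := by
      rw [poisson_pole (h j)]; unfold numSq
      rw [← hη, sub_self, mul_zero, Real.cos_zero]; congr 1; ring
    have hr1 : 0 < modulus μ j - 1 := sub_pos.2 (h j)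
    have h2 : (κ 0 : ℝ) < poisson (pole μ j) η := by
      rw [h1, lt_div_iff₀ (by positivity)]
      nlinarith
    nlinarith
  have hterm : ∀ l x, 0 ≤ order κ l * poisson (pole μ l) x := fun l x =>
    mul_nonneg (by unfold order; positivity) (poisson_pos (hw l) x).le
  have hle : ∀ x, genDeriv (order κ) (degree κ) (pole μ) x + K * poisson (pole μ j) x ≤ κ 0 := by
    intro x
    rw [genDeriv_eq_sub h]
    have := Finset.single_le_sum (f := fun l => order κ l * poisson (pole μ l) x)
      (fun l _ => hterm l x) (Finset.mem_univ j)
    linarith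
  have hle₂ : ∀ l x, l ≠ j → genDeriv (order κ) (degree κ) (pole μ) x +
      order κ l * poisson (pole μ l) x + K * poisson (pole μ j) x ≤ κ 0 := by
    intro l x hlj
    rw [genDeriv_eq_sub h]
    have := Finset.add_le_sum (f := fun l => order κ l * poisson (pole μ l) x)
      (fun l _ => hterm l x) (Finset.mem_univ l) (Finset.mem_univ j) hlj
    linarith
  -- the arc that contains the angle of `a_j`
  have hneg : genDeriv (order κ) (degree κ) (pole μ) η < 0 := by linarith [hle η]
  obtain ⟨i, hηi, ti⟩ : ∃ i : ℤ, η ∈ Ioo (C (2 * i - 1)) (C (2 * i)) ∧ Touches κ μ C i j := by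
    obtain ⟨i', hi1, hi2⟩ := exists_mem_Ico hC.strictMono hC.periodic η
    have hne : C i' ≠ η := fun h0 => by rw [← h0, hC.zero] at hneg; exact lt_irrefl _ hneg
    have hi1' := lt_of_le_of_ne hi1 hne
    obtain ⟨i, rfl⟩ : ∃ i, i' = 2 * i - 1 := by
      rcases Int.even_or_odd' i' with ⟨n, rfl | rfl⟩
      · exact absurd (hC.pos_of_mem hw ⟨hi1', hi2⟩) (not_lt.2 hneg.le)
      · exact ⟨n + 1, by ring⟩
    rw [show 2 * i - 1 + 1 = 2 * i by ring] at hi2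
    refine ⟨i, ⟨hi1', hi2⟩, ?_⟩
    -- If another disk touched this arc, `genDeriv_add_nonneg` would give `F' + k_l P_l ≥ 0` at `η`,
    -- whereas this sum is at most `k_0 - k_j P_j < 0`.
    obtain ⟨l, hl⟩ := exists_touches h hκ hC i
    have h1 := genDeriv_add_nonneg h hκ hC hl ⟨hi1', hi2⟩
    by_cases hlj : l = j
    · exact hlj ▸ hl
    · linarith [hle₂ l η hlj]
  obtain ⟨n, rfl⟩ := touches_inj h hκ hC ht₀ ti
  have e1 : C (2 * (i₀ + m * n) - 1) = C (2 * i₀ - 1) + n := by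
    rw [← periodic_int hC.periodic]; congr 1; ring
  have e2 : C (2 * (i₀ + m * n)) = C (2 * i₀) + n := by
    rw [← periodic_int hC.periodic]; congr 1; ring
  have hdrop : lift κ μ (C (2 * i₀ - 1)) - lift κ μ (C (2 * i₀)) =
      lift κ μ (C (2 * (i₀ + m * n) - 1)) - lift κ μ (C (2 * (i₀ + m * n))) := by
    rw [e1, e2, lift_add_int, lift_add_int]; ring
  rw [hdrop]
  have z1 := hC.zero (2 * (i₀ + m * n) - 1)
  have z2 := hC.zero (2 * (i₀ + m * n))
  have hdec : AntitoneOn (lift κ μ) (Icc (C (2 * (i₀ + m * n) - 1)) (C (2 * (i₀ + m * n)))) := by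
    rw [lift_eq_genLift]
    exact ((hC.isMultimodalLift hw).decreasing _).antitoneOn
  set y₁ := C (2 * (i₀ + m * n) - 1)
  set y₂ := C (2 * (i₀ + m * n))
  have hg : ∀ x, HasDerivAt (fun x => K * A x - κ 0 * x) (K * poisson (pole μ j) x - κ 0) x := by
    intro x
    have h1 := ((hasDerivAt_poissonInt (hw j) x).const_mul K).sub ((hasDerivAt_id x).const_mul
      (κ 0 : ℝ))
    rw [mul_one] at h1; exact h1
  -- This integrates `F' ≤ k_0 - k_j P_j`, which holds everywhere because the other kernels are
  -- positive.
  have hFA : ∀ x y, x ≤ y → K * (A y - A x) - κ 0 * (y - x) ≤ lift κ μ x - lift κ μ y := by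
    intro x y hxy
    have hder : ∀ x, HasDerivAt (fun x => lift κ μ x + (K * A x - κ 0 * x))
        (genDeriv (order κ) (degree κ) (pole μ) x + (K * poisson (pole μ j) x - κ 0)) x := by
      intro x
      rw [lift_eq_genLift]
      exact (hasDerivAt_genLift hw x).add (hg x)
    have hanti : Antitone fun x => lift κ μ x + (K * A x - κ 0 * x) :=
      antitone_of_deriv_nonpos (fun x => (hder x).differentiableAt) fun x => by
        rw [(hder x).deriv]; linarith [hle x]
    have := hanti hxy
    dsimp only at this
    linarith
  have hside : ∀ x y, x ≤ y → (∀ t ∈ Ioo x y, K * poisson (pole μ j) t ≤ κ 0) →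
      K * (A y - A x) ≤ κ 0 * (y - x) := by
    intro x y hxy hb
    rcases hxy.eq_or_lt with rfl | hxy
    · simp
    obtain ⟨t, ht, hs⟩ := exists_hasDerivAt_eq_slope A (poisson (pole μ j)) hxy
      (fun x _ => (hasDerivAt_poissonInt (hw j) x).continuousAt.continuousWithinAt)
      (fun x _ => hasDerivAt_poissonInt (hw j) x)
    have := hb t ht
    rw [hs, ← mul_div_assoc, div_le_iff₀ (sub_pos.2 hxy)] at this
    exact this
  have hPy : ∀ t s, |s - η| ≤ |t - η| → |t - η| ≤ 1 / 2 →
      genDeriv (order κ) (degree κ) (pole μ) s = 0 → K * poisson (pole μ j) t ≤ κ 0 := by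
    intro t s h1 h2 h3
    have h4 := hle s
    rw [h3, zero_add] at h4
    have h5 := poisson_le_of_le (h j) h1 h2
    nlinarith
  -- At the end of the arc `F' = 0`, hence `k_j P_j ≤ k_0` there and, by monotonicity of the kernel,
  -- further away from `η`. So the part of `[η - a, η + a]` beyond either end of the arc carries at
  -- most `k_0 a`. With the loss `2 k_0 a` from `hFA` this makes up `4 k_0 a`.
  have hright : K * (A (η + a) - A (min y₂ (η + a))) ≤ κ 0 * a := by
    rcases le_total (η + a) y₂ with hle' | hle'
    · rw [min_eq_right hle']; simp; positivity
    · rw [min_eq_left hle']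
      refine (hside _ _ hle' fun t ht => hPy t y₂ ?_ ?_ z2).trans ?_
      · rw [abs_of_pos (by linarith [hηi.2]), abs_of_pos (by linarith [hηi.2, ht.1])]
        linarith [ht.1]
      · rw [abs_of_pos (by linarith [hηi.2, ht.1])]; linarith [ht.2]
      · exact mul_le_mul_of_nonneg_left (by linarith [hηi.2]) hk0.le
  have hleft : K * (A (max y₁ (η - a)) - A (η - a)) ≤ κ 0 * a := by
    rcases le_total y₁ (η - a) with hle' | hle'
    · rw [max_eq_right hle']; simp; positivity
    · rw [max_eq_left hle']
      refine (hside _ _ hle' fun t ht => hPy t y₁ ?_ ?_ z1).trans ?_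
      · rw [abs_of_neg (by linarith [hηi.1]), abs_of_neg (by linarith [hηi.1, ht.2])]
        linarith [ht.2]
      · rw [abs_of_neg (by linarith [hηi.1, ht.2])]; linarith [ht.1]
      · exact mul_le_mul_of_nonneg_left (by linarith [hηi.1]) hk0.le
  have hx1 : y₁ ≤ max y₁ (η - a) := le_max_left _ _
  have hx1' : η - a ≤ max y₁ (η - a) := le_max_right _ _
  have hx1'' : max y₁ (η - a) ≤ η := max_le hηi.1.le (by linarith)
  have hx2 : min y₂ (η + a) ≤ y₂ := min_le_left _ _
  have hx2' : min y₂ (η + a) ≤ η + a := min_le_right _ _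
  have hx2'' : η ≤ min y₂ (η + a) := le_min hηi.2.le (by linarith)
  have hmid := hFA _ _ (hx1''.trans hx2'')
  have hm1 := hdec ⟨le_rfl, hηi.1.le.trans hηi.2.le⟩ ⟨hx1, hx1''.trans hηi.2.le⟩ hx1
  have hm2 := hdec ⟨hηi.1.le.trans hx2'', hx2⟩ ⟨hηi.1.le.trans hηi.2.le, le_rfl⟩ hx2
  have hmass := mul_le_mul_of_nonneg_left (poissonInt_sub_ge (h j) ha ha') (by linarith : 0 ≤ K)
  have hK' : K = κ j.succ := rfl
  rw [← hK']
  have hlen : (κ 0 : ℝ) * (min y₂ (η + a) - max y₁ (η - a)) ≤ κ 0 * (2 * a) :=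
    mul_le_mul_of_nonneg_left (by linarith) hk0.le
  linarith

/-- If the decrease on the arc of `a_j` stays away from `k_j`, then `a_j` stays away from the
circle. -/
lemma exists_modulus_bound (hκ : ∀ i, 0 < κ i) {δ : ℝ} (hδ : 0 < δ) :
    ∃ ε : ℝ, 0 < ε ∧ ∀ (μ : Fin (2 * m) → ℝ) (C : ℤ → ℝ) (i : ℤ) (j : Fin m), (∀ j, 1 < modulus μ j) →
      Alternates m (genDeriv (order κ) (degree κ) (pole μ)) C → Touches κ μ C i j →
      lift κ μ (C (2 * i - 1)) - lift κ μ (C (2 * i)) ≤ κ j.succ - δ → 1 + ε < modulus μ j := by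
  have hk0 : 0 < (κ 0 : ℝ) := by exact_mod_cast hκ 0
  set K : ℝ := ∑ j : Fin m, (κ j.succ : ℝ) with hK
  have hK0 : 0 ≤ K := Finset.sum_nonneg fun j _ => by positivity
  -- First `a` is chosen so that the error `4 k_0 a` of `drop_ge` is at most `δ / 4`, then `ε` so
  -- that for `r ≤ 1 + ε` the loss of mass costs at most `δ / 2`. The drop would then exceed `k_j -
  -- δ`.
  set a : ℝ := min (1 / 4) (δ / (16 * κ 0)) with ha
  have ha0 : 0 < a := lt_min (by norm_num) (by positivity)
  have ha1 : a ≤ 1 / 4 := min_le_left _ _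
  have ha2 : 4 * κ 0 * a ≤ δ / 4 := by
    have : a ≤ δ / (16 * κ 0) := min_le_right _ _
    rw [le_div_iff₀ (by positivity)] at this
    linarith
  have hπ := Real.pi_pos
  set c := 2 * (1 - Real.cos (2 * Real.pi * a)) with hc
  have hcos : 0 < c := by
    have : Real.cos (2 * Real.pi * a) < 1 := by
      refine lt_of_le_of_ne (Real.cos_le_one _) fun h1 => ?_
      have h2 := (Real.cos_eq_one_iff_of_lt_of_lt (by nlinarith) (by nlinarith)).1 h1
      nlinarith
    linarith
  set ε : ℝ := min (min 1 (1 / κ 0)) (c * δ / (8 * (K + 1))) with hε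
  have hε0 : 0 < ε := lt_min (lt_min one_pos (by positivity)) (by positivity)
  refine ⟨ε, hε0, fun μ C i j h hC ht hd => ?_⟩
  by_contra hle
  have hle := not_lt.1 hle
  have hε1 : ε ≤ 1 := (min_le_left _ _).trans (min_le_left _ _)
  have hε2 : ε ≤ 1 / κ 0 := (min_le_left _ _).trans (min_le_right _ _)
  have hε3 : ε ≤ c * δ / (8 * (K + 1)) := min_le_right _ _
  have hj := h j
  have hr : (κ 0 : ℝ) * (modulus μ j - 1) < 2 := by
    rw [le_div_iff₀ hk0] at hε2
    nlinarith
  have hge := drop_ge h hκ hC ht hr ha0 (by linarith)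
  rw [← hc] at hge
  have hkK : (κ j.succ : ℝ) ≤ K :=
    Finset.single_le_sum (f := fun j : Fin m => (κ j.succ : ℝ)) (fun l _ => by positivity)
      (Finset.mem_univ j)
  have h1 : modulus μ j ^ 2 - 1 ≤ 3 * ε := by nlinarith
  have h2 : (κ j.succ : ℝ) * ((modulus μ j ^ 2 - 1) / c) ≤ δ / 2 := by
    have h3 : (modulus μ j ^ 2 - 1) / c ≤ 3 * ε / c := div_le_div_of_nonneg_right h1 hcos.le
    have h4 : (κ j.succ : ℝ) * ((modulus μ j ^ 2 - 1) / c) ≤ K * (3 * ε / c) :=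
      mul_le_mul hkK h3 (div_nonneg (by nlinarith) hcos.le) hK0
    refine h4.trans ?_
    rw [← mul_div_assoc, div_le_iff₀ hcos]
    rw [le_div_iff₀ (by positivity)] at hε3
    nlinarith
  linarith

end estimates


/-! ### Types -/

lemma ncard_Icc_inter_add_int {a b : ℝ} (s : ℝ) :
    (Icc a b ∩ {x : ℝ | ∃ n : ℤ, x = s + n}).ncard = (⌊b - s⌋ + 1 - ⌈a - s⌉).toNat := by
  have h : Icc a b ∩ {x : ℝ | ∃ n : ℤ, x = s + n} =
      (fun n : ℤ => s + (n : ℝ)) '' (Finset.Icc ⌈a - s⌉ ⌊b - s⌋ : Set ℤ) := by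
    ext x
    simp only [mem_inter_iff, mem_Icc, mem_ofPred_eq, mem_image, Finset.coe_Icc, Int.ceil_le,
      Int.le_floor]
    constructor
    · rintro ⟨⟨h1, h2⟩, n, rfl⟩
      exact ⟨n, ⟨by linarith, by linarith⟩, rfl⟩
    · rintro ⟨n, ⟨h1, h2⟩, rfl⟩
      exact ⟨⟨by linarith, by linarith⟩, n, rfl⟩
  rw [h, ncard_image_of_injective _ (fun m n hmn => by simpa using hmn), ncard_coe_finset,
    Int.card_Icc]

/-- A closed interval of length `ℓ` meets each translate of `ℤ` in at least `⌊ℓ⌋` points, and some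
translate attains this. A type thus records the integral parts of the differences of the critical
values. -/
lemma sInf_ncard_inter_add_int (a b : ℝ) :
    sInf (range fun s : ℝ => (uIcc a b ∩ {x : ℝ | ∃ n : ℤ, x = s + n}).ncard) =
      ⌊|b - a|⌋.toNat := by
  wlog hab : a ≤ b generalizing a b
  · rw [uIcc_comm, abs_sub_comm]
    exact this b a (le_of_not_ge hab)
  rw [uIcc_of_le hab, abs_of_nonneg (sub_nonneg.2 hab)]
  simp_rw [ncard_Icc_inter_add_int]
  -- Lengthening the interval equally at both ends to the length `⌊ℓ⌋ + 1` puts both new ends on the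
  -- translate, so exactly `⌊ℓ⌋` of its points remain inside.
  refine IsLeast.csInf_eq ⟨⟨b + (1 - Int.fract (b - a)) / 2, ?_⟩, ?_⟩
  · have h1 := Int.fract_lt_one (b - a)
    have h2 := Int.fract_nonneg (b - a)
    have h3 := Int.self_sub_fract (b - a)
    have e1 : ⌊b - (b + (1 - Int.fract (b - a)) / 2)⌋ = -1 := by
      rw [Int.floor_eq_iff]; push_cast; constructor <;> linarith
    have e2 : ⌈a - (b + (1 - Int.fract (b - a)) / 2)⌉ = -⌊b - a⌋ := by
      rw [Int.ceil_eq_iff]; push_cast; constructor <;> linarith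
    dsimp only
    rw [e1, e2]; congr 1; ring
  · rintro _ ⟨s, rfl⟩
    refine Int.toNat_le_toNat ?_
    have h1 := Int.ceil_lt_add_one (a - s)
    have h2 := Int.lt_floor_add_one (b - s)
    have h3 := Int.floor_le (b - a)
    have : ((⌊b - a⌋ : ℤ) : ℝ) < ((⌊b - s⌋ + 1 - ⌈a - s⌉ + 1 : ℤ) : ℝ) := by push_cast; linarith
    have := Int.cast_lt.1 this
    omega

section type
variable {m : ℕ} {κ : Fin (m + 1) → ℕ} {τ : Fin (2 * m - 1) → ℤ}

/-- The vectors in `V` whose differences have the integral parts prescribed by `τ`. -/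
def typeSet (κ : Fin (m + 1) → ℕ) (τ : Fin (2 * m - 1) → ℤ) : Set (Fin (2 * m) → ℝ) :=
  V κ ∩ {v | ∀ i : Fin (2 * m - 1),
    ⌊(-1) ^ ((i : ℕ) + 1) * (v ⟨i + 1, by omega⟩ - v ⟨i, by omega⟩)⌋ = (-1) ^ ((i : ℕ) + 1) * τ i}

lemma floor_eq_of_convex {x y : ℝ} {n : ℤ} {a b : ℝ} (hx : ⌊x⌋ = n) (hy : ⌊y⌋ = n) (ha : 0 ≤ a)
    (hb : 0 ≤ b) (hab : a + b = 1) : ⌊a * x + b * y⌋ = n := by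
  rw [Int.floor_eq_iff] at *
  have e : b = 1 - a := by linarith
  subst e
  have h := convex_Ico (n : ℝ) (n + 1) hx hy ha hb hab
  simpa using h

lemma convex_V : Convex ℝ (V κ) := by
  rintro v ⟨h1, h2, h3⟩ v' ⟨h1', h2', h3'⟩ a b ha hb hab
  have key : ∀ x y : ℝ, 0 < x → 0 < y → 0 < a * x + b * y := fun x y hx hy => by
    simpa using convex_Ioi (0 : ℝ) (mem_Ioi.2 hx) (mem_Ioi.2 hy) ha hb hab
  refine ⟨fun i i' hi => ?_, fun j => ⟨?_, ?_⟩, fun i i' hi hi' => ?_⟩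
  · have := key _ _ (h1 i i' hi) (h1' i i' hi)
    simp only [Pi.add_apply, Pi.smul_apply, smul_eq_mul]
    linarith
  · have := key _ _ (h2 j).1 (h2' j).1
    simp only [Pi.add_apply, Pi.smul_apply, smul_eq_mul]
    linarith
  · have := key _ _ (sub_pos.2 (h2 j).2) (sub_pos.2 (h2' j).2)
    simp only [Pi.add_apply, Pi.smul_apply, smul_eq_mul]
    have e : b = 1 - a := by linarith
    subst e
    linarith
  · have := key _ _ (sub_pos.2 (h3 i i' hi hi')) (sub_pos.2 (h3' i i' hi hi'))
    simp only [Pi.add_apply, Pi.smul_apply, smul_eq_mul]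
    have e : b = 1 - a := by linarith
    subst e
    linarith

lemma isOpen_V : IsOpen (V κ) := by
  have : V κ = (⋂ (i : Fin (2 * m)) (i' : Fin (2 * m)), {v : Fin (2 * m) → ℝ | (i' : ℕ) = i + 1 →
      0 < (-1) ^ ((i : ℕ) + 1) * (v i' - v i)}) ∩
    ((⋂ j : Fin m, {v : Fin (2 * m) → ℝ | 0 < v ⟨2 * j, by omega⟩ - v ⟨2 * j + 1, by omega⟩} ∩
      {v | v ⟨2 * j, by omega⟩ - v ⟨2 * j + 1, by omega⟩ < (κ j.succ : ℝ)}) ∩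
    ⋂ (i : Fin (2 * m)) (i' : Fin (2 * m)), {v | (i : ℕ) = 0 → (i' : ℕ) + 1 = 2 * m →
      v i' < v i + (degree κ : ℝ)}) := by
    ext v; simp [V]
  rw [this]
  have himp : ∀ (p : Prop) (U : Set (Fin (2 * m) → ℝ)), IsOpen U → IsOpen {v | p → v ∈ U} :=
    fun p U hU => by by_cases hp : p <;> simp [hp, hU]
  refine IsOpen.inter (isOpen_iInter_of_finite fun i => isOpen_iInter_of_finite fun i' =>
    himp _ {v | 0 < (-1) ^ ((i : ℕ) + 1) * (v i' - v i)} (isOpen_lt (by fun_prop) (by fun_prop)))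
      (IsOpen.inter ?_ ?_)
  · exact isOpen_iInter_of_finite fun j => (isOpen_lt (by fun_prop) (by fun_prop)).inter
      (isOpen_lt (by fun_prop) (by fun_prop))
  · exact isOpen_iInter_of_finite fun i => isOpen_iInter_of_finite fun i' =>
      himp _ {v | _ → _} (himp _ {v : Fin (2 * m) → ℝ | v i' < v i + (degree κ : ℝ)} (isOpen_lt (by fun_prop) (by fun_prop)))

lemma add_const_mem_V {v : Fin (2 * m) → ℝ} (hv : v ∈ V κ) (c : ℝ) : (fun i => v i + c) ∈ V κ := by
  obtain ⟨h1, h2, h3⟩ := hv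
  refine ⟨fun i i' hi => ?_, fun j => ?_, fun i i' hi hi' => ?_⟩
  · simpa using h1 i i' hi
  · simpa using h2 j
  · have := h3 i i' hi hi'
    dsimp only; linarith

/-- Prescribing the integral part of a linear function confines it to a half-open interval, a convex
condition. -/
lemma convex_typeSet : Convex ℝ (typeSet κ τ) := by
  refine convex_V.inter fun v hv v' hv' a b ha hb hab i => ?_
  rw [← floor_eq_of_convex (hv i) (hv' i) ha hb hab]
  congr 1
  simp only [Pi.add_apply, Pi.smul_apply, smul_eq_mul]
  ring

lemma add_const_mem_typeSet {v : Fin (2 * m) → ℝ} (hv : v ∈ typeSet κ τ) (c : ℝ) :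
    (fun i => v i + c) ∈ typeSet κ τ :=
  ⟨add_const_mem_V hv.1 c, fun i => by rw [← hv.2 i]; simp⟩

/-- The values at the points `C 1, …, C (2m)`. -/
def turningValues (m : ℕ) (G : ℝ → ℝ) (C : ℤ → ℝ) (i : Fin (2 * m)) : ℝ := G (C ((i : ℤ) + 1))

lemma IsMultimodalLift.pos {d : ℤ} {G : ℝ → ℝ} {C : ℤ → ℝ} (h : IsMultimodalLift m d G C) (i : ℕ) :
    0 < (-1) ^ (i + 1) * (G (C ((i : ℤ) + 2)) - G (C ((i : ℤ) + 1))) := by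
  rcases Nat.even_or_odd' i with ⟨n, rfl | rfl⟩
  · have h1 : C (2 * n + 1) < C (2 * n + 2) := h.strictMono (by omega)
    have := h.decreasing (n + 1)
    rw [show 2 * ((n : ℤ) + 1) - 1 = 2 * n + 1 by ring, show 2 * ((n : ℤ) + 1) = 2 * n + 2 by ring]
      at this
    have := this ⟨le_rfl, h1.le⟩ ⟨h1.le, le_rfl⟩ h1
    rw [pow_succ, pow_mul, neg_one_sq, one_pow]
    push_cast
    linarith
  · have h1 : C (2 * n + 2) < C (2 * n + 3) := h.strictMono (by omega)
    have := h.increasing (n + 1)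
    rw [show 2 * ((n : ℤ) + 1) + 1 = 2 * n + 3 by ring, show 2 * ((n : ℤ) + 1) = 2 * n + 2 by ring]
      at this
    have := this ⟨le_rfl, h1.le⟩ ⟨h1.le, le_rfl⟩ h1
    rw [show 2 * n + 1 + 1 = 2 * (n + 1) by ring, pow_mul, neg_one_sq, one_pow]
    push_cast
    rw [show 2 * (n : ℤ) + 1 + 2 = 2 * n + 3 by ring, show 2 * (n : ℤ) + 1 + 1 = 2 * n + 2 by ring]
    linarith

lemma IsMultimodalLift.hasType_iff {d : ℤ} {G : ℝ → ℝ} {C : ℤ → ℝ} (h : IsMultimodalLift m d G C) :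
    HasType m G C τ ↔ ∀ i : Fin (2 * m - 1),
      ⌊(-1) ^ ((i : ℕ) + 1) * (turningValues m G C ⟨i + 1, by omega⟩ -
        turningValues m G C ⟨i, by omega⟩)⌋ = (-1) ^ ((i : ℕ) + 1) * τ i := by
  refine forall_congr' fun i => ?_
  have hp := h.pos i
  have e1 : turningValues m G C ⟨i + 1, by omega⟩ = G (C ((i : ℤ) + 2)) := by
    unfold turningValues; push_cast; congr 2
  have e2 : turningValues m G C ⟨i, by omega⟩ = G (C ((i : ℤ) + 1)) := rfl
  rw [sInf_ncard_inter_add_int, e1, e2]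
  have habs : |G (C ((i : ℤ) + 2)) - G (C ((i : ℤ) + 1))| =
      (-1) ^ ((i : ℕ) + 1) * (G (C ((i : ℤ) + 2)) - G (C ((i : ℤ) + 1))) := by
    rw [← abs_of_pos hp, abs_mul, abs_neg_one_pow, one_mul]
  rw [habs, Int.toNat_of_nonneg (Int.floor_nonneg.2 hp.le)]
  have hs : ((-1 : ℤ) ^ ((i : ℕ) + 1)) * (-1) ^ ((i : ℕ) + 1) = 1 := by
    rw [← mul_pow]; norm_num
  constructor
  · intro h; rw [h, ← mul_assoc, hs, one_mul]
  · intro h; rw [h, ← mul_assoc, hs, one_mul]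

lemma IsMultimodalLift.turningValues_mem_V {G : ℝ → ℝ} {C : ℤ → ℝ}
    (h : IsMultimodalLift m (BlaschkeMultimodal.degree κ) G C)
    (hd : ∀ j : Fin m, G (C (2 * ((j : ℤ) + 1) - 1)) - G (C (2 * ((j : ℤ) + 1))) < κ j.succ) :
    turningValues m G C ∈ V κ := by
  refine ⟨fun i i' hi => ?_, fun j => ⟨?_, ?_⟩, fun i i' hi hi' => ?_⟩
  · have := h.pos i
    have e : ((i' : ℕ) : ℤ) + 1 = (i : ℤ) + 2 := by omega
    unfold turningValues
    rwa [e]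
  · have := h.pos (2 * j)
    rw [pow_succ, pow_mul, neg_one_sq, one_pow] at this
    unfold turningValues
    push_cast at this ⊢
    rw [show 2 * ((j : ℕ) : ℤ) + 1 + 1 = 2 * j + 2 by ring]
    linarith
  · have := hd j
    unfold turningValues
    push_cast
    rw [show 2 * ((j : ℕ) : ℤ) + 1 + 1 = 2 * (j + 1) by ring]
    rwa [show 2 * ((j : ℕ) : ℤ) + 1 = 2 * (j + 1) - 1 by ring]
  · have := h.pos i'
    rw [hi', pow_mul] at this
    unfold turningValues
    rw [show ((i' : ℕ) : ℤ) + 2 = 1 + 2 * m by omega, h.periodic, h.degree] at this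
    rw [hi]
    push_cast
    rw [neg_one_sq, one_pow] at this
    linarith

lemma IsMultimodalLift.drop_lt_of_hasType {d : ℤ} {G : ℝ → ℝ} {C : ℤ → ℝ}
    (h : IsMultimodalLift m d G C) (hτ : HasType m G C τ) (j : Fin m)
    (i : Fin (2 * m - 1)) (hi : (i : ℕ) = 2 * j) :
    G (C (2 * ((j : ℤ) + 1) - 1)) - G (C (2 * ((j : ℤ) + 1))) < -τ i + 1 := by
  have h1 := h.hasType_iff.1 hτ i
  have s1 : (-1 : ℝ) ^ (2 * (j : ℕ) + 1) = -1 := by rw [pow_succ, pow_mul]; norm_num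
  have s2 : (-1 : ℤ) ^ (2 * (j : ℕ) + 1) = -1 := by rw [pow_succ, pow_mul]; norm_num
  simp only [hi, s1, s2] at h1
  have h3 := Int.lt_floor_add_one (-1 *
    (turningValues m G C ⟨2 * j + 1, by omega⟩ - turningValues m G C ⟨2 * j, by omega⟩))
  rw [h1] at h3
  unfold turningValues at h3
  push_cast at h3
  rw [show 2 * ((j : ℕ) : ℤ) + 1 + 1 = 2 * (j + 1) by ring,
    show 2 * ((j : ℕ) : ℤ) + 1 = 2 * (j + 1) - 1 by ring] at h3
  linarith

/-- The critical values of `G` itself belong to the set: its drops are below `-τ_i + 1`, and `κ`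
being above `τ` makes this at most `k_j - 1`. -/
lemma typeSet_nonempty {d : ℤ} {G : ℝ → ℝ} {c : ℤ → ℝ} (hG : IsMultimodalLift m d G c)
    (hτ : HasType m G c τ) (habove : ∀ (j : Fin m) (i : Fin (2 * m - 1)), (i : ℕ) = 2 * j → -τ i + 2 ≤ (κ j.succ : ℤ))
    (hdeg : (κ 0 : ℤ) = d + ∑ j : Fin m, (κ j.succ : ℤ)) : (typeSet κ τ).Nonempty := by
  have hd : d = degree κ := by unfold degree; linarith
  subst hd
  refine ⟨turningValues m G c, hG.turningValues_mem_V fun j => ?_, hG.hasType_iff.1 hτ⟩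
  obtain ⟨i, hi⟩ : ∃ i : Fin (2 * m - 1), (i : ℕ) = 2 * j := ⟨⟨_, by omega⟩, rfl⟩
  have := hG.drop_lt_of_hasType hτ j i hi
  have h4 : ((-τ i + 2 : ℤ) : ℝ) ≤ ((κ j.succ : ℤ) : ℝ) := Int.cast_le.2 (habove j i hi)
  push_cast at h4
  linarith

/-! ### Labellings and types -/

variable {μ : Fin (2 * m) → ℝ} {C C' : ℤ → ℝ}

lemma IsLabelling.alternates (h : IsLabelling κ μ C) :
    Alternates m (genDeriv (order κ) (degree κ) (pole μ)) C := by
  have := h.multimodal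
  rw [lift_eq_genLift] at this
  exact this.alternates fun j => norm_pole_lt (h.one_lt_modulus j)

lemma IsLabelling.touches (h : IsLabelling κ μ C) (j : Fin m) :
    Touches κ μ C ((j : ℤ) + 1) j := by
  have := isLabelling_iff.1 h
  exact this.2.2 j

lemma IsLabelling.turningValues_mem_V (hκ : ∀ i, 0 < κ i) (h : IsLabelling κ μ C) :
    turningValues m (lift κ μ) C ∈ V κ :=
  h.multimodal.turningValues_mem_V fun j => drop_lt h.one_lt_modulus hκ h.alternates (h.touches j)

/-- Labellings are unique up to integral translations. -/
lemma IsLabelling.eq_add_int (hκ : ∀ i, 0 < κ i) (h : IsLabelling κ μ C) (h' : IsLabelling κ μ C') :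
    ∃ n : ℤ, ∀ i, C' i = C i + n := by
  have hw := fun j => norm_pole_lt (h.one_lt_modulus j)
  obtain ⟨l, hl⟩ := h.alternates.exists_shift h'.alternates hw
  have hm := h.alternates.m_pos
  have t1 := h.touches ⟨0, hm⟩
  have t2 : Touches κ μ C (1 + l) ⟨0, hm⟩ := by
    obtain ⟨x, hx, hc⟩ := h'.touches ⟨0, hm⟩
    refine ⟨x, ?_, hc⟩
    rw [hl, hl] at hx
    convert hx using 2 <;> congr 1 <;> push_cast <;> ring
  -- Two labellings differ by an even shift of the index. Both place the disk of `a_1` at the first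
  -- arc, so the shift is a multiple of `2m`, that is, an integral translation.
  obtain ⟨n, hn⟩ := touches_inj h.one_lt_modulus hκ h.alternates t1 t2
  refine ⟨n, fun i => ?_⟩
  rw [hl, ← periodic_int h.alternates.periodic]
  congr 1
  push_cast at hn
  have : l = m * n := by linarith
  rw [this]; ring

lemma IsLabelling.turningValues_eq (hκ : ∀ i, 0 < κ i) (h : IsLabelling κ μ C)
    (h' : IsLabelling κ μ C') : ∃ c : ℝ,
      turningValues m (lift κ μ) C' = fun i => turningValues m (lift κ μ) C i + c := by
  obtain ⟨n, hn⟩ := h.eq_add_int hκ h'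
  refine ⟨degree κ * n, funext fun i => ?_⟩
  unfold turningValues
  rw [hn, lift_add_int]

lemma IsLabelling.mem_DeltaTau_iff (hκ : ∀ i, 0 < κ i) (h : IsLabelling κ μ C) :
    μ ∈ DeltaTau κ τ ↔ turningValues m (lift κ μ) C ∈ typeSet κ τ := by
  constructor
  · rintro ⟨C', h', ht⟩
    obtain ⟨c, hc⟩ := h'.turningValues_eq hκ h
    rw [hc]
    exact add_const_mem_typeSet ⟨h'.turningValues_mem_V hκ, h'.multimodal.hasType_iff.1 ht⟩ c
  · intro ht
    exact ⟨C, h, h.multimodal.hasType_iff.2 ht.2⟩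

/-! ### Uniform bounds -/

/-- The type bounds the drops by `k_j - 1`, so `exists_modulus_bound` applies with the gap `1`. -/
lemma exists_modulus_bound_DeltaTau (hκ : ∀ i, 0 < κ i)
    (habove : ∀ (j : Fin m) (i : Fin (2 * m - 1)), (i : ℕ) = 2 * j → -τ i + 2 ≤ (κ j.succ : ℤ)) :
    ∃ δ : ℝ, 0 < δ ∧ ∀ μ ∈ DeltaTau κ τ, ∀ j : Fin m, 1 + δ < modulus μ j := by
  obtain ⟨ε, hε, hb⟩ := exists_modulus_bound (m := m) hκ one_pos
  refine ⟨ε, hε, fun μ ⟨C, hC, ht⟩ j => ?_⟩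
  refine hb μ C (j + 1) j hC.one_lt_modulus hC.alternates (hC.touches j) ?_
  obtain ⟨i, hi⟩ : ∃ i : Fin (2 * m - 1), (i : ℕ) = 2 * j := ⟨⟨_, by omega⟩, rfl⟩
  have := hC.multimodal.drop_lt_of_hasType ht j i hi
  have h4 : ((-τ i + 2 : ℤ) : ℝ) ≤ ((κ j.succ : ℤ) : ℝ) := Int.cast_le.2 (habove j i hi)
  push_cast at h4
  linarith

lemma deriv_lift (h : ∀ j, 1 < modulus μ j) :
    deriv (lift κ μ) = genDeriv (order κ) (degree κ) (pole μ) := by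
  funext t
  rw [lift_eq_genLift]
  exact (hasDerivAt_genLift (fun j => norm_pole_lt (h j)) t).deriv

lemma numSq_one_ge {r η x : ℝ} (hr : 1 < r) : (r - 1) ^ 2 ≤ numSq r η 1 x := by
  unfold numSq
  nlinarith [Real.cos_le_one (2 * Real.pi * (x - η))]

/-- For `r > 1 + δ` the kernel is at most `(r + 1) / (r - 1) ≤ 1 + 2 / δ`, even as `r` tends to
infinity, and the terms of the second derivative are bounded by products of such quotients. -/
lemma exists_deriv_bound (κ : Fin (m + 1) → ℕ) {δ : ℝ} (hδ : 0 < δ) :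
    ∃ M : ℝ, 0 < M ∧ ∀ μ : Fin (2 * m) → ℝ, (∀ j, 1 + δ < modulus μ j) → ∀ t : ℝ,
      |deriv (lift κ μ) t| < M ∧ |deriv (deriv (lift κ μ)) t| < M := by
  set K : ℝ := ∑ j : Fin m, (κ j.succ : ℝ) with hK
  have hK0 : 0 ≤ K := Finset.sum_nonneg fun j _ => by positivity
  set a := 1 + 2 / δ
  set b := 4 * Real.pi * (a * a * (1 / δ))
  have hπ := Real.pi_pos
  refine ⟨κ 0 + K * a + K * b + 1, by positivity, fun μ h t => ?_⟩
  have h1 : ∀ j, 1 < modulus μ j := fun j => by linarith [h j]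
  rw [deriv_lift h1]
  have hr : ∀ j, (modulus μ j + 1) / (modulus μ j - 1) ≤ a := fun j => by
    have := h j
    rw [div_le_iff₀ (by linarith)]
    have : a * (modulus μ j - 1) = (modulus μ j - 1) + 2 * ((modulus μ j - 1) / δ) := by
      simp only [a]; field_simp
    have h3 : 1 ≤ (modulus μ j - 1) / δ := by rw [le_div_iff₀ hδ]; linarith
    linarith
  have hP : ∀ j, poisson (pole μ j) t ≤ a := fun j => by
    rw [poisson_pole (h1 j)]
    have := h1 j
    refine le_trans ?_ (hr j)
    refine (div_le_div_of_nonneg_left (by nlinarith) (by nlinarith) (numSq_one_ge this)).trans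
      (le_of_eq ?_)
    have : modulus μ j - 1 ≠ 0 := by linarith
    field_simp
    ring
  constructor
  · rw [genDeriv_eq_sub h1]
    have h3 : 0 ≤ ∑ j, order κ j * poisson (pole μ j) t := Finset.sum_nonneg fun j _ =>
      mul_nonneg (by unfold order; positivity) (poisson_pos (norm_pole_lt (h1 j)) t).le
    have h4 : ∑ j, order κ j * poisson (pole μ j) t ≤ K * a := by
      rw [hK, Finset.sum_mul]
      exact Finset.sum_le_sum fun j _ => mul_le_mul_of_nonneg_left (hP j) (by unfold order; positivity)
    have h5 : (0 : ℝ) ≤ κ 0 := by positivity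
    have h6 : 0 ≤ K * b := by positivity
    rw [abs_lt]
    constructor <;> linarith
  · have e1 : deriv (genDeriv (order κ) (degree κ) (pole μ)) t = 2 * angular κ μ 1 t := by
      rw [angular_one h1]; ring
    rw [e1]
    unfold angular
    rw [Finset.mul_sum]
    have h6 : 0 ≤ K * a := by positivity
    have h5 : (0 : ℝ) ≤ κ 0 := by positivity
    suffices H : ∀ j : Fin m, |2 * ((κ j.succ : ℝ) * (2 * Real.pi * 1 * modulus μ j *
        (modulus μ j ^ 2 - 1) * Real.sin (2 * Real.pi * (t - angle μ j)) /
        (numSq (modulus μ j) (angle μ j) 1 t * denSq (modulus μ j) (angle μ j) 1 t)))| ≤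
        κ j.succ * b by
      refine lt_of_le_of_lt (Finset.abs_sum_le_sum_abs _ _) ?_
      refine lt_of_le_of_lt (Finset.sum_le_sum fun j _ => H j) ?_
      rw [← Finset.sum_mul, ← hK]
      linarith
    intro j
    have hj := h j
    set r := modulus μ j
    have hN := numSq_one_ge (η := angle μ j) (x := t) (h1 j)
    have hD : denSq r (angle μ j) 1 t = numSq r (angle μ j) 1 t := by unfold numSq denSq; ring
    set N := numSq r (angle μ j) 1 t
    have hr1 : 0 < r - 1 := by linarith
    have hN0 : 0 < N := lt_of_lt_of_le (by positivity) hN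
    have hra : (r + 1) / (r - 1) ≤ a := hr j
    have hrb : r / (r - 1) ≤ a := le_trans (div_le_div_of_nonneg_right (by linarith) hr1.le) hra
    have hrc : 1 / (r - 1) ≤ 1 / δ := one_div_le_one_div_of_le hδ (by linarith)
    rw [hD, abs_mul, abs_mul, abs_div, abs_mul, abs_of_pos (by positivity : (0 : ℝ) < 2),
      abs_of_nonneg (by positivity : (0 : ℝ) ≤ κ j.succ), abs_of_pos (mul_pos hN0 hN0),
      abs_of_pos (by nlinarith [mul_pos hπ (by linarith : 0 < r)] :
        0 < 2 * Real.pi * 1 * r * (r ^ 2 - 1))]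
    have h7 : 2 * Real.pi * 1 * r * (r ^ 2 - 1) * |Real.sin (2 * Real.pi * (t - angle μ j))| /
        (N * N) ≤ 2 * Real.pi * r * (r ^ 2 - 1) / ((r - 1) ^ 2 * (r - 1) ^ 2) := by
      have h8 : 0 ≤ 2 * Real.pi * r * (r ^ 2 - 1) := by
        have : 0 < r ^ 2 - 1 := by nlinarith
        have : 0 < r := by linarith
        positivity
      refine div_le_div₀ h8 ?_ (by positivity) (mul_le_mul hN hN (by positivity) hN0.le)
      rw [mul_one]
      exact mul_le_of_le_one_right h8 (Real.abs_sin_le_one _)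
    have h9 : 2 * Real.pi * r * (r ^ 2 - 1) / ((r - 1) ^ 2 * (r - 1) ^ 2) =
        2 * Real.pi * (r / (r - 1) * ((r + 1) / (r - 1)) * (1 / (r - 1))) := by
      field_simp; ring
    have h10 : r / (r - 1) * ((r + 1) / (r - 1)) * (1 / (r - 1)) ≤ a * a * (1 / δ) := by
      have : 0 < r := by linarith
      have : 0 < r + 1 := by linarith
      gcongr
    have h11 : 2 * Real.pi * (r / (r - 1) * ((r + 1) / (r - 1)) * (1 / (r - 1))) ≤
        2 * Real.pi * (a * a * (1 / δ)) := mul_le_mul_of_nonneg_left h10 (by positivity)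
    have h12 := mul_le_mul_of_nonneg_left ((h7.trans h9.le).trans h11)
      (by positivity : (0 : ℝ) ≤ κ j.succ)
    have h13 : (κ j.succ : ℝ) * b = 2 * (κ j.succ * (2 * Real.pi * (a * a * (1 / δ)))) := by
      simp only [b]; ring
    rw [h13]
    linarith

end type


/-! ### Persistence of the turning points -/

/-- The implicit function theorem for a real unknown. -/
lemma exists_zero_curve {E : Type*} [NormedAddCommGroup E] [NormedSpace ℝ E] [CompleteSpace E]
    {f : E × ℝ → ℝ} {u : E} {t : ℝ} {n : ℕ∞ω} (hf : ContDiffAt ℝ n f (u, t)) (hn : n ≠ 0)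
    (h0 : f (u, t) = 0) (hd : deriv (fun s => f (u, s)) t ≠ 0) :
    ∃ c : E → ℝ, ContDiffAt ℝ n c u ∧ c u = t ∧ ∀ᶠ v in 𝓝 (u, t), f v = 0 ↔ c v.1 = v.2 := by
  set a := deriv (fun s => f (u, s)) t
  have hfd := (hf.differentiableAt hn).hasFDerivAt
  have h1 : HasDerivAt (fun s => f (u, s)) (fderiv ℝ f (u, t) (0, 1)) t :=
    hfd.comp_hasDerivAt t ((hasDerivAt_const t u).prodMk (hasDerivAt_id t))
  have hinv : (fderiv ℝ f (u, t) ∘L .inr ℝ E ℝ).IsInvertible := by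
    refine ⟨ContinuousLinearEquiv.unitsEquivAut ℝ (Units.mk0 a hd), ?_⟩
    ext
    simp [a, h1.deriv]
  refine ⟨hf.implicitFunction hn hinv, hf.contDiffAt_implicitFunction hn hinv,
    hf.implicitFunction_apply_self hn hinv, ?_⟩
  simpa [h0] using hf.eventually_apply_eq_iff_implicitFunction hn hinv

/-- Periodicity reduces the conditions to finitely many indices, so that they can hold
simultaneously near a parameter. -/
lemma alternates_of_periodic {m : ℕ} {g : ℝ → ℝ} {C : ℤ → ℝ} (a : ℤ) (hm : 0 < m)
    (hp : ∀ i, C (i + 2 * m) = C i + 1) (hg : ∀ t (n : ℤ), g (t + n) = g t)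
    (hz : ∀ i ∈ Finset.Ico (0 : ℤ) (2 * m), g (C i) = 0)
    (hneg : ∀ j ∈ Finset.Ico a (a + m), ∃ x ∈ Ioo (C (2 * j - 1)) (C (2 * j)), g x < 0)
    (hpos : ∀ j ∈ Finset.Ico a (a + m), ∃ x ∈ Ioo (C (2 * j)) (C (2 * j + 1)), 0 < g x) :
    Alternates m g C := by
  have hm' : (0 : ℤ) < m := by exact_mod_cast hm
  have hj : ∀ j : ℤ, ∃ r ∈ Finset.Ico a (a + m), ∃ n : ℤ, j = r + m * n := fun j => by
    have h1 := Int.emod_nonneg (j - a) hm'.ne'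
    have h2 := Int.emod_lt_of_pos (j - a) hm'
    have h3 := Int.emod_add_mul_ediv (j - a) m
    exact ⟨a + (j - a) % m, Finset.mem_Ico.2 ⟨by omega, by omega⟩, (j - a) / m, by omega⟩
  have neg : ∀ j : ℤ, ∃ x ∈ Ioo (C (2 * j - 1)) (C (2 * j)), g x < 0 := by
    intro j
    obtain ⟨r, hr, n, rfl⟩ := hj j
    obtain ⟨x, hx, hgx⟩ := hneg r hr
    refine ⟨x + n, ?_, by rwa [hg]⟩
    rw [show 2 * (r + m * n) - 1 = 2 * r - 1 + 2 * m * n by ring,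
      show 2 * (r + m * n) = 2 * r + 2 * m * n by ring, periodic_int hp, periodic_int hp]
    exact ⟨by linarith [hx.1], by linarith [hx.2]⟩
  have pos : ∀ j : ℤ, ∃ x ∈ Ioo (C (2 * j)) (C (2 * j + 1)), 0 < g x := by
    intro j
    obtain ⟨r, hr, n, rfl⟩ := hj j
    obtain ⟨x, hx, hgx⟩ := hpos r hr
    refine ⟨x + n, ?_, by rwa [hg]⟩
    rw [show 2 * (r + m * n) + 1 = 2 * r + 1 + 2 * m * n by ring,
      show 2 * (r + m * n) = 2 * r + 2 * m * n by ring, periodic_int hp, periodic_int hp]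
    exact ⟨by linarith [hx.1], by linarith [hx.2]⟩
  refine ⟨strictMono_int_of_lt_succ fun i => ?_, hp, fun i => ?_, neg, pos⟩
  · rcases Int.even_or_odd' i with ⟨j, rfl | rfl⟩
    · obtain ⟨x, hx, -⟩ := pos j
      exact hx.1.trans hx.2
    · obtain ⟨x, hx, -⟩ := neg (j + 1)
      rw [show 2 * (j + 1) - 1 = 2 * j + 1 by ring, show 2 * (j + 1) = 2 * j + 1 + 1 by ring] at hx
      exact hx.1.trans hx.2
  · have h2 : (0 : ℤ) < 2 * m := by omega
    have h3 := Int.emod_add_mul_ediv i (2 * m)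
    rw [← h3, periodic_int hp, hg]
    exact hz _ (Finset.mem_Ico.2 ⟨Int.emod_nonneg _ h2.ne', Int.emod_lt_of_pos _ h2⟩)

section persistence
variable {m : ℕ} {κ : Fin (m + 1) → ℕ} {μ₀ : Fin (2 * m) → ℝ} {C₀ : ℤ → ℝ}

/-- The derivative of the lift as a function of the parameters and of the point. -/
noncomputable def slope (κ : Fin (m + 1) → ℕ) (p : (Fin (2 * m) → ℝ) × ℝ) : ℝ :=
  genDeriv (order κ) (degree κ) (pole p.1) p.2

lemma contDiffAt_pole {n : ℕ∞ω} (h : ∀ j, 1 < modulus μ₀ j) :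
    ContDiffAt ℝ n (fun μ : Fin (2 * m) → ℝ => pole μ) μ₀ := by
  refine contDiffAt_pi.2 fun j => ?_
  unfold pole
  refine ContDiffAt.mul ?_ (contDiff_e.contDiffAt.comp μ₀ (contDiff_angle j).contDiffAt)
  exact Complex.ofRealCLM.contDiff.contDiffAt.comp μ₀
    ((contDiff_modulus j).contDiffAt.inv (by linarith [h j]))

lemma contDiff_shift {n : ℕ∞ω} : ContDiff ℝ n (fun μ : Fin (2 * m) → ℝ => shift κ μ) := by
  unfold shift
  refine (contDiff_coord 0).add (ContDiff.sum fun j _ => ?_)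
  have := contDiff_angle (n := n) j
  fun_prop

lemma contDiffAt_slope {n : ℕ∞ω} (h : ∀ j, 1 < modulus μ₀ j) (t : ℝ) :
    ContDiffAt ℝ n (slope κ) (μ₀, t) := by
  have h1 : ContDiffAt ℝ n (fun p : (Fin (2 * m) → ℝ) × ℝ => (pole p.1, p.2)) (μ₀, t) :=
    ((contDiffAt_pole h).comp (μ₀, t) contDiffAt_fst).prodMk contDiffAt_snd
  have h2 : ContDiffAt ℝ n
      (fun p : (Fin m → ℂ) × ℝ => genDeriv (order κ) (degree κ) p.1 p.2) (pole μ₀, t) :=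
    contDiffAt_genDeriv fun j => norm_pole_lt (h j)
  exact (ContDiffAt.comp (μ₀, t) h2 h1).congr_of_eventuallyEq (Eventually.of_forall fun _ => rfl)

lemma contDiffAt_lift {n : ℕ∞ω} (h : ∀ j, 1 < modulus μ₀ j) (t : ℝ) :
    ContDiffAt ℝ n (fun p : (Fin (2 * m) → ℝ) × ℝ => lift κ p.1 p.2) (μ₀, t) := by
  have h1 : ContDiffAt ℝ n (fun p : (Fin (2 * m) → ℝ) × ℝ => (shift κ p.1, pole p.1, p.2))
      (μ₀, t) := (contDiff_shift.contDiffAt.comp (μ₀, t) contDiffAt_fst).prodMk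
    (((contDiffAt_pole h).comp (μ₀, t) contDiffAt_fst).prodMk contDiffAt_snd)
  refine ((contDiffAt_genLift (D := degree κ) (k := order κ) (p := (shift κ μ₀, pole μ₀, t))
    fun j => norm_pole_lt (h j)).comp (μ₀, t) h1).congr_of_eventuallyEq
    (Eventually.of_forall fun p => ?_)
  simp [lift_eq_genLift]

lemma slope_add_int (μ : Fin (2 * m) → ℝ) (t : ℝ) (n : ℤ) : slope κ (μ, t + n) = slope κ (μ, t) :=
  genDeriv_add_int _ _ _ _ _

/-- The turning points are smooth functions of the parameters. -/
lemma exists_turning_curve (h : ∀ j, 1 < modulus μ₀ j)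
    (hC : Alternates m (genDeriv (order κ) (degree κ) (pole μ₀)) C₀) :
    ∃ c : (Fin (2 * m) → ℝ) → ℤ → ℝ, (∀ i, ContDiffAt ℝ ∞ (fun μ => c μ i) μ₀) ∧ c μ₀ = C₀ ∧
      (∀ i, ∀ᶠ v in 𝓝 (μ₀, C₀ i), slope κ v = 0 ↔ c v.1 i = v.2) ∧
      ∀ᶠ μ in 𝓝 μ₀, Alternates m (genDeriv (order κ) (degree κ) (pole μ)) (c μ) := by
  have hw := fun j => norm_pole_lt (h j)
  have hm := hC.m_pos
  have hm2 : (0 : ℤ) < 2 * m := by omega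
  choose c' hc1 hc2 hc3 using fun i : ℤ => exists_zero_curve (contDiffAt_slope (κ := κ) (n := ∞) h
    (C₀ i)) (by simp) (hC.zero i) (hC.deriv_ne_zero hw i)
  -- The implicit functions are used for the indices of one period only and extended by `C (i + 2m)
  -- = C i + 1`; otherwise infinitely many neighbourhoods would have to be intersected.
  set c : (Fin (2 * m) → ℝ) → ℤ → ℝ := fun μ i => c' (i % (2 * m)) μ + ((i / (2 * m) : ℤ) : ℝ)
    with hc
  have hsmooth : ∀ i, ContDiffAt ℝ ∞ (fun μ => c μ i) μ₀ := fun i =>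
    (hc1 (i % (2 * m))).add contDiffAt_const
  have h0i : ∀ i, C₀ i = C₀ (i % (2 * m)) + ((i / (2 * m) : ℤ) : ℝ) := fun i => by
    rw [← periodic_int hC.periodic, Int.emod_add_mul_ediv]
  have h0 : c μ₀ = C₀ := funext fun i => by simp only [hc]; rw [hc2, ← h0i]
  have hzero : ∀ i, ∀ᶠ v in 𝓝 (μ₀, C₀ i), slope κ v = 0 ↔ c v.1 i = v.2 := by
    intro i
    have ht : Tendsto (fun v : (Fin (2 * m) → ℝ) × ℝ => (v.1, v.2 - ((i / (2 * m) : ℤ) : ℝ)))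
        (𝓝 (μ₀, C₀ i)) (𝓝 (μ₀, C₀ (i % (2 * m)))) := by
      have : ContinuousAt (fun v : (Fin (2 * m) → ℝ) × ℝ => (v.1, v.2 - ((i / (2 * m) : ℤ) : ℝ)))
        (μ₀, C₀ i) := by fun_prop
      have h2 := this.tendsto
      dsimp only at h2
      rwa [h0i i, add_sub_cancel_right, ← h0i] at h2
    filter_upwards [ht.eventually (hc3 (i % (2 * m)))] with v hv
    have e1 : slope κ (v.1, v.2 - ((i / (2 * m) : ℤ) : ℝ)) = slope κ v := by
      have := slope_add_int (κ := κ) v.1 (v.2 - ((i / (2 * m) : ℤ) : ℝ)) (i / (2 * m))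
      rwa [sub_add_cancel, eq_comm] at this
    rw [e1] at hv
    rw [hv]
    simp only [hc]
    constructor <;> intro h3 <;> linarith
  have hcont : ∀ i, Tendsto (fun μ => c μ i) (𝓝 μ₀) (𝓝 (C₀ i)) := fun i => by
    have := (hsmooth i).continuousAt.tendsto
    rwa [h0] at this
  have hgc : ∀ x, ContinuousAt (fun μ => slope κ (μ, x)) μ₀ := fun x =>
    ContinuousAt.comp (f := fun μ => (μ, x)) (contDiffAt_slope (n := 0) h x).continuousAt (by fun_prop)
  refine ⟨c, hsmooth, h0, hzero, ?_⟩
  choose x hx hgx using hC.neg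
  choose y hy hgy using hC.pos
  have e1 : ∀ᶠ μ in 𝓝 μ₀, ∀ i ∈ Finset.Ico (0 : ℤ) (2 * m), slope κ (μ, c μ i) = 0 := by
    refine (Finset.eventually_all _).2 fun i _ => ?_
    filter_upwards [(tendsto_id.prodMk_nhds (hcont i)).eventually (hzero i)] with μ hμ
    exact hμ.2 rfl
  have e2 : ∀ᶠ μ in 𝓝 μ₀, ∀ j ∈ Finset.Ico (0 : ℤ) m,
      x j ∈ Ioo (c μ (2 * j - 1)) (c μ (2 * j)) ∧ slope κ (μ, x j) < 0 := by
    refine (Finset.eventually_all _).2 fun j _ => ?_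
    filter_upwards [(hcont (2 * j - 1)).eventually (gt_mem_nhds (hx j).1),
      (hcont (2 * j)).eventually (lt_mem_nhds (hx j).2),
      (hgc (x j)).eventually (gt_mem_nhds (hgx j))] with μ h1 h2 h3
    exact ⟨⟨h1, h2⟩, h3⟩
  have e3 : ∀ᶠ μ in 𝓝 μ₀, ∀ j ∈ Finset.Ico (0 : ℤ) m,
      y j ∈ Ioo (c μ (2 * j)) (c μ (2 * j + 1)) ∧ 0 < slope κ (μ, y j) := by
    refine (Finset.eventually_all _).2 fun j _ => ?_
    filter_upwards [(hcont (2 * j)).eventually (gt_mem_nhds (hy j).1),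
      (hcont (2 * j + 1)).eventually (lt_mem_nhds (hy j).2),
      (hgc (y j)).eventually (lt_mem_nhds (hgy j))] with μ h1 h2 h3
    exact ⟨⟨h1, h2⟩, h3⟩
  filter_upwards [e1, e2, e3] with μ h1 h2 h3
  refine alternates_of_periodic 0 hm (fun i => ?_) (fun t n => genDeriv_add_int _ _ _ _ _) h1
    (fun j hj => ⟨x j, h2 j (by simpa using hj)⟩) fun j hj => ⟨y j, h3 j (by simpa using hj)⟩
  simp only [hc]
  rw [Int.add_emod_right, Int.add_ediv_of_dvd_right (dvd_refl _), Int.ediv_self hm2.ne']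
  push_cast; ring

/-! ### Persistence of the labelling -/

lemma eventually_mem_region (h : ∀ j, 1 < modulus μ₀ j) {z : ℂ} (hz : z ∈ region κ μ₀) :
    ∀ᶠ p : (Fin (2 * m) → ℝ) × ℂ in 𝓝 (μ₀, z), p.2 ∈ region κ p.1 := by
  have h1 : ContinuousAt (fun p : (Fin (2 * m) → ℝ) × ℂ => ‖blaschke κ p.1 p.2‖) (μ₀, z) :=
    (continuousAt_blaschke h hz.1.le).norm
  filter_upwards [h1.eventually (gt_mem_nhds hz.2),
    (continuous_snd.norm.continuousAt (x := (μ₀, z))).eventually (lt_mem_nhds hz.1)] with p h2 h3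
  exact ⟨h3, h2⟩

lemma eventually_subset_region (h : ∀ j, 1 < modulus μ₀ j) {K : Set ℂ} (hK : IsCompact K)
    (hsub : K ⊆ region κ μ₀) : ∀ᶠ μ in 𝓝 μ₀, K ⊆ region κ μ :=
  hK.eventually_forall_of_forall_eventually fun _ hz => eventually_mem_region h (hsub hz)

/-- Inside the disk, a path joins `a_j` to a point of the box above `x`. Together with a small ball
around `a_j`, which still contains the moved zero, it is a compact connected set that remains in the
region for nearby parameters. -/
lemma eventually_collar (h : ∀ j, 1 < modulus μ₀ j) (hκ : ∀ i, 0 < κ i) {j : Fin m} {x : ℝ}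
    (hx : genDeriv (order κ) (degree κ) (pole μ₀) x < 0) (hc : Collar κ μ₀ j x) :
    ∀ᶠ μ in 𝓝 μ₀, Collar κ μ j x := by
  obtain ⟨ε, hε, hbox⟩ := exists_box (κ := κ) h (σ := -1) (x₀ := x) (by linarith)
  obtain ⟨ρ, hρ, hmem⟩ := exists_of_collar hc hε
  have ho : IsOpen (outerDisk κ μ₀ j) := (isOpen_region h).connectedComponentIn
  have hzj := zero_mem_outerDisk h j (hκ j.succ)
  have hpc : IsPathConnected (outerDisk κ μ₀ j) :=
    ho.isConnected_iff_isPathConnected.1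
      (isConnected_connectedComponentIn_iff.2 (zero_mem_region h j (hκ j.succ)))
  obtain ⟨γ, hγ⟩ := hpc.joinedIn _ hzj _ hmem
  obtain ⟨r, hr, hball⟩ := Metric.nhds_basis_closedBall.mem_iff.1 (ho.mem_nhds hzj)
  set K := Metric.closedBall (zero μ₀ j) r ∪ range γ
  have hKc : IsCompact K := (isCompact_closedBall _ _).union (isCompact_range γ.continuous)
  have hKr : K ⊆ region κ μ₀ := union_subset (hball.trans (outerDisk_subset j))
    (range_subset_iff.2 fun t => outerDisk_subset j (hγ t))
  have hKp : IsPreconnected K := IsPreconnected.union (zero μ₀ j)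
    (Metric.mem_closedBall_self hr.le) ⟨0, γ.source⟩ (convex_closedBall _ _).isPreconnected
    (isPreconnected_range γ.continuous)
  filter_upwards [hbox, eventually_subset_region h hKc hKr,
    (continuous_zero j).continuousAt.eventually (Metric.closedBall_mem_nhds _ hr)] with μ hb hK hz
  have hend : (ρ : ℂ) * e x ∈ outerDisk κ μ j := by
    refine mem_component_of_isPreconnected hKp hK (Or.inl hz) ?_ (Or.inr ⟨1, γ.target⟩)
    exact mem_connectedComponentIn (hK (Or.inl hz))
  have hI : (fun s : ℝ => (s : ℂ) * e x) '' Ioo 1 (1 + ε) ⊆ region κ μ := by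
    rintro _ ⟨s, hs, rfl⟩
    refine ⟨by rw [norm_ofReal_mul_e (by linarith [hs.1])]; exact hs.1, ?_⟩
    refine (Real.log_neg_iff (blaschke_norm_pos x hs.1.le fun l => hs.2.trans (hb.1 l))).1 ?_
    have := hb.2 x (by simpa using hε) s hs
    linarith
  refine collar_of_forall hε fun s hs => ?_
  exact mem_component_of_isPreconnected (isPreconnected_Ioo.image _
    (Complex.continuous_ofReal.mul continuous_const).continuousOn) hI (mem_image_of_mem _ hρ) hend
    (mem_image_of_mem _ hs)

lemma eventually_touches (h : ∀ j, 1 < modulus μ₀ j) (hκ : ∀ i, 0 < κ i)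
    (hC : Alternates m (genDeriv (order κ) (degree κ) (pole μ₀)) C₀)
    {c : (Fin (2 * m) → ℝ) → ℤ → ℝ} (hc : ∀ i, Tendsto (fun μ => c μ i) (𝓝 μ₀) (𝓝 (C₀ i)))
    {i : ℤ} {j : Fin m} (ht : Touches κ μ₀ C₀ i j) : ∀ᶠ μ in 𝓝 μ₀, Touches κ μ (c μ) i j := by
  obtain ⟨x, hx, hcx⟩ := ht
  filter_upwards [eventually_collar h hκ (hC.neg_of_mem (fun j => norm_pole_lt (h j)) hx) hcx,
    (hc (2 * i - 1)).eventually (gt_mem_nhds hx.1), (hc (2 * i)).eventually (lt_mem_nhds hx.2)]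
    with μ h1 h2 h3
  exact ⟨x, ⟨h2, h3⟩, h1⟩

/-- The correspondence between the arcs and the disks is locally constant. -/
lemma eventually_touches_iff (h : ∀ j, 1 < modulus μ₀ j) (hκ : ∀ i, 0 < κ i)
    (hC : Alternates m (genDeriv (order κ) (degree κ) (pole μ₀)) C₀)
    {c : (Fin (2 * m) → ℝ) → ℤ → ℝ} (hc : ∀ i, Tendsto (fun μ => c μ i) (𝓝 μ₀) (𝓝 (C₀ i)))
    (hA : ∀ᶠ μ in 𝓝 μ₀, Alternates m (genDeriv (order κ) (degree κ) (pole μ)) (c μ)) :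
    ∀ᶠ μ in 𝓝 μ₀, ∀ i j, Touches κ μ (c μ) i j ↔ Touches κ μ₀ C₀ i j := by
  choose f hf using exists_touches h hκ hC
  have hm : (0 : ℤ) < m := by exact_mod_cast hC.m_pos
  filter_upwards [hA, isOpen_one_lt_modulus.mem_nhds h, (Finset.eventually_all _).2
    fun i (_ : i ∈ Finset.Ico (0 : ℤ) m) => eventually_touches h hκ hC hc (hf i)] with μ h1 h2 h3
  -- For both parameters the arc `i` is touched by the same disk. As each arc is touched by only one
  -- disk, the two relations coincide.
  have h4 : ∀ i, Touches κ μ (c μ) i (f (i % m)) ∧ Touches κ μ₀ C₀ i (f (i % m)) := by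
    intro i
    have e1 := Int.emod_add_mul_ediv i m
    have h5 := h3 (i % m) (Finset.mem_Ico.2 ⟨Int.emod_nonneg _ hm.ne', Int.emod_lt_of_pos _ hm⟩)
    constructor
    · have := (touches_add h1.periodic (i / m)).2 h5
      rwa [e1] at this
    · have := (touches_add hC.periodic (i / m)).2 (hf (i % m))
      rwa [e1] at this
  intro i j
  constructor
  · intro ht
    rw [touches_unique h2 hκ h1 ht (h4 i).1]; exact (h4 i).2
  · intro ht
    rw [touches_unique h hκ hC ht (h4 i).2]; exact (h4 i).1

lemma touches_comp_shift {μ : Fin (2 * m) → ℝ} {C : ℤ → ℝ} {i l : ℤ} {j : Fin m} :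
    Touches κ μ (fun i => C (i + 2 * l)) i j ↔ Touches κ μ C (i + l) j := by
  unfold Touches
  rw [show 2 * (i + l) - 1 = 2 * i - 1 + 2 * l by ring, show 2 * (i + l) = 2 * i + 2 * l by ring]

/-- Near a parameter with a labelling, there is a labelling that depends smoothly on the parameter
and contains all zeros near the given ones. -/
lemma IsLabelling.exists_curve (hκ : ∀ i, 0 < κ i) (hL : IsLabelling κ μ₀ C₀) :
    ∃ c : (Fin (2 * m) → ℝ) → ℤ → ℝ, (∀ i, ContDiffAt ℝ ∞ (fun μ => c μ i) μ₀) ∧ c μ₀ = C₀ ∧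
      (∀ i, ∀ᶠ v in 𝓝 (μ₀, C₀ i), slope κ v = 0 ↔ c v.1 i = v.2) ∧
      ∀ᶠ μ in 𝓝 μ₀, IsLabelling κ μ (c μ) := by
  have h := hL.one_lt_modulus
  obtain ⟨c, h1, h2, h3, h4⟩ := exists_turning_curve h hL.alternates
  refine ⟨c, h1, h2, h3, ?_⟩
  have hc : ∀ i, Tendsto (fun μ => c μ i) (𝓝 μ₀) (𝓝 (C₀ i)) := fun i => by
    have := (h1 i).continuousAt.tendsto
    rwa [h2] at this
  filter_upwards [h4, isOpen_one_lt_modulus.mem_nhds h,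
    eventually_touches_iff h hκ hL.alternates hc h4] with μ h5 h6 h7
  exact isLabelling_iff.2 ⟨h6, h5, fun j => (h7 _ _).2 (hL.touches j)⟩

lemma isOpen_OrderedDelta (hκ : ∀ i, 0 < κ i) : IsOpen (OrderedDelta κ) := by
  rw [isOpen_iff_mem_nhds]
  rintro μ ⟨C, hC⟩
  obtain ⟨c, -, -, -, h⟩ := hC.exists_curve hκ
  filter_upwards [h] with μ hμ
  exact ⟨_, hμ⟩

lemma OrderedDelta_subset : OrderedDelta κ ⊆ Delta κ := fun _ ⟨_, hC⟩ =>
  ⟨hC.one_lt_modulus, _, hC.multimodal⟩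

/-- `OrderedDelta` is closed in `Delta`. -/
lemma eventually_not_mem_OrderedDelta (hκ : ∀ i, 0 < κ i) (hμ : μ₀ ∈ Delta κ)
    (hμ' : μ₀ ∉ OrderedDelta κ) : ∀ᶠ μ in 𝓝 μ₀, μ ∉ OrderedDelta κ := by
  obtain ⟨h, C₀, hC₀⟩ := hμ
  rw [lift_eq_genLift] at hC₀
  have hA := hC₀.alternates fun j => norm_pole_lt (h j)
  obtain ⟨c, h1, h2, h3, h4⟩ := exists_turning_curve h hA
  have hc : ∀ i, Tendsto (fun μ => c μ i) (𝓝 μ₀) (𝓝 (C₀ i)) := fun i => by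
    have := (h1 i).continuousAt.tendsto
    rwa [h2] at this
  filter_upwards [h4, isOpen_one_lt_modulus.mem_nhds h, eventually_touches_iff h hκ hA hc h4]
    with μ h5 h6 h7
  rintro ⟨C, hC⟩
  obtain ⟨l, hl⟩ := h5.exists_shift hC.alternates fun j => norm_pole_lt (h6 j)
  -- A labelling of the nearby parameter is a shift of the continued turning points, and the same
  -- shift of `C₀` would label `μ₀`.
  refine hμ' ⟨fun i => C₀ (i + 2 * l), isLabelling_iff.2 ⟨h, hA.comp_shift l, fun j => ?_⟩⟩
  rw [touches_comp_shift, ← h7, ← touches_comp_shift]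
  have := hC.touches j
  rwa [funext hl] at this

end persistence


/-! ### Coordinates -/

section coordinates
variable {m : ℕ}

lemma coord_add (μ ν : Fin (2 * m) → ℝ) (i : ℕ) : coord (μ + ν) i = coord μ i + coord ν i := by
  unfold coord; split_ifs <;> simp

lemma coord_smul (s : ℝ) (μ : Fin (2 * m) → ℝ) (i : ℕ) : coord (s • μ) i = s * coord μ i := by
  unfold coord; split_ifs <;> simp

lemma modulus_add (μ ν : Fin (2 * m) → ℝ) (j : Fin m) :
    modulus (μ + ν) j = modulus μ j + modulus ν j := by
  unfold modulus; split_ifs <;> exact coord_add _ _ _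

lemma modulus_smul (s : ℝ) (μ : Fin (2 * m) → ℝ) (j : Fin m) :
    modulus (s • μ) j = s * modulus μ j := by
  unfold modulus; split_ifs <;> exact coord_smul _ _ _

lemma angle_add (μ ν : Fin (2 * m) → ℝ) (j : Fin m) : angle (μ + ν) j = angle μ j + angle ν j := by
  unfold angle; split_ifs
  · simp
  · exact coord_add _ _ _

lemma angle_smul (s : ℝ) (μ : Fin (2 * m) → ℝ) (j : Fin m) : angle (s • μ) j = s * angle μ j := by
  unfold angle; split_ifs
  · simp
  · exact coord_smul _ _ _

lemma angle_of_val_eq_zero (μ : Fin (2 * m) → ℝ) {j : Fin m} (hj : (j : ℕ) = 0) : angle μ j = 0 :=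
  if_pos hj

/-- The parameter with given initial coordinate, moduli and angles. -/
def mkParam (c : ℝ) (r η : Fin m → ℝ) (i : Fin (2 * m)) : ℝ :=
  if (i : ℕ) = 0 then c
  else if (i : ℕ) % 2 = 0 ∨ (i : ℕ) = 1 then r ⟨i / 2, by omega⟩ else η ⟨i / 2, by omega⟩

lemma coord_mkParam (hm : 0 < m) (c : ℝ) (r η : Fin m → ℝ) : coord (mkParam c r η) 0 = c := by
  unfold coord mkParam; rw [dif_pos (by omega), if_pos rfl]

lemma modulus_mkParam (c : ℝ) (r η : Fin m → ℝ) (j : Fin m) : modulus (mkParam c r η) j = r j := by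
  unfold modulus coord mkParam
  have hj := j.2
  by_cases h : (j : ℕ) = 0
  · rw [if_pos h, dif_pos (by omega)]
    simp only [one_ne_zero, if_false, or_true, if_true]
    congr 1; ext; simp [h]
  · rw [if_neg h, dif_pos (by omega), if_neg (by dsimp only; omega), if_pos (by dsimp only; omega)]
    congr 1; ext; simp

lemma angle_mkParam (c : ℝ) (r η : Fin m → ℝ) (h0 : ∀ j : Fin m, (j : ℕ) = 0 → η j = 0)
    (j : Fin m) : angle (mkParam c r η) j = η j := by
  unfold angle coord mkParam
  have hj := j.2
  by_cases h : (j : ℕ) = 0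
  · rw [if_pos h, h0 j h]
  · rw [if_neg h, dif_pos (by omega), if_neg (by dsimp only; omega), if_neg (by dsimp only; omega)]
    congr 1; ext; dsimp only; omega

/-- Each coordinate is the initial coordinate, a modulus, or an angle. -/
lemma coord_cases (i : Fin (2 * m)) : (∀ μ : Fin (2 * m) → ℝ, μ i = coord μ 0) ∨
    (∃ j, ∀ μ : Fin (2 * m) → ℝ, μ i = modulus μ j) ∨
    ∃ j, ∀ μ : Fin (2 * m) → ℝ, μ i = angle μ j := by
  have hi := i.2
  by_cases h0 : (i : ℕ) = 0
  · left; intro μ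
    unfold coord; rw [dif_pos (by omega)]; congr 1; ext; exact h0
  right
  by_cases h1 : (i : ℕ) = 1
  · left
    refine ⟨⟨0, by omega⟩, fun μ => ?_⟩
    unfold modulus coord
    rw [if_pos rfl, dif_pos (by omega)]; congr 1; ext; exact h1
  by_cases h2 : (i : ℕ) % 2 = 0
  · left
    refine ⟨⟨i / 2, by omega⟩, fun μ => ?_⟩
    unfold modulus coord
    rw [if_neg (by dsimp only; omega), dif_pos (by dsimp only; omega)]
    congr 1; ext; dsimp only; omega
  · right
    refine ⟨⟨i / 2, by omega⟩, fun μ => ?_⟩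
    unfold angle coord
    rw [if_neg (by dsimp only; omega), dif_pos (by dsimp only; omega)]
    congr 1; ext; dsimp only; omega

lemma param_ext {μ ν : Fin (2 * m) → ℝ} (h0 : coord μ 0 = coord ν 0)
    (h1 : ∀ j, modulus μ j = modulus ν j) (h2 : ∀ j, angle μ j = angle ν j) : μ = ν := by
  funext i
  rcases coord_cases i with h | ⟨j, h⟩ | ⟨j, h⟩
  · rw [h μ, h ν, h0]
  · rw [h μ, h ν, h1]
  · rw [h μ, h ν, h2]

end coordinates

/-! ### The derivative of the critical values -/

section derivative
variable {m : ℕ} {κ : Fin (m + 1) → ℕ} {μ₀ : Fin (2 * m) → ℝ} {C₀ : ℤ → ℝ}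

/-- The derivative of the constant term in the direction `ν`. -/
noncomputable def shiftDeriv (κ : Fin (m + 1) → ℕ) (ν : Fin (2 * m) → ℝ) : ℝ :=
  coord ν 0 + ∑ j : Fin m, (κ j.succ : ℝ) * (2 * angle ν j)

/-- The derivative of the poles in the direction `ν`. -/
noncomputable def poleDeriv (μ ν : Fin (2 * m) → ℝ) (j : Fin m) : ℂ :=
  (-(modulus ν j / modulus μ j ^ 2 : ℝ) +
    ((modulus μ j)⁻¹ : ℝ) * (2 * Real.pi * Complex.I * (angle ν j : ℝ))) * e (angle μ j)

/-- The derivative of the lift in the direction `ν`, at a fixed point. -/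
noncomputable def liftDeriv (κ : Fin (m + 1) → ℕ) (μ ν : Fin (2 * m) → ℝ) (t : ℝ) : ℝ :=
  trigSum Finset.univ (pole μ) (fun j => -((order κ j / Real.pi : ℝ) * conj (poleDeriv μ ν j)))
    (shiftDeriv κ ν) (e t)

lemma hasDerivAt_pole (h : ∀ j, 1 < modulus μ₀ j) (ν : Fin (2 * m) → ℝ) (j : Fin m) :
    HasDerivAt (fun s : ℝ => pole (μ₀ + s • ν) j) (poleDeriv μ₀ ν j) 0 := by
  unfold pole poleDeriv
  simp only [modulus_add, modulus_smul, angle_add, angle_smul]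
  have hr : HasDerivAt (fun s : ℝ => modulus μ₀ j + s * modulus ν j) (modulus ν j) 0 := by
    simpa using ((hasDerivAt_id (0 : ℝ)).mul_const (modulus ν j)).const_add (modulus μ₀ j)
  have ha : HasDerivAt (fun s : ℝ => angle μ₀ j + s * angle ν j) (angle ν j) 0 := by
    simpa using ((hasDerivAt_id (0 : ℝ)).mul_const (angle ν j)).const_add (angle μ₀ j)
  have hne : modulus μ₀ j + 0 * modulus ν j ≠ 0 := by have := h j; linarith
  have h1 := (hr.fun_inv hne).ofReal_comp
  have h2 := (hasDerivAt_e (angle μ₀ j + 0 * angle ν j)).scomp (0 : ℝ) ha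
  refine (h1.mul h2).congr_deriv ?_
  simp only [zero_mul, add_zero, Complex.real_smul, Function.comp]
  push_cast
  ring

lemma hasDerivAt_shift (ν : Fin (2 * m) → ℝ) :
    HasDerivAt (fun s : ℝ => shift κ (μ₀ + s • ν)) (shiftDeriv κ ν) 0 := by
  unfold shift shiftDeriv
  simp only [coord_add, coord_smul, angle_add, angle_smul]
  refine HasDerivAt.add ?_ (HasDerivAt.fun_sum fun j _ => ?_)
  · simpa using ((hasDerivAt_id (0 : ℝ)).mul_const (coord ν 0)).const_add (coord μ₀ 0)
  · have := (((((hasDerivAt_id (0 : ℝ)).mul_const (angle ν j)).const_add (angle μ₀ j)).const_mul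
      2).add_const 1).const_mul (κ j.succ : ℝ)
    simpa using this

/-- The motion of the turning point does not contribute, because the derivative of the lift vanishes
there. -/
lemma hasDerivAt_turningValue (h : ∀ j, 1 < modulus μ₀ j) {c : (Fin (2 * m) → ℝ) → ℝ}
    (hc : DifferentiableAt ℝ c μ₀) (hz : slope κ (μ₀, c μ₀) = 0) (ν : Fin (2 * m) → ℝ) :
    HasDerivAt (fun s : ℝ => lift κ (μ₀ + s • ν) (c (μ₀ + s • ν)))
      (liftDeriv κ μ₀ ν (c μ₀)) 0 := by
  have hline : HasDerivAt (fun s : ℝ => μ₀ + s • ν) ν 0 := by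
    simpa using ((hasDerivAt_id (0 : ℝ)).smul_const ν).const_add μ₀
  have hc' : HasDerivAt (fun s : ℝ => c (μ₀ + s • ν)) (fderiv ℝ c μ₀ ν) 0 := by
    refine HasFDerivAt.comp_hasDerivAt (0 : ℝ) ?_ hline
    simpa using hc.hasFDerivAt
  have := hasDerivAt_genLift_curve (k := order κ) (D := degree κ) (hasDerivAt_shift (κ := κ) (μ₀ := μ₀) ν)
    (hasDerivAt_pole h ν) hc' (by simpa using fun j => norm_pole_lt (h j))
  simp only [lift_eq_genLift]
  refine this.congr_deriv ?_
  have e0 : μ₀ + (0 : ℝ) • ν = μ₀ := by simp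
  rw [e0]
  have : genDeriv (order κ) (degree κ) (pole μ₀) (c μ₀) = 0 := hz
  rw [this, zero_mul, add_zero]
  rfl

/-- A direction in which all critical values have the same derivative changes only the initial
coordinate. -/
lemma eq_zero_of_liftDeriv (hκ : ∀ i, 0 < κ i) (h : ∀ j, 1 < modulus μ₀ j)
    (hC : Alternates m (genDeriv (order κ) (degree κ) (pole μ₀)) C₀) {ν : Fin (2 * m) → ℝ} {l : ℝ}
    (hl : ∀ i ∈ Icc (1 : ℤ) (2 * m), liftDeriv κ μ₀ ν (C₀ i) = l) :
    (∀ j, modulus ν j = 0) ∧ ∀ j, angle ν j = 0 := by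
  classical
  have hw := fun j => norm_pole_lt (h j)
  have hm := hC.m_pos
  obtain ⟨x, hx, hgx⟩ := hC.neg 1
  -- Adding a multiple of `F'` changes nothing at the turning points. The factor is chosen such that
  -- `liftDeriv - l + a F'` also vanishes at `x`, which gives `2m + 1` zeros.
  set a : ℝ := (l - liftDeriv κ μ₀ ν x) / genDeriv (order κ) (degree κ) (pole μ₀) x with ha
  set Q : Fin m → ℂ := fun j => -((order κ j / Real.pi : ℝ) * conj (poleDeriv μ₀ ν j)) +
    a * (-(2 * order κ j * Complex.I * conj (pole μ₀ j))) with hQ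
  set c : ℝ := shiftDeriv κ ν - l + a * degree κ
  have hsum : ∀ t, trigSum Finset.univ (pole μ₀) Q c (e t) =
      liftDeriv κ μ₀ ν t - l + a * genDeriv (order κ) (degree κ) (pole μ₀) t := by
    intro t
    unfold liftDeriv genDeriv trigSum
    have e1 : ∀ j, (Q j * e t / (1 - conj (pole μ₀ j) * e t)).im =
        (-((order κ j / Real.pi : ℝ) * conj (poleDeriv μ₀ ν j)) * e t /
          (1 - conj (pole μ₀ j) * e t)).im + a * (-(2 * order κ j * Complex.I * conj (pole μ₀ j)) *
          e t / (1 - conj (pole μ₀ j) * e t)).im := by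
      intro j
      rw [← Complex.im_ofReal_mul, ← Complex.add_im]
      congr 1
      simp only [hQ]
      ring
    rw [Finset.sum_congr rfl fun j _ => e1 j, Finset.sum_add_distrib, ← Finset.mul_sum]
    ring
  obtain ⟨T, hcard, hT, -, hCT⟩ := hC.finset_zeros
  have hTz : T = (Finset.Icc (1 : ℤ) (2 * m)).image C₀ := by
    symm
    refine Finset.eq_of_subset_of_card_le ?_ ?_
    · intro t ht
      obtain ⟨i, hi, rfl⟩ := Finset.mem_image.1 ht
      exact hCT i (by simpa using hi)
    · rw [hcard, Finset.card_image_of_injective _ hC.strictMono.injective, Int.card_Icc]; omega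
  have hx12 : x ∈ Ioo (C₀ 1) (C₀ 2) := by simpa using hx
  have hxT : x ∉ T := by
    intro hxT
    rw [hTz] at hxT
    obtain ⟨i, -, hi⟩ := Finset.mem_image.1 hxT
    rw [← hi, hC.zero] at hgx
    exact lt_irrefl _ hgx
  have hall : ∀ t, trigSum Finset.univ (pole μ₀) Q c (e t) = 0 := by
    refine trigSum_eq_zero_of_card (T := insert x T) (x := C₀ 1) (fun j _ => hw j) ?_ ?_ ?_
    · intro t ht
      rcases Finset.mem_insert.1 ht with rfl | ht
      · exact ⟨hx12.1.le, hx12.2.trans (sub_lt_of_periodic hC.strictMono hC.periodic (by omega))⟩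
      · exact hT t ht
    · intro t ht
      rw [hsum]
      rcases Finset.mem_insert.1 ht with rfl | ht
      · rw [ha, div_mul_cancel₀ _ hgx.ne]; ring
      · rw [hTz] at ht
        obtain ⟨i, hi, rfl⟩ := Finset.mem_image.1 ht
        rw [hl i (by simpa using hi), hC.zero]; ring
    · rw [Finset.card_insert_of_notMem hxT, hcard, Finset.card_univ, Fintype.card_fin]; omega
  have hinj := (hC.injective_pole hw).1
  have hπ : (Real.pi : ℂ) ≠ 0 := by exact_mod_cast Real.pi_ne_zero
  -- Vanishing residues say that the pole `w_j` has derivative `2πi a w_j` for each `j`: all poles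
  -- are rotated by the same infinitesimal angle, and their moduli are fixed.
  have key : ∀ j, modulus ν j = 0 ∧ angle ν j = a := by
    intro j
    have h1 := residue_eq_zero_of_trigSum (fun j _ => hw j) hinj.injOn hall (Finset.mem_univ j)
    have hk : (order κ j : ℂ) ≠ 0 := by
      unfold order; exact_mod_cast (hκ j.succ).ne'
    have h2 : conj (poleDeriv μ₀ ν j) = conj (2 * Real.pi * Complex.I * a * pole μ₀ j) := by
      have h3 : (order κ j : ℂ) / Real.pi * (conj (poleDeriv μ₀ ν j) +
          2 * Real.pi * Complex.I * a * conj (pole μ₀ j)) = 0 := by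
        rw [← neg_eq_zero, ← h1]
        simp only [hQ]
        push_cast
        field_simp
        ring
      have h4 := (mul_eq_zero.1 h3).resolve_left (div_ne_zero hk hπ)
      rw [eq_neg_of_add_eq_zero_left h4]
      simp only [map_mul, Complex.conj_I, Complex.conj_ofReal, map_ofNat]
      ring
    have h3 := (starRingEnd ℂ).injective h2
    unfold poleDeriv pole at h3
    have h4 := mul_right_cancel₀ (e_ne_zero _) (h3.trans (mul_assoc _ _ _).symm)
    have hr : modulus μ₀ j ≠ 0 := by have := h j; linarith
    have hre := congrArg Complex.re h4
    have him := congrArg Complex.im h4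
    simp [-Complex.ofReal_inv, -Complex.ofReal_div, -Complex.ofReal_pow] at hre him
    constructor
    · rcases hre with h5 | h5
      · exact h5
      · exact absurd h5 hr
    · have hinv : (modulus μ₀ j)⁻¹ ≠ 0 := inv_ne_zero hr
      have h5 : (modulus μ₀ j)⁻¹ * (2 * Real.pi) * (angle ν j - a) = 0 := by linarith
      have h6 := (mul_eq_zero.1 h5).resolve_left (mul_ne_zero hinv (by positivity))
      linarith
  -- The normalization `η_1 = 0` excludes this common rotation.
  have ha0 : a = 0 := by
    rw [← (key ⟨0, hm⟩).2]; exact angle_of_val_eq_zero ν rfl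
  exact ⟨fun j => (key j).1, fun j => by rw [(key j).2, ha0]⟩

/-- The critical values, with a part of the value at the first turning point replaced by the
constant term. -/
noncomputable def mixedValues (κ : Fin (m + 1) → ℕ) (a : ℝ) (μ : Fin (2 * m) → ℝ) (C : ℤ → ℝ)
    (i : Fin (2 * m)) : ℝ :=
  turningValues m (lift κ μ) C i - a * (lift κ μ (C 1) - shift κ μ)

lemma contDiffAt_lift_comp {n : ℕ∞ω} (h : ∀ j, 1 < modulus μ₀ j) {c : (Fin (2 * m) → ℝ) → ℝ}
    (hc : ContDiffAt ℝ n c μ₀) : ContDiffAt ℝ n (fun μ => lift κ μ (c μ)) μ₀ :=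
  (ContDiffAt.comp μ₀ (contDiffAt_lift (κ := κ) h (c μ₀)) (contDiffAt_id.prodMk hc)).congr_of_eventuallyEq
    (Eventually.of_forall fun _ => rfl)

lemma contDiffAt_mixedValues {n : ℕ∞ω} (h : ∀ j, 1 < modulus μ₀ j) {c : (Fin (2 * m) → ℝ) → ℤ → ℝ}
    (hc : ∀ i, ContDiffAt ℝ n (fun μ => c μ i) μ₀) (a : ℝ) :
    ContDiffAt ℝ n (fun μ => mixedValues κ a μ (c μ)) μ₀ := by
  refine contDiffAt_pi.2 fun i => ?_
  unfold mixedValues turningValues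
  exact (contDiffAt_lift_comp h (hc _)).sub
    (contDiffAt_const.mul ((contDiffAt_lift_comp h (hc 1)).sub contDiff_shift.contDiffAt))

/-- The case `a = 0` concerns the critical values, the case `a = 1` their normalization. A kernel
vector changes all critical values equally, so it only moves `η_0`; then every critical value and
`shift` change by the same amount, which must be `0`. -/
lemma exists_hasFDerivAt_mixedValues (hκ : ∀ i, 0 < κ i) (h : ∀ j, 1 < modulus μ₀ j)
    (hC : Alternates m (genDeriv (order κ) (degree κ) (pole μ₀)) C₀)
    {c : (Fin (2 * m) → ℝ) → ℤ → ℝ} (hc : ∀ i, ContDiffAt ℝ ∞ (fun μ => c μ i) μ₀) (h0 : c μ₀ = C₀)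
    (a : ℝ) : ∃ L : (Fin (2 * m) → ℝ) ≃L[ℝ] (Fin (2 * m) → ℝ),
      HasFDerivAt (fun μ => mixedValues κ a μ (c μ)) (L : (Fin (2 * m) → ℝ) →L[ℝ] (Fin (2 * m) → ℝ)) μ₀ := by
  have hd := ((contDiffAt_mixedValues (κ := κ) h hc a).differentiableAt (by simp)).hasFDerivAt
  set L : (Fin (2 * m) → ℝ) →L[ℝ] (Fin (2 * m) → ℝ) :=
    fderiv ℝ (fun μ => mixedValues κ a μ (c μ)) μ₀
  have hval : ∀ i, ∀ ν, HasDerivAt (fun s : ℝ => lift κ (μ₀ + s • ν) (c (μ₀ + s • ν) i))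
      (liftDeriv κ μ₀ ν (C₀ i)) 0 := by
    intro i ν
    have := hasDerivAt_turningValue (κ := κ) h ((hc i).differentiableAt (by simp))
      (by rw [h0]; exact hC.zero i) ν
    rwa [h0] at this
  have hdir : ∀ ν i, L ν i = liftDeriv κ μ₀ ν (C₀ ((i : ℤ) + 1)) -
      a * (liftDeriv κ μ₀ ν (C₀ 1) - shiftDeriv κ ν) := by
    intro ν i
    have hline : HasDerivAt (fun s : ℝ => μ₀ + s • ν) ν 0 := by
      simpa using ((hasDerivAt_id (0 : ℝ)).smul_const ν).const_add μ₀
    have h1 : HasDerivAt (fun s : ℝ => mixedValues κ a (μ₀ + s • ν) (c (μ₀ + s • ν))) (L ν) 0 := by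
      have e0 : μ₀ + (0 : ℝ) • ν = μ₀ := by simp
      have hd' : HasFDerivAt (fun μ => mixedValues κ a μ (c μ)) L (μ₀ + (0 : ℝ) • ν) := by
        rw [e0]; exact hd
      exact hd'.comp_hasDerivAt (0 : ℝ) hline
    have h2 := hasDerivAt_pi.1 h1 i
    refine h2.unique ?_
    unfold mixedValues turningValues
    exact (hval _ ν).sub (((hval 1 ν).sub (hasDerivAt_shift ν)).const_mul a)
  have hker : ∀ ν, L ν = 0 → ν = 0 := by
    intro ν hν
    have h1 : ∀ i ∈ Icc (1 : ℤ) (2 * m), liftDeriv κ μ₀ ν (C₀ i) =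
        a * (liftDeriv κ μ₀ ν (C₀ 1) - shiftDeriv κ ν) := by
      intro i hi
      have h2 := hdir ν ⟨(i - 1).toNat, by have := hi.1; have := hi.2; omega⟩
      rw [hν] at h2
      have e1 : (((i - 1).toNat : ℕ) : ℤ) + 1 = i := by have := hi.1; omega
      dsimp only at h2
      rw [e1] at h2
      simp only [Pi.zero_apply] at h2
      linarith
    obtain ⟨hmod, hang⟩ := eq_zero_of_liftDeriv hκ h hC h1
    have h2 : ∀ t, liftDeriv κ μ₀ ν t = shiftDeriv κ ν := by
      intro t
      unfold liftDeriv trigSum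
      rw [Finset.sum_eq_zero fun j _ => ?_, add_zero]
      simp [poleDeriv, hmod j, hang j]
    have h3 : shiftDeriv κ ν = 0 := by
      have hm := hC.m_pos
      have := h1 1 ⟨le_rfl, by omega⟩
      rw [h2] at this
      simpa using this
    refine param_ext ?_ (fun j => ?_) fun j => ?_
    · unfold shiftDeriv at h3
      simp only [hang, mul_zero, Finset.sum_const_zero, add_zero] at h3
      rw [h3]
      simp [coord]
    · rw [hmod j]; simp [modulus, coord]
    · rw [hang j]; simp [angle, coord]
  have hinj : Function.Injective (L : (Fin (2 * m) → ℝ) →ₗ[ℝ] (Fin (2 * m) → ℝ)) :=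
    (injective_iff_map_eq_zero (L : (Fin (2 * m) → ℝ) →ₗ[ℝ] (Fin (2 * m) → ℝ))).2 hker
  refine ⟨(LinearEquiv.ofInjectiveEndo (L : (Fin (2 * m) → ℝ) →ₗ[ℝ] (Fin (2 * m) → ℝ)) hinj).toContinuousLinearEquiv, ?_⟩
  exact hd.congr_fderiv (by ext; rfl)

end derivative


/-! ### Normalized critical values -/

section normalized
variable {m : ℕ} {κ : Fin (m + 1) → ℕ} {τ : Fin (2 * m - 1) → ℤ} {μ : Fin (2 * m) → ℝ} {C : ℤ → ℝ}

open Classical in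
/-- The critical values, normalized by a translation such that they do not depend on the
labelling. -/
noncomputable def normValues (κ : Fin (m + 1) → ℕ) (μ : Fin (2 * m) → ℝ) : Fin (2 * m) → ℝ :=
  if h : μ ∈ OrderedDelta κ then mixedValues κ 1 μ h.choose else 0

/-- Another labelling translates all turning points by an integer `n`, which adds `degree κ * n` to
each value and also to the subtracted one. -/
lemma IsLabelling.normValues_eq (hκ : ∀ i, 0 < κ i) (h : IsLabelling κ μ C) :
    normValues κ μ = mixedValues κ 1 μ C := by
  have hμ : μ ∈ OrderedDelta κ := ⟨C, h⟩
  obtain ⟨n, hn⟩ := h.eq_add_int hκ hμ.choose_spec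
  unfold normValues
  rw [dif_pos hμ]
  funext i
  unfold mixedValues turningValues
  rw [hn, hn, lift_add_int, lift_add_int]
  ring

lemma IsLabelling.normValues_eq_add (hκ : ∀ i, 0 < κ i) (h : IsLabelling κ μ C) :
    normValues κ μ = fun i => turningValues m (lift κ μ) C i + (shift κ μ - lift κ μ (C 1)) := by
  rw [h.normValues_eq hκ]
  funext i
  unfold mixedValues
  ring

lemma IsLabelling.turningValues_eq_add (hκ : ∀ i, 0 < κ i) (h : IsLabelling κ μ C) :
    turningValues m (lift κ μ) C = fun i => normValues κ μ i + (lift κ μ (C 1) - shift κ μ) := by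
  rw [h.normValues_eq_add hκ]
  funext i
  ring

lemma normValues_mem_V (hκ : ∀ i, 0 < κ i) (hμ : μ ∈ OrderedDelta κ) : normValues κ μ ∈ V κ := by
  obtain ⟨C, hC⟩ := hμ
  rw [hC.normValues_eq_add hκ]
  exact add_const_mem_V (hC.turningValues_mem_V hκ) _

lemma DeltaTau_subset : DeltaTau κ τ ⊆ OrderedDelta κ := fun _ ⟨C, hC, _⟩ => ⟨C, hC⟩

lemma mem_DeltaTau_iff (hκ : ∀ i, 0 < κ i) (hμ : μ ∈ OrderedDelta κ) :
    μ ∈ DeltaTau κ τ ↔ normValues κ μ ∈ typeSet κ τ := by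
  obtain ⟨C, hC⟩ := hμ
  rw [hC.mem_DeltaTau_iff hκ]
  constructor
  · intro h
    rw [hC.normValues_eq_add hκ]
    exact add_const_mem_typeSet h _
  · intro h
    rw [hC.turningValues_eq_add hκ]
    exact add_const_mem_typeSet h _

/-- Convergence of the normalized values thus controls the constant term of the lift, and thereby
`η_0`. -/
lemma IsLabelling.normValues_zero (hκ : ∀ i, 0 < κ i) (h : IsLabelling κ μ C) :
    normValues κ μ ⟨0, by have := h.alternates.m_pos; omega⟩ = shift κ μ := by
  rw [h.normValues_eq_add hκ]
  unfold turningValues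
  simp

lemma exists_normValues_local (hκ : ∀ i, 0 < κ i) (hμ : μ ∈ OrderedDelta κ) :
    ContDiffAt ℝ ∞ (normValues κ) μ ∧ ∃ L : (Fin (2 * m) → ℝ) ≃L[ℝ] (Fin (2 * m) → ℝ),
      HasFDerivAt (normValues κ) (L : (Fin (2 * m) → ℝ) →L[ℝ] (Fin (2 * m) → ℝ)) μ := by
  obtain ⟨C, hC⟩ := hμ
  obtain ⟨c, h1, h2, -, h4⟩ := hC.exists_curve hκ
  have heq : normValues κ =ᶠ[𝓝 μ] fun μ => mixedValues κ 1 μ (c μ) := by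
    filter_upwards [h4] with μ' hμ' using hμ'.normValues_eq hκ
  obtain ⟨L, hL⟩ := exists_hasFDerivAt_mixedValues hκ hC.one_lt_modulus hC.alternates h1 h2 1
  exact ⟨(contDiffAt_mixedValues hC.one_lt_modulus h1 1).congr_of_eventuallyEq heq,
    L, hL.congr_of_eventuallyEq heq⟩

/-! ### Translations of the parameters by integral angles -/

/-- Translations of the parameters that do not change the map. -/
def IsDeck (κ : Fin (m + 1) → ℕ) (a : Fin (2 * m) → ℝ) : Prop :=
  (∀ j, modulus a j = 0) ∧ ∃ n : Fin m → ℤ, (∀ j, angle a j = n j) ∧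
    coord a 0 = -∑ j : Fin m, (κ j.succ : ℝ) * (2 * n j)

variable {a : Fin (2 * m) → ℝ}

lemma IsDeck.neg (h : IsDeck κ a) : IsDeck κ (-a) := by
  obtain ⟨h1, n, h2, h3⟩ := h
  have e1 : -a = (-1 : ℝ) • a := by simp
  refine ⟨fun j => ?_, fun j => -n j, fun j => ?_, ?_⟩
  · rw [e1, modulus_smul, h1, mul_zero]
  · rw [e1, angle_smul, h2]; push_cast; ring
  · rw [e1, coord_smul, h3]
    push_cast
    rw [Finset.sum_congr rfl fun j _ => show (κ j.succ : ℝ) * (2 * -(n j : ℝ)) =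
      -(κ j.succ * (2 * n j)) by ring, Finset.sum_neg_distrib]
    ring

lemma IsDeck.modulus_add (h : IsDeck κ a) (j : Fin m) : modulus (μ + a) j = modulus μ j := by
  rw [BlaschkeMultimodal.modulus_add, h.1, add_zero]

lemma IsDeck.zero_add (h : IsDeck κ a) (j : Fin m) : zero (μ + a) j = zero μ j := by
  obtain ⟨h1, n, h2, h3⟩ := h
  unfold zero
  rw [BlaschkeMultimodal.modulus_add, h1, add_zero, angle_add, h2, e_add_int]

lemma IsDeck.pole_add (h : IsDeck κ a) : pole (μ + a) = pole μ :=
  funext fun j => by rw [pole_eq, pole_eq, h.zero_add]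

lemma IsDeck.shift_add (h : IsDeck κ a) : shift κ (μ + a) = shift κ μ := by
  obtain ⟨h1, n, h2, h3⟩ := h
  unfold shift
  rw [coord_add, h3, add_assoc, neg_add_eq_sub, ← Finset.sum_sub_distrib]
  congr 1
  refine Finset.sum_congr rfl fun j _ => ?_
  rw [angle_add, h2]; ring

lemma IsDeck.lift_add (h : IsDeck κ a) : lift κ (μ + a) = lift κ μ := by
  rw [lift_eq_genLift, lift_eq_genLift, h.shift_add, h.pole_add]

lemma IsDeck.blaschke_add (h : IsDeck κ a) (z : ℂ) : blaschke κ (μ + a) z = blaschke κ μ z := by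
  have h0 := h
  obtain ⟨h1, n, h2, h3⟩ := h
  unfold blaschke
  have : coord (μ + a) 0 = coord μ 0 + ((-∑ j : Fin m, (κ j.succ : ℤ) * (2 * n j) : ℤ) : ℝ) := by
    rw [coord_add, h3]; push_cast; rfl
  rw [this, e_add_int]
  simp only [h0.zero_add]

lemma IsDeck.isLabelling_add (h : IsDeck κ a) (hL : IsLabelling κ μ C) :
    IsLabelling κ (μ + a) C := by
  have ho : ∀ j, outerDisk κ (μ + a) j = outerDisk κ μ j := fun j => by
    unfold outerDisk; simp only [h.blaschke_add, h.zero_add]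
  refine ⟨fun j => by rw [h.modulus_add]; exact hL.one_lt_modulus j,
    by rw [h.lift_add]; exact hL.multimodal, fun j => ?_, fun j => ?_⟩
  · rw [ho]; exact hL.max_mem j
  · rw [ho]; exact hL.min_mem j

lemma IsDeck.mem_OrderedDelta (h : IsDeck κ a) (hμ : μ ∈ OrderedDelta κ) :
    μ + a ∈ OrderedDelta κ :=
  let ⟨C, hC⟩ := hμ
  ⟨C, h.isLabelling_add hC⟩

lemma IsDeck.normValues_add (hκ : ∀ i, 0 < κ i) (h : IsDeck κ a) (hμ : μ ∈ OrderedDelta κ) :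
    normValues κ (μ + a) = normValues κ μ := by
  obtain ⟨C, hC⟩ := hμ
  rw [hC.normValues_eq hκ, (h.isLabelling_add hC).normValues_eq hκ]
  unfold mixedValues
  rw [h.lift_add, h.shift_add]

/-- The angles can be reduced to a compact range while `η_0` compensates, so that the lift is
unchanged. -/
lemma exists_isDeck (hm : 0 < m) (κ : Fin (m + 1) → ℕ) (μ : Fin (2 * m) → ℝ) :
    ∃ a, IsDeck κ a ∧ ∀ j, angle (μ + a) j ∈ Icc (0 : ℝ) 1 := by
  have h0 : ∀ j : Fin m, (j : ℕ) = 0 → ((-⌊angle μ j⌋ : ℤ) : ℝ) = 0 := fun j hj => by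
    rw [angle_of_val_eq_zero μ hj]; simp
  refine ⟨mkParam (-∑ j : Fin m, (κ j.succ : ℝ) * (2 * ((-⌊angle μ j⌋ : ℤ) : ℝ))) (fun _ => 0)
    (fun j => ((-⌊angle μ j⌋ : ℤ) : ℝ)), ⟨fun j => modulus_mkParam _ _ _ j,
    fun j => -⌊angle μ j⌋, fun j => angle_mkParam _ _ _ h0 j, coord_mkParam hm _ _ _⟩, fun j => ?_⟩
  rw [angle_add, angle_mkParam _ _ _ h0]
  push_cast
  have h1 := Int.floor_le (angle μ j)
  have h2 := Int.lt_floor_add_one (angle μ j)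
  constructor <;> linarith

lemma IsLabelling.add_int (h : IsLabelling κ μ C) (n : ℤ) :
    IsLabelling κ μ (fun i => C i + n) := by
  have hA := h.alternates
  have e1 : (fun i => C i + n) = fun i => C (i + 2 * (m * n)) := funext fun i => by
    rw [← periodic_int hA.periodic]; congr 1; ring
  rw [e1]
  refine isLabelling_iff.2 ⟨h.one_lt_modulus, hA.comp_shift _, fun j => ?_⟩
  rw [touches_comp_shift]
  exact (touches_add hA.periodic n).2 (h.touches j)

/-! ### Compactness -/

/-- Limits of labelled turning points whose values converge to a point of `V`. -/
lemma alternates_of_tendsto {w : Fin m → ℂ} (hm : 0 < m) (hw : ∀ j, ‖w j‖ < 1)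
    {c : ℤ → ℝ} (hmono : Monotone c) (hp : ∀ i, c (i + 2 * m) = c i + 1)
    (hz : ∀ i, genDeriv (order κ) (degree κ) w (c i) = 0) {s : ℝ}
    (hv : turningValues m (genLift (order κ) (degree κ) s w) c ∈ V κ) :
    Alternates m (genDeriv (order κ) (degree κ) w) c := by
  set G := genLift (order κ) (degree κ) s w with hG
  have hder : ∀ x, HasDerivAt G (genDeriv (order κ) (degree κ) w x) x := hasDerivAt_genLift hw
  -- Limits of turning points are only weakly ordered. The strict inequalities of `V` separate the
  -- values, hence the points, and the mean value theorem gives derivatives of the required signs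
  -- between them.
  have hmvt : ∀ x y : ℝ, x ≤ y → G x ≠ G y → ∃ t ∈ Ioo x y,
      genDeriv (order κ) (degree κ) w t = (G y - G x) / (y - x) ∧ 0 < y - x := by
    intro x y hxy hne
    have hlt : x < y := lt_of_le_of_ne hxy fun h => hne (by rw [h])
    obtain ⟨t, ht, hs⟩ := exists_hasDerivAt_eq_slope G _ hlt
      (fun x _ => (hder x).continuousAt.continuousWithinAt) fun x _ => hder x
    exact ⟨t, ht, hs, sub_pos.2 hlt⟩
  obtain ⟨hv1, hv2, hv3⟩ := hv
  have hdown : ∀ j ∈ Finset.Ico (1 : ℤ) (1 + m), G (c (2 * j)) < G (c (2 * j - 1)) := by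
    intro j hj
    obtain ⟨h1, h2⟩ := Finset.mem_Ico.1 hj
    have := (hv2 ⟨(j - 1).toNat, by omega⟩).1
    unfold turningValues at this
    dsimp only at this
    rw [show ((2 * (j - 1).toNat : ℕ) : ℤ) + 1 = 2 * j - 1 by push_cast; omega,
      show ((2 * (j - 1).toNat + 1 : ℕ) : ℤ) + 1 = 2 * j by push_cast; omega] at this
    linarith
  have hup : ∀ j ∈ Finset.Ico (1 : ℤ) (1 + m), G (c (2 * j)) < G (c (2 * j + 1)) := by
    intro j hj
    obtain ⟨h1, h2⟩ := Finset.mem_Ico.1 hj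
    by_cases hlast : j = m
    · have := hv3 ⟨0, by omega⟩ ⟨2 * m - 1, by omega⟩ rfl (by dsimp only; omega)
      unfold turningValues at this
      dsimp only at this
      rw [show ((2 * m - 1 : ℕ) : ℤ) + 1 = 2 * m by omega, show ((0 : ℕ) : ℤ) + 1 = 1 by omega]
        at this
      rw [hlast, show 2 * (m : ℤ) + 1 = 1 + 2 * m by ring, hp, hG, genLift_add_one]
      exact this
    · have := hv1 ⟨(2 * j - 1).toNat, by omega⟩ ⟨(2 * j).toNat, by omega⟩ (by dsimp only; omega)
      unfold turningValues at this
      dsimp only at this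
      rw [show (((2 * j - 1).toNat : ℕ) : ℤ) + 1 = 2 * j by omega,
        show (((2 * j).toNat : ℕ) : ℤ) + 1 = 2 * j + 1 by omega,
        show (2 * j - 1).toNat + 1 = 2 * j.toNat by omega, pow_mul, neg_one_sq, one_pow] at this
      linarith
  refine alternates_of_periodic 1 hm hp (fun t n => genDeriv_add_int _ _ _ _ _) (fun i _ => hz i)
    (fun j hj => ?_) fun j hj => ?_
  · obtain ⟨t, ht, hs, hpos⟩ := hmvt (c (2 * j - 1)) (c (2 * j)) (hmono (by omega)) (hdown j hj).ne'
    exact ⟨t, ht, by rw [hs]; exact div_neg_of_neg_of_pos (sub_neg.2 (hdown j hj)) hpos⟩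
  · obtain ⟨t, ht, hs, hpos⟩ := hmvt (c (2 * j)) (c (2 * j + 1)) (hmono (by omega)) (hup j hj).ne
    exact ⟨t, ht, by rw [hs]; exact div_pos (sub_pos.2 (hup j hj)) hpos⟩

/-- Up to translations by integral angles, the normalized critical values are a proper map to
`V`. -/
lemma exists_convergent_subseq (hκ : ∀ i, 0 < κ i) {v : Fin (2 * m) → ℝ} (hv : v ∈ V κ)
    {μ : ℕ → Fin (2 * m) → ℝ} (hμ : ∀ n, μ n ∈ OrderedDelta κ)
    (hlim : Tendsto (fun n => normValues κ (μ n)) atTop (𝓝 v)) :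
    ∃ x ∈ OrderedDelta κ, ∃ (a : ℕ → Fin (2 * m) → ℝ) (φ : ℕ → ℕ), StrictMono φ ∧
      (∀ n, IsDeck κ (a n)) ∧ Tendsto (fun n => μ (φ n) + a n) atTop (𝓝 x) := by
  have hm : 0 < m := by
    obtain ⟨C, hC⟩ := hμ 0
    exact hC.alternates.m_pos
  have hm2 : (0 : ℤ) < 2 * m := by omega
  choose a ha hang using fun n => exists_isDeck hm κ (μ n)
  set ν : ℕ → Fin (2 * m) → ℝ := fun n => μ n + a n with hν
  have hνO : ∀ n, ν n ∈ OrderedDelta κ := fun n => (ha n).mem_OrderedDelta (hμ n)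
  have hνlim : Tendsto (fun n => normValues κ (ν n)) atTop (𝓝 v) := by
    refine hlim.congr fun n => ?_
    exact ((ha n).normValues_add hκ (hμ n)).symm
  have hlab : ∀ n, ∃ C, IsLabelling κ (ν n) C ∧ C 1 ∈ Ico (0 : ℝ) 1 := by
    intro n
    obtain ⟨C, hC⟩ := hνO n
    refine ⟨_, hC.add_int (-⌊C 1⌋), ?_⟩
    have h1 := Int.floor_le (C 1)
    have h2 := Int.lt_floor_add_one (C 1)
    push_cast
    constructor <;> linarith
  choose C hC hC1 using hlab
  -- As `v` lies in `V`, the drops eventually stay away from `k_j`, which keeps the zeros away from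
  -- the circle.
  have hmod : ∀ j, ∃ ε : ℝ, 0 < ε ∧ ∀ᶠ n in atTop, 1 + ε < modulus (ν n) j := by
    intro j
    have hdrop := (hv.2.1 j).2
    obtain ⟨ε, hε, hb⟩ := exists_modulus_bound (m := m) hκ
      (half_pos (sub_pos.2 hdrop))
    refine ⟨ε, hε, ?_⟩
    have h1 : Tendsto (fun n => normValues κ (ν n) ⟨2 * j, by omega⟩ -
        normValues κ (ν n) ⟨2 * j + 1, by omega⟩) atTop
        (𝓝 (v ⟨2 * j, by omega⟩ - v ⟨2 * j + 1, by omega⟩)) :=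
      (tendsto_pi_nhds.1 hνlim _).sub (tendsto_pi_nhds.1 hνlim _)
    filter_upwards [h1.eventually (gt_mem_nhds (show v ⟨2 * j, by omega⟩ - v ⟨2 * j + 1, by omega⟩ <
      κ j.succ - (κ j.succ - (v ⟨2 * j, by omega⟩ - v ⟨2 * j + 1, by omega⟩)) / 2 by linarith))]
      with n hn
    refine hb (ν n) (C n) (j + 1) j (hC n).one_lt_modulus (hC n).alternates ((hC n).touches j) ?_
    rw [(hC n).normValues_eq_add hκ] at hn
    unfold turningValues at hn
    push_cast at hn
    rw [show 2 * ((j : ℕ) : ℤ) + 1 + 1 = 2 * (j + 1) by ring,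
      show 2 * ((j : ℕ) : ℤ) + 1 = 2 * (j + 1) - 1 by ring] at hn
    linarith
  choose ε hε hmod using hmod
  -- a convergent subsequence
  have hcomp : IsCompact ((Icc 0 1 : Set (Fin m → ℝ)) ×ˢ ((Icc 0 1 : Set (Fin m → ℝ)) ×ˢ
      (Icc (-1) 2 : Set (Fin (2 * m) → ℝ)))) := isCompact_Icc.prod (isCompact_Icc.prod isCompact_Icc)
  obtain ⟨⟨q, η, b⟩, -, φ, hφ, hconv⟩ := hcomp.tendsto_subseq
    (x := fun n => ((fun j => (modulus (ν n) j)⁻¹), (fun j => angle (ν n) j),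
      fun i : Fin (2 * m) => C n (i : ℤ))) (fun n => by
      have h1 := (hC n).one_lt_modulus
      have hmono := (hC n).alternates.strictMono
      refine ⟨⟨fun j => ?_, fun j => ?_⟩, ⟨fun j => (hang n j).1, fun j => (hang n j).2⟩,
        fun i => ?_, fun i => ?_⟩
      · have := h1 j
        simp only [Pi.zero_apply]; positivity
      · exact inv_le_one_of_one_le₀ (h1 j).le
      · have h2 : C n 1 - 1 < C n (i : ℤ) := by
          have := sub_lt_of_periodic hmono (hC n).alternates.periodic (i := (i : ℤ)) (i' := 1)
            (by omega)
          linarith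
        simp only [Pi.neg_apply, Pi.one_apply]
        linarith [(hC1 n).1]
      · have h2 : C n (i : ℤ) < C n 1 + 1 :=
          sub_lt_of_periodic hmono (hC n).alternates.periodic (by omega)
        simp only [Pi.ofNat_apply]
        linarith [(hC1 n).2])
  have hq : ∀ j, Tendsto (fun n => (modulus (ν (φ n)) j)⁻¹) atTop (𝓝 (q j)) := fun j =>
    tendsto_pi_nhds.1 ((continuous_fst.tendsto _).comp hconv) j
  have hη : ∀ j, Tendsto (fun n => angle (ν (φ n)) j) atTop (𝓝 (η j)) := fun j =>
    tendsto_pi_nhds.1 (((continuous_fst.comp continuous_snd).tendsto _).comp hconv) j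
  have hb : ∀ i : Fin (2 * m), Tendsto (fun n => C (φ n) (i : ℤ)) atTop (𝓝 (b i)) := fun i =>
    tendsto_pi_nhds.1 (((continuous_snd.comp continuous_snd).tendsto _).comp hconv) i
  have hφt := hφ.tendsto_atTop
  have hq0 : ∀ j, 0 ≤ q j := fun j => ge_of_tendsto (hq j) (Eventually.of_forall fun n => by
    have := (hC (φ n)).one_lt_modulus j; positivity)
  have hq1 : ∀ j, q j < 1 := fun j => by
    have h1 : q j ≤ (1 + ε j)⁻¹ := le_of_tendsto (hq j) (by
      filter_upwards [hφt.eventually (hmod j)] with n hn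
      exact inv_anti₀ (by linarith [hε j]) hn.le)
    exact h1.trans_lt (inv_lt_one_of_one_lt₀ (by linarith [hε j]))
  have hc : ∀ i : ℤ, ∃ l, Tendsto (fun n => C (φ n) i) atTop (𝓝 l) := by
    intro i
    have h1 := Int.emod_nonneg i hm2.ne'
    have h2 := Int.emod_lt_of_pos i hm2
    refine ⟨_, ((hb ⟨(i % (2 * m)).toNat, by omega⟩).add_const ((i / (2 * m) : ℤ) : ℝ)).congr
      fun n => ?_⟩
    rw [← periodic_int (hC (φ n)).alternates.periodic]
    congr 1
    have := Int.emod_add_mul_ediv i (2 * m)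
    dsimp only
    omega
  choose c hc using hc
  have hmono : Monotone c := fun i i' hi => le_of_tendsto_of_tendsto' (hc i) (hc i') fun n =>
    (hC (φ n)).alternates.strictMono.monotone hi
  have hper : ∀ i, c (i + 2 * m) = c i + 1 := fun i =>
    tendsto_nhds_unique (hc _) (((hc i).add_const 1).congr fun n =>
      ((hC (φ n)).alternates.periodic i).symm)
  set w : Fin m → ℂ := fun j => (q j : ℝ) * e (η j) with hw
  have hwlim : Tendsto (fun n => pole (ν (φ n))) atTop (𝓝 w) := by
    refine tendsto_pi_nhds.2 fun j => ?_
    unfold pole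
    exact ((Complex.continuous_ofReal.tendsto _).comp (hq j)).mul
      ((continuous_e.tendsto _).comp (hη j))
  have hw1 : ∀ j, ‖w j‖ < 1 := fun j => by
    rw [hw]
    dsimp only
    rw [norm_mul, norm_e, mul_one, Complex.norm_real, Real.norm_of_nonneg (hq0 j)]
    exact hq1 j
  have hz : ∀ i, genDeriv (order κ) (degree κ) w (c i) = 0 := by
    intro i
    have h1 := ((contDiffAt_genDeriv (k := order κ) (D := degree κ) (n := 0) (p := (w, c i))
      hw1).continuousAt.tendsto).comp (hwlim.prodMk_nhds (hc i))
    refine tendsto_nhds_unique h1 (tendsto_const_nhds.congr fun n => ?_)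
    exact ((hC (φ n)).alternates.zero i).symm
  have hNlim := hνlim.comp hφt
  set s := v ⟨0, by omega⟩ with hs
  have hslim : Tendsto (fun n => shift κ (ν (φ n))) atTop (𝓝 s) := by
    refine (tendsto_pi_nhds.1 hNlim ⟨0, by omega⟩).congr fun n => ?_
    exact (hC (φ n)).normValues_zero hκ
  have hFlim : ∀ i, Tendsto (fun n => lift κ (ν (φ n)) (C (φ n) i)) atTop
      (𝓝 (genLift (order κ) (degree κ) s w (c i))) := by
    intro i
    have h1 := ((contDiffAt_genLift (k := order κ) (D := degree κ) (n := 0) (p := (s, w, c i))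
      hw1).continuousAt.tendsto).comp (hslim.prodMk_nhds (hwlim.prodMk_nhds (hc i)))
    refine h1.congr fun n => ?_
    rw [lift_eq_genLift]; rfl
  have hvals : turningValues m (genLift (order κ) (degree κ) s w) c ∈ V κ := by
    have h1 : v = fun i => turningValues m (genLift (order κ) (degree κ) s w) c i +
        (s - genLift (order κ) (degree κ) s w (c 1)) := by
      refine tendsto_nhds_unique hNlim (tendsto_pi_nhds.2 fun i => ?_)
      refine ((hFlim ((i : ℤ) + 1)).add (hslim.sub (hFlim 1))).congr fun n => ?_
      simp only [Function.comp]
      rw [(hC (φ n)).normValues_eq_add hκ]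
      rfl
    have h2 := add_const_mem_V hv (-(s - genLift (order κ) (degree κ) s w (c 1)))
    rw [h1] at h2
    convert h2 using 1
    funext i
    ring
  have hA := alternates_of_tendsto hm hw1 hmono hper hz hvals
  -- A vanishing limit pole would leave too few poles for `2m` turning points. So no modulus tends
  -- to infinity.
  have hqne : ∀ j, q j ≠ 0 := fun j h0 => (hA.injective_pole hw1).2 j (by
    simp only [hw]; rw [h0]; simp)
  have hη0 : ∀ j : Fin m, (j : ℕ) = 0 → η j = 0 := fun j hj =>
    tendsto_nhds_unique (hη j) (tendsto_const_nhds.congr fun n => (angle_of_val_eq_zero _ hj).symm)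
  set x : Fin (2 * m) → ℝ := mkParam (s - ∑ j : Fin m, (κ j.succ : ℝ) * (2 * η j + 1))
    (fun j => (q j)⁻¹) η with hx
  have hxm : ∀ j, modulus x j = (q j)⁻¹ := fun j => modulus_mkParam _ _ _ j
  have hxa : ∀ j, angle x j = η j := fun j => angle_mkParam _ _ _ hη0 j
  have hlimx : Tendsto (fun n => ν (φ n)) atTop (𝓝 x) := by
    refine tendsto_pi_nhds.2 fun i => ?_
    rcases coord_cases i with h | ⟨j, h⟩ | ⟨j, h⟩
    · rw [h x, coord_mkParam hm]
      refine (hslim.sub (tendsto_finsetSum _ fun j _ =>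
        (((hη j).const_mul 2).add_const 1).const_mul (κ j.succ : ℝ))).congr fun n => ?_
      rw [h (ν (φ n))]
      unfold shift
      ring
    · rw [h x, hxm]
      refine ((hq j).inv₀ (hqne j)).congr fun n => ?_
      rw [inv_inv, h (ν (φ n))]
    · rw [h x, hxa]
      refine (hη j).congr fun n => ?_
      rw [h (ν (φ n))]
  have hx1 : ∀ j, 1 < modulus x j := fun j => by
    rw [hxm]
    exact (one_lt_inv₀ (lt_of_le_of_ne (hq0 j) (hqne j).symm)).2 (hq1 j)
  have hpx : pole x = w := funext fun j => by
    unfold pole; rw [hxm, hxa, inv_inv]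
  have hxD : x ∈ Delta κ := by
    refine ⟨hx1, c, ?_⟩
    rw [lift_eq_genLift, hpx]
    exact hA.isMultimodalLift hw1
  refine ⟨x, ?_, fun n => a (φ n), φ, hφ, fun n => ha _, hlimx⟩
  -- The limit is in `Delta`, and `OrderedDelta` is closed there.
  by_contra hxO
  obtain ⟨n, hn⟩ := (hlimx.eventually (eventually_not_mem_OrderedDelta hκ hxD hxO)).exists
  exact hn (hνO _)

end normalized


/-! ### Sections of local homeomorphisms over convex sets -/

section sections
open scoped unitInterval

variable {X E : Type*} [TopologicalSpace X]

/-- Paths can be lifted if there are local sections through all points of the fibres. -/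
lemma exists_path_lift [TopologicalSpace E] {p : X → E} {V : Set E}
    (huls : ∀ v ∈ V, ∃ U ∈ 𝓝 v, ∀ x, p x ∈ U → ∃ s : E → X, ContinuousOn s U ∧
      (∀ u ∈ U, p (s u) = u) ∧ s (p x) = x)
    (γ : C(I, E)) (hγ : ∀ t, γ t ∈ V) {x : X}
    (hx : p x = γ 0) : ∃ Γ : C(I, X), (∀ t, p (Γ t) = γ t) ∧ Γ 0 = x := by
  choose! U hU S using huls
  -- The path is subdivided so that each piece stays in one neighbourhood with sections; the lift is
  -- continued by a section through its last point.
  obtain ⟨t, t_0, t_mono, ⟨n_max, h_max⟩, t_sub⟩ :=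
    exists_monotone_Icc_subset_open_cover_unitInterval
      (c := fun v : V => γ ⁻¹' interior (U v)) (fun v => isOpen_interior.preimage γ.continuous)
      fun t _ => mem_iUnion.2 ⟨⟨γ t, hγ t⟩, mem_interior_iff_mem_nhds.2 (hU _ (hγ t))⟩
  suffices ∀ n, ∃ Γ : I → X, ContinuousOn Γ (Icc 0 (t n)) ∧
      (∀ s ∈ Icc 0 (t n), p (Γ s) = γ s) ∧ Γ 0 = x by
    obtain ⟨Γ, cont, eqOn, Γ_0⟩ := this n_max
    rw [h_max _ le_rfl] at cont eqOn
    have huniv : (Icc 0 1 : Set I) = univ := eq_univ_of_forall fun t => ⟨bot_le, le_top⟩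
    rw [huniv] at cont eqOn
    exact ⟨⟨Γ, continuousOn_univ.1 cont⟩, fun t => eqOn t (mem_univ t), Γ_0⟩
  intro n
  induction n with
  | zero =>
    refine ⟨fun _ => x, continuous_const.continuousOn, fun t ht => ?_, rfl⟩
    rw [t_0, Icc_self, mem_singleton_iff] at ht
    rw [ht, hx]
  | succ n ih =>
    obtain ⟨Γ, cont, eqOn, Γ_0⟩ := ih
    obtain ⟨v, t_sub⟩ := t_sub n
    have hsub : ∀ s ∈ Icc (t n) (t (n + 1)), γ s ∈ U v := fun s hs => interior_subset (t_sub hs)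
    have hpn : p (Γ (t n)) = γ (t n) := eqOn _ ⟨t_0 ▸ t_mono n.zero_le, le_rfl⟩
    obtain ⟨s, hs1, hs2, hs3⟩ := S v v.2 (Γ (t n))
      (hpn ▸ hsub _ ⟨le_rfl, t_mono n.le_succ⟩)
    refine ⟨fun r => if r ≤ t n then Γ r else s (γ r), .if (fun r hr => ?_)
      (cont.mono fun r hr => ?_) ?_, fun r hr => ?_, ?_⟩
    · cases frontier_Iic_subset _ hr.2
      rw [← hpn, hs3]
    · rw [closure_le_eq continuous_id' continuous_const] at hr
      exact ⟨hr.1.1, hr.2⟩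
    · refine hs1.comp γ.continuous.continuousOn fun r hr => ?_
      simp_rw [not_le] at hr
      exact hsub _ ⟨closure_lt_subset_le continuous_const continuous_subtype_val hr.2, hr.1.2⟩
    · dsimp only
      split_ifs with h
      exacts [eqOn r ⟨hr.1, h⟩, hs2 _ (hsub r ⟨le_of_not_ge h, hr.2⟩)]
    · dsimp only
      rwa [if_pos (t_0 ▸ t_mono n.zero_le)]

variable [NormedAddCommGroup E] [NormedSpace ℝ E]

/-- A local homeomorphism to a convex set with uniform local sections has a section through every
point. -/
lemma exists_section [T2Space X] {p : X → E} {V : Set E} (hp : IsLocalHomeomorph p)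
    (hV : Convex ℝ V) (hpV : ∀ x, p x ∈ V)
    (huls : ∀ v ∈ V, ∃ U ∈ 𝓝 v, ∀ x, p x ∈ U → ∃ s : E → X, ContinuousOn s U ∧
      (∀ u ∈ U, p (s u) = u) ∧ s (p x) = x) (x₀ : X) :
    ∃ ψ : E → X, ContinuousOn ψ V ∧ (∀ v ∈ V, p (ψ v) = v) ∧ ψ (p x₀) = x₀ := by
  classical
  -- The segments from `p x₀` to the points of `V` are lifted from `x₀`, and the section is the end
  -- point of the lift. Joint continuity follows from that of the initial points, because `p` is a
  -- separated local homeomorphism.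
  set f : C(I × V, E) := ⟨fun q => p x₀ + (q.1 : ℝ) • ((q.2 : E) - p x₀), by fun_prop⟩ with hf
  have hfV : ∀ q, f q ∈ V := fun q => by
    have := hV.add_smul_sub_mem (hpV x₀) q.2.2 ⟨q.1.2.1, q.1.2.2⟩
    exact this
  have hsep : IsSeparatedMap p := T2Space.isSeparatedMap p
  choose Γ hΓ hΓ0 using fun a : V => exists_path_lift huls
    (f.comp ((ContinuousMap.id I).prodMk (.const I a))) (fun t => hfV (t, a)) (x := x₀)
    (by simp [hf])
  have hg : Continuous fun q : I × V => Γ q.2 q.1 := by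
    refine hp.continuous_lift hsep f (funext fun q => hΓ q.2 q.1) ?_ fun a => (Γ a).continuous
    simp only [hΓ0]
    exact continuous_const
  have h1 : ∀ a : V, p (Γ a 1) = a := fun a => by
    rw [hΓ a 1]; simp [hf]
  refine ⟨fun v => if h : v ∈ V then Γ ⟨v, h⟩ 1 else x₀, ?_, fun v hv => ?_, ?_⟩
  · rw [continuousOn_iff_continuous_domRestrict]
    refine (hg.comp (Continuous.prodMk_right (1 : I))).congr fun a => ?_
    simp
  · simp only [dif_pos hv]; exact h1 ⟨v, hv⟩
  · simp only [dif_pos (hpV x₀)]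
    refine Eq.trans ?_ (hΓ0 ⟨p x₀, hpV x₀⟩)
    refine hsep.const_of_comp hp.isLocallyInjective (Γ ⟨p x₀, hpV x₀⟩).continuous
      (fun t t' => ?_) 1 0
    rw [hΓ, hΓ]; simp [hf]

lemma connectedComponentIn_eq_of_clopen {Y : Type*} [TopologicalSpace Y] {S K : Set Y}
    (hK : IsPreconnected K) (hKS : K ⊆ S) {x : Y} (hx : x ∈ K)
    (hopen : ∀ y ∈ K, ∀ᶠ z in 𝓝[S] y, z ∈ K) (hclosed : ∀ y ∈ S, y ∉ K → ∀ᶠ z in 𝓝[S] y, z ∉ K) :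
    connectedComponentIn S x = K := by
  refine Subset.antisymm (fun y hy => ?_) (hK.subset_connectedComponentIn hx hKS)
  have hsub := connectedComponentIn_subset S x
  have := isPreconnected_connectedComponentIn.induction₂ (fun y z => y ∈ K ↔ z ∈ K)
    (fun y hy => ?_) (fun x y z _ _ _ h1 h2 => h1.trans h2) (fun x y _ _ h => h.symm)
    (mem_connectedComponentIn (hKS hx)) hy
  · exact this.1 hx
  · by_cases hyK : y ∈ K
    · filter_upwards [nhdsWithin_mono y hsub (hopen y hyK)] with z hz
      exact ⟨fun _ => hz, fun _ => hyK⟩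
    · filter_upwards [nhdsWithin_mono y hsub (hclosed y (hsub hy) hyK)] with z hz
      exact ⟨fun h => absurd h hyK, fun h => absurd h hz⟩

lemma simplyConnectedSpace_image {F : Type*} [TopologicalSpace F] {A : Set E} (hA : Convex ℝ A)
    (hne : A.Nonempty) {ψ : E → F} {q : F → E} (hψ : ContinuousOn ψ A)
    (hq : ContinuousOn q (ψ '' A)) (hqψ : ∀ v ∈ A, q (ψ v) = v) : SimplyConnectedSpace ↥(ψ '' A) := by
  have hmem : ∀ y : ↥(ψ '' A), q y ∈ A := by
    rintro ⟨_, v, hv, rfl⟩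
    rw [hqψ v hv]; exact hv
  let e : A ≃ₜ ↥(ψ '' A) :=
    { toFun := fun v => ⟨ψ v, mem_image_of_mem ψ v.2⟩
      invFun := fun y => ⟨q y, hmem y⟩
      left_inv := fun v => Subtype.ext (hqψ v v.2)
      right_inv := by
        rintro ⟨_, v, hv, rfl⟩
        exact Subtype.ext (congrArg ψ (hqψ v hv))
      continuous_toFun := (continuousOn_iff_continuous_domRestrict.1 hψ).subtype_mk _
      continuous_invFun := (continuousOn_iff_continuous_domRestrict.1 hq).subtype_mk _ }
  have := hA.contractibleSpace hne
  have := e.symm.contractibleSpace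
  infer_instance

end sections

/-! ### Sections of the normalized critical values -/

section ordered
variable {m : ℕ} {κ : Fin (m + 1) → ℕ} {τ : Fin (2 * m - 1) → ℤ} {μ₀ : Fin (2 * m) → ℝ}

lemma continuousOn_normValues (hκ : ∀ i, 0 < κ i) : ContinuousOn (normValues κ) (OrderedDelta κ) :=
  fun _ hμ => (exists_normValues_local hκ hμ).1.continuousAt.continuousWithinAt

lemma exists_openPartialHomeomorph (hκ : ∀ i, 0 < κ i) (hμ : μ₀ ∈ OrderedDelta κ) :
    ∃ Φ : OpenPartialHomeomorph (Fin (2 * m) → ℝ) (Fin (2 * m) → ℝ), μ₀ ∈ Φ.source ∧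
      Φ.source ⊆ OrderedDelta κ ∧ ∀ μ, Φ μ = normValues κ μ := by
  obtain ⟨h1, L, hL⟩ := exists_normValues_local hκ hμ
  refine ⟨(h1.toOpenPartialHomeomorph _ hL (by simp)).restrOpen _ (isOpen_OrderedDelta hκ),
    ⟨h1.mem_toOpenPartialHomeomorph_source hL (by simp), hμ⟩, inter_subset_right, fun μ => rfl⟩

lemma isLocalHomeomorph_normValues (hκ : ∀ i, 0 < κ i) :
    IsLocalHomeomorph fun μ : OrderedDelta κ => normValues κ μ := by
  rw [isLocalHomeomorph_iff_isLocalHomeomorphOn_univ]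
  have h1 : IsLocalHomeomorphOn (normValues κ) (OrderedDelta κ) := by
    refine IsLocalHomeomorphOn.mk _ _ fun μ hμ => ?_
    obtain ⟨Φ, h2, -, h4⟩ := exists_openPartialHomeomorph hκ hμ
    exact ⟨Φ, h2, fun x _ => (h4 x).symm⟩
  refine h1.comp (f := Subtype.val) (s := univ) ?_ fun μ _ => μ.2
  exact ((isOpen_OrderedDelta hκ).isOpenEmbedding_subtypeVal.isLocalHomeomorph).isLocalHomeomorphOn.mono
    (subset_univ _)

/-- Near a point of `V`, there are sections through all points of the fibres, over a neighbourhood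
that does not depend on the point of the fibre. -/
lemma exists_uniform_section (hκ : ∀ i, 0 < κ i) {v : Fin (2 * m) → ℝ} (hv : v ∈ V κ) :
    ∃ U ∈ 𝓝 v, ∀ μ ∈ OrderedDelta κ, normValues κ μ ∈ U → ∃ s : (Fin (2 * m) → ℝ) →
      (Fin (2 * m) → ℝ), ContinuousOn s U ∧ (∀ u ∈ U, s u ∈ OrderedDelta κ ∧
        normValues κ (s u) = u) ∧ s (normValues κ μ) = μ := by
  -- If the balls of radius `1 / (n + 1)` all failed, at points `μ n`, a subsequence would converge
  -- after deck translations to a point above `v`. The local inverse there, translated back, is a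
  -- section through `μ n` over a small ball.
  by_contra hne
  push Not at hne
  have hpos : ∀ n : ℕ, (0 : ℝ) < 1 / (n + 1) := fun n => Nat.one_div_pos_of_nat
  choose μ hμ hμv hs using fun n : ℕ => hne _ (Metric.ball_mem_nhds v (hpos n))
  have hlim : Tendsto (fun n => normValues κ (μ n)) atTop (𝓝 v) := by
    rw [tendsto_iff_dist_tendsto_zero]
    exact squeeze_zero (fun _ => dist_nonneg) (fun n => (hμv n).le)
      tendsto_one_div_add_atTop_nhds_zero_nat
  obtain ⟨x, hx, a, φ, hφ, ha, hconv⟩ := exists_convergent_subseq hκ hv hμ hlim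
  obtain ⟨Φ, h1, h2, h3⟩ := exists_openPartialHomeomorph hκ hx
  have hxv : normValues κ x = v := by
    refine tendsto_nhds_unique
      (((exists_normValues_local hκ hx).1.continuousAt.tendsto).comp hconv)
      ((hlim.comp hφ.tendsto_atTop).congr fun n => ?_)
    exact ((ha n).normValues_add hκ (hμ _)).symm
  have hvt : Φ.target ∈ 𝓝 v := by
    rw [← hxv, ← h3]
    exact Φ.open_target.mem_nhds (Φ.map_source h1)
  obtain ⟨ρ, hρ, hball⟩ := Metric.mem_nhds_iff.1 hvt
  obtain ⟨n, hn1, hn2⟩ := ((hconv.eventually (Φ.open_source.mem_nhds h1)).and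
    ((tendsto_one_div_add_atTop_nhds_zero_nat (𝕜 := ℝ)).comp hφ.tendsto_atTop |>.eventually
      (gt_mem_nhds hρ))).exists
  have hsub : Metric.ball v (1 / ((φ n : ℝ) + 1)) ⊆ Φ.target :=
    (Metric.ball_subset_ball hn2.le).trans hball
  refine hs (φ n) (fun u => Φ.symm u + -a n) ?_ (fun u hu => ?_) ?_
  · exact (Φ.continuousOn_symm.mono hsub).add continuousOn_const
  · have h4 := h2 (Φ.map_target (hsub hu))
    refine ⟨(ha n).neg.mem_OrderedDelta h4, ?_⟩
    rw [(ha n).neg.normValues_add hκ h4, ← h3, Φ.right_inv (hsub hu)]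
  · rw [← (ha n).normValues_add hκ (hμ _), ← h3, Φ.left_inv hn1, add_neg_cancel_right]

lemma exists_normValues_section (hκ : ∀ i, 0 < κ i) (hμ : μ₀ ∈ OrderedDelta κ) :
    ∃ σ : (Fin (2 * m) → ℝ) → (Fin (2 * m) → ℝ), ContinuousOn σ (V κ) ∧
      (∀ v ∈ V κ, σ v ∈ OrderedDelta κ ∧ normValues κ (σ v) = v) ∧ σ (normValues κ μ₀) = μ₀ := by
  classical
  have huls : ∀ v ∈ V κ, ∃ U ∈ 𝓝 v, ∀ x : OrderedDelta κ, normValues κ x ∈ U →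
      ∃ s : (Fin (2 * m) → ℝ) → OrderedDelta κ, ContinuousOn s U ∧
      (∀ u ∈ U, normValues κ (s u) = u) ∧ s (normValues κ x) = x := by
    intro v hv
    obtain ⟨U, hU, hs⟩ := exists_uniform_section hκ hv
    refine ⟨U, hU, fun x hx => ?_⟩
    obtain ⟨s, h1, h2, h3⟩ := hs x x.2 hx
    refine ⟨fun u => if h : s u ∈ OrderedDelta κ then ⟨s u, h⟩ else x, ?_, fun u hu => ?_, ?_⟩
    · rw [IsInducing.subtypeVal.continuousOn_iff]
      refine h1.congr fun u hu => ?_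
      simp only [Function.comp]
      rw [dif_pos (h2 u hu).1]
    · simp only [dif_pos (h2 u hu).1]; exact (h2 u hu).2
    · have : s (normValues κ x) ∈ OrderedDelta κ := by rw [h3]; exact x.2
      simp only [dif_pos this]; exact Subtype.ext h3
  obtain ⟨σ, h1, h2, h3⟩ := exists_section (V := V κ) (isLocalHomeomorph_normValues hκ) convex_V
    (fun μ => normValues_mem_V hκ μ.2) huls ⟨μ₀, hμ⟩
  exact ⟨fun v => σ v, continuous_subtype_val.comp_continuousOn h1,
    fun v hv => ⟨(σ v).2, h2 v hv⟩, congrArg Subtype.val h3⟩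

end ordered


/-! ### The components -/

section components
variable {m : ℕ} {κ : Fin (m + 1) → ℕ} {τ : Fin (2 * m - 1) → ℤ} {μ₀ : Fin (2 * m) → ℝ}

/-- `ψ` is a continuous section over `V` of the normalized critical values. -/
structure IsNormSection (κ : Fin (m + 1) → ℕ) (ψ : (Fin (2 * m) → ℝ) → Fin (2 * m) → ℝ) :
    Prop where
  continuousOn : ContinuousOn ψ (V κ)
  mem : ∀ v ∈ V κ, ψ v ∈ OrderedDelta κ
  apply_eq : ∀ v ∈ V κ, normValues κ (ψ v) = v

variable {ψ : (Fin (2 * m) → ℝ) → Fin (2 * m) → ℝ}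

lemma IsNormSection.mem_image_iff (h : IsNormSection κ ψ)
    {A : Set (Fin (2 * m) → ℝ)} (hA : A ⊆ V κ) {μ : Fin (2 * m) → ℝ} (hμ : μ ∈ OrderedDelta κ) :
    μ ∈ ψ '' A ↔ normValues κ μ ∈ A ∧
      ψ (normValues κ μ) = μ := by
  constructor
  · rintro ⟨v, hv, rfl⟩
    rw [h.apply_eq v (hA hv)]
    exact ⟨hv, rfl⟩
  · rintro ⟨h1, h2⟩
    exact ⟨_, h1, h2⟩

lemma IsNormSection.continuousAt (hκ : ∀ i, 0 < κ i) (h : IsNormSection κ ψ)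
    (hμ : μ₀ ∈ OrderedDelta κ) :
    ContinuousAt (fun μ => ψ (normValues κ μ)) μ₀ :=
  (h.continuousOn.continuousAt (isOpen_V.mem_nhds (normValues_mem_V hκ hμ))).comp
    (exists_normValues_local hκ hμ).1.continuousAt

/-- Near a point of the image, `ψ (normValues κ μ)` is close to `μ` and has the same normalized
values, so local injectivity makes the two equal. -/
lemma IsNormSection.isOpen_image (hκ : ∀ i, 0 < κ i) (h : IsNormSection κ ψ) :
    IsOpen (ψ '' V κ) := by
  rw [isOpen_iff_mem_nhds]
  rintro _ ⟨v, hv, rfl⟩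
  have hμ := h.mem v hv
  obtain ⟨Φ, h1, h2, h3⟩ := exists_openPartialHomeomorph hκ hμ
  have h4 := h.continuousAt hκ hμ
  have h5 : ψ (normValues κ (ψ v)) = ψ v := by rw [h.apply_eq v hv]
  have h6 : Φ.source ∈ 𝓝 (ψ (normValues κ (ψ v))) := by
    rw [h5]; exact Φ.open_source.mem_nhds h1
  filter_upwards [Φ.open_source.mem_nhds h1, h4.preimage_mem_nhds h6] with μ h7 h8
  have hμV := normValues_mem_V hκ (h2 h7)
  refine (h.mem_image_iff Subset.rfl (h2 h7)).2 ⟨hμV, Φ.injOn h8 h7 ?_⟩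
  rw [h3, h3, h.apply_eq _ hμV]

/-- Within `OrderedDelta` the image consists of the fixed points of `ψ ∘ normValues`, a closed
condition, and `OrderedDelta` is itself closed in `Delta`. -/
lemma IsNormSection.eventually_not_mem_image (hκ : ∀ i, 0 < κ i) (h : IsNormSection κ ψ)
    (hμ : μ₀ ∈ Delta κ) (hμ' : μ₀ ∉ ψ '' V κ) : ∀ᶠ μ in 𝓝 μ₀, μ ∉ ψ '' V κ := by
  by_cases hO : μ₀ ∈ OrderedDelta κ
  · have h1 : ψ (normValues κ μ₀) ≠ μ₀ := fun h2 =>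
      hμ' ((h.mem_image_iff Subset.rfl hO).2 ⟨normValues_mem_V hκ hO, h2⟩)
    filter_upwards [((h.continuousAt hκ hO).ne_iff_eventually_ne continuousAt_id).1 h1,
      (isOpen_OrderedDelta hκ).mem_nhds hO] with μ h2 h3 h4
    exact h2 ((h.mem_image_iff Subset.rfl h3).1 h4).2
  · filter_upwards [eventually_not_mem_OrderedDelta hκ hμ hO] with μ h1
    rintro ⟨v, hv, rfl⟩
    exact h1 (h.mem v hv)

lemma typeSet_subset : typeSet κ τ ⊆ V κ := fun _ h => h.1

lemma IsNormSection.image_inter_DeltaTau (hκ : ∀ i, 0 < κ i) (h : IsNormSection κ ψ) :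
    DeltaTau κ τ ∩ ψ '' V κ = ψ '' typeSet κ τ := by
  ext μ
  constructor
  · rintro ⟨h1, v, hv, rfl⟩
    rw [mem_DeltaTau_iff hκ (h.mem v hv), h.apply_eq v hv] at h1
    exact ⟨v, h1, rfl⟩
  · rintro ⟨v, hv, rfl⟩
    have hvV := typeSet_subset hv
    refine ⟨?_, v, hvV, rfl⟩
    rwa [mem_DeltaTau_iff hκ (h.mem v hvV), h.apply_eq v hvV]

/-- The image of the connected set `V` is open and closed in `Delta`, so it is a whole component. -/
lemma IsNormSection.component_Delta (hκ : ∀ i, 0 < κ i) (h : IsNormSection κ ψ)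
    (hμ : μ₀ ∈ ψ '' V κ) : connectedComponentIn (Delta κ) μ₀ = ψ '' V κ :=
  connectedComponentIn_eq_of_clopen (convex_V.isPreconnected.image ψ h.continuousOn)
    (image_subset_iff.2 fun v hv => mem_preimage.2 (OrderedDelta_subset (h.mem v hv))) hμ
    (fun _ hy => nhdsWithin_le_nhds ((h.isOpen_image hκ).mem_nhds hy))
    fun _ hy hy' => nhdsWithin_le_nhds (h.eventually_not_mem_image hκ hy hy')

lemma IsNormSection.component_OrderedDelta (hκ : ∀ i, 0 < κ i) (h : IsNormSection κ ψ)
    (hμ : μ₀ ∈ ψ '' V κ) : connectedComponentIn (OrderedDelta κ) μ₀ = ψ '' V κ :=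
  connectedComponentIn_eq_of_clopen (convex_V.isPreconnected.image ψ h.continuousOn)
    (image_subset_iff.2 fun v hv => mem_preimage.2 (h.mem v hv)) hμ
    (fun _ hy => nhdsWithin_le_nhds ((h.isOpen_image hκ).mem_nhds hy))
    fun _ hy hy' => nhdsWithin_le_nhds
      (h.eventually_not_mem_image hκ (OrderedDelta_subset hy) hy')

lemma IsNormSection.component_DeltaTau (hκ : ∀ i, 0 < κ i) (h : IsNormSection κ ψ)
    (hμ : μ₀ ∈ ψ '' typeSet κ τ) : connectedComponentIn (DeltaTau κ τ) μ₀ = ψ '' typeSet κ τ := by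
  refine connectedComponentIn_eq_of_clopen
    (convex_typeSet.isPreconnected.image ψ (h.continuousOn.mono typeSet_subset))
    (by rw [← h.image_inter_DeltaTau hκ]; exact inter_subset_left) hμ (fun y hy => ?_)
    fun y hy hy' => ?_
  · filter_upwards [nhdsWithin_le_nhds ((h.isOpen_image hκ).mem_nhds
      (image_mono typeSet_subset hy)), self_mem_nhdsWithin] with μ h1 h2
    rw [← h.image_inter_DeltaTau hκ]
    exact ⟨h2, h1⟩
  · have h1 : y ∉ ψ '' V κ := fun h1 => hy' (by
      rw [← h.image_inter_DeltaTau hκ]; exact ⟨hy, h1⟩)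
    filter_upwards [nhdsWithin_le_nhds (h.eventually_not_mem_image hκ
      (OrderedDelta_subset (DeltaTau_subset hy)) h1)] with μ h2 h3
    exact h2 (image_mono typeSet_subset h3)

lemma IsNormSection.simplyConnectedSpace (hκ : ∀ i, 0 < κ i) (h : IsNormSection κ ψ)
    (hne : (typeSet κ τ).Nonempty) : SimplyConnectedSpace ↥(ψ '' typeSet κ τ) :=
  simplyConnectedSpace_image convex_typeSet hne (h.continuousOn.mono typeSet_subset)
    ((continuousOn_normValues hκ).mono (image_subset_iff.2 fun v hv =>
      h.mem v (typeSet_subset hv))) fun v hv => h.apply_eq v (typeSet_subset hv)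

lemma exists_isNormSection (hκ : ∀ i, 0 < κ i) (hμ : μ₀ ∈ OrderedDelta κ) :
    ∃ ψ, IsNormSection κ ψ ∧ ψ (normValues κ μ₀) = μ₀ := by
  obtain ⟨ψ, h1, h2, h3⟩ := exists_normValues_section hκ hμ
  exact ⟨ψ, ⟨h1, fun v hv => (h2 v hv).1, fun v hv => (h2 v hv).2⟩, h3⟩

/-! ### Continuous choices of the turning points -/

open Classical in
/-- The turning point `C 1`, as a point of the circle. -/
noncomputable def turningPoint (κ : Fin (m + 1) → ℕ) (μ : Fin (2 * m) → ℝ) : AddCircle (1 : ℝ) :=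
  if h : μ ∈ OrderedDelta κ then ((h.choose 1 : ℝ) : AddCircle (1 : ℝ)) else 0

lemma coe_add_int (t : ℝ) (n : ℤ) : ((t + n : ℝ) : AddCircle (1 : ℝ)) = t := by
  rw [AddCircle.coe_add, add_eq_left]
  exact AddCircle.coe_eq_zero_iff (1 : ℝ) |>.2 ⟨n, by simp⟩

variable {μ : Fin (2 * m) → ℝ} {C : ℤ → ℝ}

lemma IsLabelling.turningPoint_eq (hκ : ∀ i, 0 < κ i) (h : IsLabelling κ μ C) :
    turningPoint κ μ = (C 1 : ℝ) := by
  have hμ : μ ∈ OrderedDelta κ := ⟨C, h⟩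
  obtain ⟨n, hn⟩ := h.eq_add_int hκ hμ.choose_spec
  unfold turningPoint
  rw [dif_pos hμ, hn, coe_add_int]

lemma IsLabelling.exists_of_turningPoint (hκ : ∀ i, 0 < κ i) (h : IsLabelling κ μ C) {t : ℝ}
    (ht : turningPoint κ μ = (t : ℝ)) : IsLabelling κ μ fun i => C i + (t - C 1) := by
  rw [h.turningPoint_eq hκ, eq_comm, ← sub_eq_zero, ← AddCircle.coe_sub,
    AddCircle.coe_eq_zero_iff] at ht
  obtain ⟨n, hn⟩ := ht
  have h1 := h.add_int n
  simp only [zsmul_eq_mul, mul_one] at hn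
  rwa [hn] at h1

lemma continuousAt_turningPoint (hκ : ∀ i, 0 < κ i) (hμ : μ ∈ OrderedDelta κ) :
    ContinuousAt (turningPoint κ) μ := by
  obtain ⟨C, hC⟩ := hμ
  obtain ⟨c, h1, -, -, h4⟩ := hC.exists_curve hκ
  have h5 : ContinuousAt (fun μ => ((c μ 1 : ℝ) : AddCircle (1 : ℝ))) μ :=
    (AddCircle.continuous_mk' (1 : ℝ)).continuousAt.comp (h1 1).continuousAt
  refine h5.congr ?_
  filter_upwards [h4] with μ' hμ' using (hμ'.turningPoint_eq hκ).symm

/-- The labelling determines `C 1` as a point of the circle. A component is the image of the simply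
connected set `V`, so this continuous map to the circle lifts to `ℝ`. -/
lemma exists_turningPoint_lift (hκ : ∀ i, 0 < κ i) (hμ : μ₀ ∈ OrderedDelta κ) :
    ∃ T : (Fin (2 * m) → ℝ) → ℝ, ∀ μ ∈ connectedComponentIn (OrderedDelta κ) μ₀,
      ContinuousAt T μ ∧ turningPoint κ μ = (T μ : ℝ) := by
  obtain ⟨ψ, hψ, hψμ⟩ := exists_isNormSection hκ hμ
  rw [hψ.component_OrderedDelta hκ ⟨_, normValues_mem_V hκ hμ, hψμ⟩]
  have hm := normValues_mem_V hκ hμ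
  have : SimplyConnectedSpace (V κ) := by
    have := convex_V.contractibleSpace ⟨_, hm⟩
    infer_instance
  have : LocallyPathConnectedSpace (V κ) := isOpen_V.locallyPathConnectedSpace
  let f : C(V κ, AddCircle (1 : ℝ)) := ⟨fun v => turningPoint κ (ψ v), by
    refine ContinuousOn.comp_continuous (s := OrderedDelta κ)
      (fun μ hμ => (continuousAt_turningPoint hκ hμ).continuousWithinAt)
      (continuousOn_iff_continuous_domRestrict.1 hψ.continuousOn) fun v => hψ.mem v v.2⟩
  obtain ⟨t₀, ht₀⟩ := QuotientAddGroup.mk_surjective (f ⟨_, hm⟩)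
  obtain ⟨F, ⟨-, hF⟩, -⟩ := (AddCircle.isCoveringMap_coe (1 : ℝ)).existsUnique_continuousMap_lifts
    f ⟨_, hm⟩ t₀ ht₀
  classical
  refine ⟨fun μ => if h : normValues κ μ ∈ V κ then F ⟨_, h⟩ else 0, fun μ hμ => ?_⟩
  have hμO : μ ∈ OrderedDelta κ := by
    obtain ⟨v, hv, rfl⟩ := hμ
    exact hψ.mem v hv
  have hμV := normValues_mem_V hκ hμO
  have hG : ContinuousOn (fun v => if h : v ∈ V κ then F ⟨v, h⟩ else 0) (V κ) := by
    rw [continuousOn_iff_continuous_domRestrict]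
    exact F.continuous.congr fun v => by simp
  refine ⟨(hG.continuousAt (isOpen_V.mem_nhds hμV)).comp
    (f := normValues κ) (exists_normValues_local hκ hμO).1.continuousAt, ?_⟩
  simp only [dif_pos hμV]
  have h1 := congrFun hF ⟨_, hμV⟩
  refine Eq.trans ?_ h1.symm
  change turningPoint κ μ = turningPoint κ (ψ (normValues κ μ))
  rw [((hψ.mem_image_iff Subset.rfl hμO).1 hμ).2]

lemma exists_isCriticalFamily (hκ : ∀ i, 0 < κ i) : ∃ C, IsCriticalFamily κ C := by
  classical
  -- The lift is chosen for the component as a set, so that all parameters of a component share the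
  -- same one.
  have key : ∀ K : Set (Fin (2 * m) → ℝ), ∃ T : (Fin (2 * m) → ℝ) → ℝ,
      ∀ μ₀ ∈ OrderedDelta κ, connectedComponentIn (OrderedDelta κ) μ₀ = K → ∀ μ ∈ K,
        ContinuousAt T μ ∧ turningPoint κ μ = (T μ : ℝ) := by
    intro K
    by_cases h : ∃ μ₀ ∈ OrderedDelta κ, connectedComponentIn (OrderedDelta κ) μ₀ = K
    · obtain ⟨μ₀, h1, rfl⟩ := h
      obtain ⟨T, hT⟩ := exists_turningPoint_lift hκ h1
      exact ⟨T, fun _ _ _ => hT⟩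
    · exact ⟨0, fun μ₀ h1 h2 => absurd ⟨μ₀, h1, h2⟩ h⟩
  choose T' hT' using key
  set T : (Fin (2 * m) → ℝ) → ℝ := fun μ => T' (connectedComponentIn (OrderedDelta κ) μ) μ with hT
  have h1 : ∀ μ ∈ OrderedDelta κ, ContinuousAt T μ ∧ turningPoint κ μ = (T μ : ℝ) := by
    intro μ hμ
    have h2 := hT' _ μ hμ rfl μ (mem_connectedComponentIn hμ)
    refine ⟨h2.1.congr ?_, h2.2⟩
    filter_upwards [(isOpen_OrderedDelta hκ).connectedComponentIn.mem_nhds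
      (mem_connectedComponentIn hμ)] with μ' h3
    rw [hT]
    dsimp only
    rw [connectedComponentIn_eq h3]
  have h2 : ∀ μ, ∃ C, μ ∈ OrderedDelta κ → IsLabelling κ μ C ∧ C 1 = T μ := by
    intro μ
    by_cases hμ : μ ∈ OrderedDelta κ
    · obtain ⟨C, hC⟩ := id hμ
      exact ⟨_, fun _ => ⟨hC.exists_of_turningPoint hκ (h1 μ hμ).2, by ring⟩⟩
    · exact ⟨0, fun h => absurd h hμ⟩
  choose C hC using h2
  refine ⟨C, fun μ hμ => (hC μ hμ).1, fun i μ hμ => ?_⟩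
  obtain ⟨c, h3, -, -, h5⟩ := (hC μ hμ).1.exists_curve hκ
  have h6 : ContinuousAt (fun μ => c μ i + (T μ - c μ 1)) μ :=
    (h3 i).continuousAt.add ((h1 μ hμ).1.sub (h3 1).continuousAt)
  refine (h6.congr ?_).continuousWithinAt
  filter_upwards [h5, (isOpen_OrderedDelta hκ).mem_nhds hμ] with μ' h7 h8
  obtain ⟨n, hn⟩ := h7.eq_add_int hκ (hC μ' h8).1
  rw [← (hC μ' h8).2, hn, hn]
  ring

end components


/-! ### The critical values along a component -/

section critical
variable {m : ℕ} {κ : Fin (m + 1) → ℕ} {τ : Fin (2 * m - 1) → ℤ} {μ : Fin (2 * m) → ℝ} {c : ℤ → ℝ}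
  {C : (Fin (2 * m) → ℝ) → ℤ → ℝ} {ψ : (Fin (2 * m) → ℝ) → Fin (2 * m) → ℝ}

lemma critValues_eq (κ : Fin (m + 1) → ℕ) (C : (Fin (2 * m) → ℝ) → ℤ → ℝ) (μ : Fin (2 * m) → ℝ) :
    critValues κ C μ = turningValues m (lift κ μ) (C μ) := rfl

/-- A continuous family differs from the smooth local labelling by an integer that is `0` at `μ`,
hence `0` nearby. -/
lemma IsCriticalFamily.exists_local (hκ : ∀ i, 0 < κ i) (hC : IsCriticalFamily κ C)
    (hμ : μ ∈ OrderedDelta κ) :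
    ContDiffAt ℝ ∞ (critValues κ C) μ ∧ ∃ L : (Fin (2 * m) → ℝ) ≃L[ℝ] (Fin (2 * m) → ℝ),
      HasFDerivAt (critValues κ C) (L : (Fin (2 * m) → ℝ) →L[ℝ] (Fin (2 * m) → ℝ)) μ := by
  have hL := hC.isLabelling μ hμ
  obtain ⟨c, h1, h2, -, h4⟩ := hL.exists_curve hκ
  have h5 : ContinuousAt (fun μ => C μ 1 - c μ 1) μ :=
    ((hC.continuousOn 1).continuousAt ((isOpen_OrderedDelta hκ).mem_nhds hμ)).sub
      (h1 1).continuousAt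
  have h6 : |C μ 1 - c μ 1| < 1 := by rw [h2]; simp
  have heq : critValues κ C =ᶠ[𝓝 μ] fun μ => mixedValues κ 0 μ (c μ) := by
    filter_upwards [h4, (isOpen_OrderedDelta hκ).mem_nhds hμ,
      h5.abs.eventually (gt_mem_nhds h6)] with μ' h7 h8 h9
    obtain ⟨n, hn⟩ := h7.eq_add_int hκ (hC.isLabelling μ' h8)
    rw [hn, add_sub_cancel_left] at h9
    have hn0 : n = 0 := Int.abs_lt_one_iff.1 (by exact_mod_cast h9)
    have : C μ' = c μ' := funext fun i => by rw [hn, hn0]; simp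
    rw [critValues_eq, this]
    funext i
    unfold mixedValues
    ring
  obtain ⟨L, hL'⟩ := exists_hasFDerivAt_mixedValues hκ hL.one_lt_modulus hL.alternates h1 h2 0
  exact ⟨(contDiffAt_mixedValues hL.one_lt_modulus h1 0).congr_of_eventuallyEq heq,
    L, hL'.congr_of_eventuallyEq heq⟩

/-! ### Rotations of the target -/

/-- The parameters of a rotation. -/
noncomputable def rotation (m : ℕ) (s : ℝ) : Fin (2 * m) → ℝ := mkParam s (fun _ => 0) fun _ => 0

lemma modulus_rotation (s : ℝ) (j : Fin m) : modulus (rotation m s) j = 0 :=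
  modulus_mkParam _ _ _ j

lemma angle_rotation (s : ℝ) (j : Fin m) : angle (rotation m s) j = 0 :=
  angle_mkParam _ _ _ (fun _ _ => rfl) j

lemma rotation_zero : rotation m 0 = 0 := by
  funext i
  simp [rotation, mkParam]

lemma zero_add_rotation (μ : Fin (2 * m) → ℝ) (s : ℝ) : zero (μ + rotation m s) = zero μ := by
  funext j
  unfold zero
  rw [modulus_add, modulus_rotation, angle_add, angle_rotation, add_zero, add_zero]

lemma shift_add_rotation (hm : 0 < m) (κ : Fin (m + 1) → ℕ) (μ : Fin (2 * m) → ℝ) (s : ℝ) :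
    shift κ (μ + rotation m s) = shift κ μ + s := by
  unfold shift
  simp only [coord_add, angle_add, angle_rotation, add_zero]
  rw [rotation, coord_mkParam hm]
  ring

lemma lift_add_rotation (hm : 0 < m) (κ : Fin (m + 1) → ℕ) (μ : Fin (2 * m) → ℝ) (s t : ℝ) :
    lift κ (μ + rotation m s) t = lift κ μ t + s := by
  unfold lift phase
  simp only [zero_add_rotation, coord_add, angle_add, angle_rotation, add_zero]
  rw [rotation, coord_mkParam hm]
  ring

lemma norm_blaschke_add_rotation (κ : Fin (m + 1) → ℕ) (μ : Fin (2 * m) → ℝ) (s : ℝ) (z : ℂ) :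
    ‖blaschke κ (μ + rotation m s) z‖ = ‖blaschke κ μ z‖ := by
  unfold blaschke
  simp only [norm_mul, norm_e, zero_add_rotation]

lemma IsLabelling.add_rotation (h : IsLabelling κ μ c) (s : ℝ) :
    IsLabelling κ (μ + rotation m s) c := by
  have hm := h.alternates.m_pos
  have ho : ∀ j, outerDisk κ (μ + rotation m s) j = outerDisk κ μ j := fun j => by
    unfold outerDisk; simp only [norm_blaschke_add_rotation, zero_add_rotation]
  have hl : lift κ (μ + rotation m s) = fun t => lift κ μ t + s :=
    funext fun t => lift_add_rotation hm κ μ s t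
  have hM := h.multimodal
  refine ⟨fun j => by rw [modulus_add, modulus_rotation, add_zero]; exact h.one_lt_modulus j,
    ?_, fun j => by rw [ho]; exact h.max_mem j, fun j => by rw [ho]; exact h.min_mem j⟩
  rw [hl]
  exact ⟨hM.continuous.add continuous_const, fun t => by rw [hM.degree]; ring, hM.strictMono,
    hM.periodic, fun j x hx y hy hxy => by
      have := hM.decreasing j hx hy hxy
      linarith, fun j x hx y hy hxy => by
      have := hM.increasing j hx hy hxy
      linarith⟩

lemma add_rotation_mem (hμ : μ ∈ OrderedDelta κ) (s : ℝ) : μ + rotation m s ∈ OrderedDelta κ :=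
  let ⟨c, hc⟩ := hμ
  ⟨c, hc.add_rotation s⟩

lemma normValues_add_rotation (hκ : ∀ i, 0 < κ i) (hμ : μ ∈ OrderedDelta κ) (s : ℝ) :
    normValues κ (μ + rotation m s) = fun i => normValues κ μ i + s := by
  obtain ⟨c, hc⟩ := hμ
  have hm := hc.alternates.m_pos
  rw [hc.normValues_eq_add hκ, (hc.add_rotation s).normValues_eq_add hκ]
  funext i
  unfold turningValues
  simp only [lift_add_rotation hm, shift_add_rotation hm]
  ring

lemma continuous_add_rotation (μ : Fin (2 * m) → ℝ) : Continuous fun s => μ + rotation m s := by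
  have : (fun s => μ + rotation m s) = fun s => μ + s • rotation m 1 := by
    funext s
    congr 1
    funext i
    simp only [rotation, mkParam, Pi.smul_apply, smul_eq_mul]
    split_ifs <;> simp
  rw [this]
  fun_prop

/-- Rotating the target by `s` stays in the component and adds `s` to the normalized values; the
section has just one point above the result. -/
lemma IsNormSection.add_const (hκ : ∀ i, 0 < κ i) (h : IsNormSection κ ψ) {v : Fin (2 * m) → ℝ}
    (hv : v ∈ V κ) (s : ℝ) : ψ (fun i => v i + s) = ψ v + rotation m s := by
  have h1 : ψ v ∈ ψ '' V κ := ⟨v, hv, rfl⟩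
  have h2 : range (fun s => ψ v + rotation m s) ⊆ ψ '' V κ := by
    rw [← h.component_OrderedDelta hκ h1]
    refine (isPreconnected_range (continuous_add_rotation _)).subset_connectedComponentIn
      ⟨0, by simp only [rotation_zero, add_zero]⟩
      (range_subset_iff.2 fun s => add_rotation_mem (h.mem v hv) s)
  have h3 := ((h.mem_image_iff Subset.rfl (add_rotation_mem (h.mem v hv) s)).1
    (h2 (mem_range_self s))).2
  rwa [normValues_add_rotation hκ (h.mem v hv), h.apply_eq v hv] at h3

/-- Rotations do not move the turning points. The remaining integral ambiguity depends continuously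
on `s` and vanishes at `s = 0`. -/
lemma IsCriticalFamily.add_rotation (hκ : ∀ i, 0 < κ i) (hC : IsCriticalFamily κ C)
    (hμ : μ ∈ OrderedDelta κ) (s : ℝ) : C (μ + rotation m s) = C μ := by
  have h1 : ∀ s, ∃ n : ℤ, ∀ i, C (μ + rotation m s) i = C μ i + n := fun s =>
    ((hC.isLabelling μ hμ).add_rotation s).eq_add_int hκ
      (hC.isLabelling _ (add_rotation_mem hμ s))
  choose n hn using h1
  have h2 : Continuous n := by
    rw [Int.isClosedEmbedding_coe_real.isInducing.continuous_iff]
    have : Continuous fun s => C (μ + rotation m s) 1 - C μ 1 :=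
      ((hC.continuousOn 1).comp_continuous (continuous_add_rotation μ) fun s =>
        add_rotation_mem hμ s).sub continuous_const
    refine this.congr fun s => ?_
    rw [hn]
    simp
  have h3 : n s = n 0 := PreconnectedSpace.constant inferInstance h2
  have h5 := hn 0 0
  rw [rotation_zero, add_zero, left_eq_add] at h5
  funext i
  rw [hn, h3, h5, add_zero]

lemma IsCriticalFamily.critValues_mem_typeSet (hκ : ∀ i, 0 < κ i) (hC : IsCriticalFamily κ C)
    (hμ : μ ∈ DeltaTau κ τ) : critValues κ C μ ∈ typeSet κ τ :=
  ((hC.isLabelling μ (DeltaTau_subset hμ)).mem_DeltaTau_iff hκ).1 hμ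

/-- The difference between the critical values and their normalization. -/
noncomputable def offset (κ : Fin (m + 1) → ℕ) (C : (Fin (2 * m) → ℝ) → ℤ → ℝ)
    (μ : Fin (2 * m) → ℝ) : ℝ :=
  lift κ μ (C μ 1) - shift κ μ

lemma IsCriticalFamily.critValues_section (hκ : ∀ i, 0 < κ i) (hC : IsCriticalFamily κ C)
    (h : IsNormSection κ ψ) {v : Fin (2 * m) → ℝ} (hv : v ∈ V κ) (s : ℝ) :
    critValues κ C (ψ fun i => v i + s) = fun i => v i + s + offset κ C (ψ v) := by
  have hL := hC.isLabelling _ (h.mem v hv)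
  have hm := hL.alternates.m_pos
  rw [h.add_const hκ hv, critValues_eq, hC.add_rotation hκ (h.mem v hv)]
  have h1 := hL.turningValues_eq_add hκ
  rw [h.apply_eq v hv] at h1
  funext i
  have h2 := congrFun h1 i
  unfold turningValues at h2 ⊢
  rw [lift_add_rotation hm, h2]
  unfold offset
  ring

/-- Equal critical values force the normalized values to differ by a constant. The two parameters
then lie on one orbit of rotations, along which the critical values move by the angle of rotation.
-/
lemma IsCriticalFamily.injOn (hκ : ∀ i, 0 < κ i) (hC : IsCriticalFamily κ C)
    (h : IsNormSection κ ψ) : InjOn (critValues κ C) (ψ '' V κ) := by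
  rintro _ ⟨v, hv, rfl⟩ _ ⟨v', hv', rfl⟩ heq
  have hm := (hC.isLabelling _ (h.mem v hv)).alternates.m_pos
  have h1 := hC.critValues_section hκ h hv 0
  have h2 := hC.critValues_section hκ h hv' 0
  simp only [add_zero] at h1 h2
  rw [heq, h2] at h1
  have h3 : v' = fun i => v i + (offset κ C (ψ v) - offset κ C (ψ v')) := by
    funext i
    have := congrFun h1 i
    linarith
  have h4 := hC.critValues_section hκ h hv (offset κ C (ψ v) - offset κ C (ψ v'))
  rw [← h3, h2] at h4
  have h5 := congrFun h4 ⟨0, by omega⟩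
  have h6 := congrFun h3 ⟨0, by omega⟩
  have h7 : offset κ C (ψ v) - offset κ C (ψ v') = 0 := by linarith
  rw [h3, h7]
  simp

lemma IsCriticalFamily.image_section (hκ : ∀ i, 0 < κ i) (hC : IsCriticalFamily κ C)
    (h : IsNormSection κ ψ) : critValues κ C '' (ψ '' typeSet κ τ) = typeSet κ τ := by
  refine Subset.antisymm ?_ fun v hv => ?_
  · rw [← h.image_inter_DeltaTau hκ]
    rintro _ ⟨μ, hμ, rfl⟩
    exact hC.critValues_mem_typeSet hκ hμ.1
  · refine ⟨_, ⟨_, add_const_mem_typeSet hv (-offset κ C (ψ v)), rfl⟩, ?_⟩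
    rw [hC.critValues_section hκ h (typeSet_subset hv)]
    funext i
    ring

/-- The image of a single section already realizes every vector of `typeSet`, so the image of `Δ_τ`
depends neither on the family nor on the component. -/
lemma IsCriticalFamily.VTau_eq (hκ : ∀ i, 0 < κ i) (hC : IsCriticalFamily κ C)
    (h : IsNormSection κ ψ) : VTau κ τ C = typeSet κ τ := by
  refine Subset.antisymm ?_ ?_
  · rintro _ ⟨μ, hμ, rfl⟩
    exact hC.critValues_mem_typeSet hκ hμ
  · rw [← hC.image_section hκ h, ← h.image_inter_DeltaTau hκ]
    exact image_mono inter_subset_left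

/-- An injective smooth map with invertible derivatives is a diffeomorphism. -/
lemma isDiffeoOnto_of_injOn {n : ℕ} {f : (Fin n → ℝ) → (Fin n → ℝ)} {U K : Set (Fin n → ℝ)}
    (hU : IsOpen U) (hinj : InjOn f U) (hf : ∀ x ∈ U, ContDiffAt ℝ ∞ f x ∧
      ∃ L : (Fin n → ℝ) ≃L[ℝ] (Fin n → ℝ), HasFDerivAt f (L : (Fin n → ℝ) →L[ℝ] (Fin n → ℝ)) x)
    (hK : K ⊆ U) : IsDiffeoOnto f K (f '' K) := by
  have hopen : IsOpenMap (U.domRestrict f) := by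
    rw [isOpenMap_iff_nhds_le]
    rintro ⟨x, hx⟩
    obtain ⟨h1, L, hL⟩ := hf x hx
    have h2 := (h1.hasStrictFDerivAt' hL (by simp)).map_nhds_eq_of_equiv
    rw [show U.domRestrict f = f ∘ Subtype.val from rfl, ← Filter.map_map,
      map_nhds_subtype_coe_eq_nhds hx (hU.mem_nhds hx), h2]
    exact le_rfl
  have hcont : ContinuousOn f U := fun x hx => (hf x hx).1.continuousAt.continuousWithinAt
  let Φ : OpenPartialHomeomorph (Fin n → ℝ) (Fin n → ℝ) :=
    OpenPartialHomeomorph.ofContinuousOpenRestrict (hinj.toPartialEquiv f U) hcont hopen hU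
  refine ⟨Φ, hK, fun x _ => rfl, fun x hx => (hf x hx).1.contDiffWithinAt, fun y hy => ?_, rfl⟩
  obtain ⟨h1, L, hL⟩ := hf (Φ.symm y) (Φ.map_target hy)
  exact (Φ.contDiffAt_symm hy (f₀' := L) hL h1).contDiffWithinAt

lemma IsCriticalFamily.isDiffeoOnto (hκ : ∀ i, 0 < κ i) (hC : IsCriticalFamily κ C)
    (hμ : μ ∈ DeltaTau κ τ) :
    IsDiffeoOnto (critValues κ C) (connectedComponentIn (DeltaTau κ τ) μ) (VTau κ τ C) := by
  have hμO := DeltaTau_subset hμ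
  obtain ⟨ψ, h, hψ⟩ := exists_isNormSection hκ hμO
  rw [h.component_DeltaTau hκ ⟨_, (mem_DeltaTau_iff hκ hμO).1 hμ, hψ⟩, hC.VTau_eq hκ h]
  have h1 := isDiffeoOnto_of_injOn (h.isOpen_image hκ) (hC.injOn hκ h) (fun x hx => by
    obtain ⟨v, hv, rfl⟩ := hx
    exact hC.exists_local hκ (h.mem v hv)) (image_mono (f := ψ) (typeSet_subset (τ := τ)))
  rwa [hC.image_section hκ h] at h1

end critical


/-! ### Existence of parameters -/

section existence
variable {m : ℕ} {κ : Fin (m + 1) → ℕ} {μ : Fin (2 * m) → ℝ}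

/-- The radius through a zero of small modulus lies in the disk around it. -/
lemma collar_angle (hκ : ∀ i, 0 < κ i) (h : ∀ j, 1 < modulus μ j) {j : Fin m}
    (hj : κ 0 * (modulus μ j - 1) < 1) : Collar κ μ j (angle μ j) := by
  set r := modulus μ j with hr
  have hr1 : 1 < r := h j
  refine collar_of_forall (ε := r - 1) (by linarith) fun ρ hρ => ?_
  have hρ1 : ρ ∈ Ioc 1 r := ⟨hρ.1, by linarith [hρ.2]⟩
  refine mem_component_of_isPreconnected (F := region κ μ)
    (S := (fun s : ℝ => (s : ℂ) * e (angle μ j)) '' Ioc 1 r)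
    (isPreconnected_Ioc.image _
      (Complex.continuous_ofReal.mul continuous_const).continuousOn) ?_
    (x := zero μ j) ⟨r, ⟨hr1, le_rfl⟩, rfl⟩ (zero_mem_outerDisk h j (hκ _)) (mem_image_of_mem _ hρ1)
  rintro _ ⟨s, ⟨hs1, hsr⟩, rfl⟩
  have hn : ‖(s : ℂ) * e (angle μ j)‖ = s := norm_ofReal_mul_e (by linarith)
  refine ⟨by dsimp only; rw [hn]; exact hs1, ?_⟩
  dsimp only
  have hz : 1 ≤ ‖(s : ℂ) * e (angle μ j)‖ := by rw [hn]; exact hs1.le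
  have h1 : ‖(s : ℂ) * e (angle μ j) - zero μ j‖ = r - s := by
    rw [← sq_eq_sq₀ (norm_nonneg _) (by linarith), norm_sub_zero_sq]
    unfold numSq
    rw [sub_self, mul_zero, Real.cos_zero]; ring
  have h2 : ‖1 - conj (zero μ j) * ((s : ℂ) * e (angle μ j))‖ = s * r - 1 := by
    rw [← sq_eq_sq₀ (norm_nonneg _) (by nlinarith), norm_one_sub_sq]
    unfold denSq
    rw [sub_self, mul_zero, Real.cos_zero]; ring
  have hden : 0 < s * r - 1 := by nlinarith
  -- Only the power of `z` and one factor with the zero `a_j` are kept; all other factors have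
  -- modulus at most `1`.
  have h3 : ‖blaschke κ μ ((s : ℂ) * e (angle μ j))‖ ≤ s ^ κ 0 * ((r - s) / (s * r - 1)) := by
    rw [norm_blaschke, hn, ← Finset.mul_prod_erase _ _ (Finset.mem_univ j), h1, h2]
    have h0 : 0 ≤ (r - s) / (s * r - 1) := div_nonneg (by linarith) hden.le
    have h1' : (r - s) / (s * r - 1) ≤ 1 := (div_le_one hden).2 (by nlinarith)
    refine mul_le_mul_of_nonneg_left ?_ (by positivity)
    refine (mul_le_of_le_one_right (by positivity) (Finset.prod_le_one (fun l _ => by positivity)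
      fun l _ => pow_le_one₀ (by positivity) (norm_factor_le_one (h l) hz))).trans ?_
    exact pow_le_of_le_one h0 h1' (hκ _).ne'
  refine h3.trans_lt ?_
  rw [← mul_div_assoc, div_lt_one hden]
  have hk : (1 : ℝ) ≤ κ 0 := by exact_mod_cast hκ 0
  have hs0 : s ≠ 0 := by linarith
  -- Bernoulli's inequality gives `s ^ k_0 (1 - k_0 (s - 1)) ≤ 1`. It remains to compare `r - s`
  -- with `(s r - 1) (1 - k_0 (s - 1))`, where `s r - 1 ≥ (r - 1) + (s - 1)`.
  have h4 : 1 + κ 0 * (s⁻¹ - 1) ≤ s⁻¹ ^ κ 0 := by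
    have : 0 < s⁻¹ := by positivity
    have := one_add_mul_le_pow (a := s⁻¹ - 1) (by linarith) (κ 0)
    rwa [add_sub_cancel] at this
  have h5 : 1 - s ≤ s⁻¹ - 1 := by
    rw [show s⁻¹ - 1 = (1 - s) / s by field_simp, le_div_iff₀ (by linarith)]
    nlinarith
  have hu : 0 < s ^ κ 0 := by positivity
  have h6 : s ^ κ 0 * (1 - κ 0 * (s - 1)) ≤ 1 := by
    have h7 : 1 - κ 0 * (s - 1) ≤ s⁻¹ ^ κ 0 := by nlinarith
    have h8 := mul_le_mul_of_nonneg_left h7 hu.le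
    rwa [← mul_pow, mul_inv_cancel₀ hs0, one_pow] at h8
  have h9 : r - s < (r - 1 + (s - 1)) * (1 - κ 0 * (s - 1)) := by
    have h7 : κ 0 * (s - 1) ≤ κ 0 * (r - 1) := by gcongr
    have h8 : 0 < (s - 1) * (2 - κ 0 * (r - 1) - κ 0 * (s - 1)) :=
      mul_pos (by linarith) (by linarith)
    linarith
  have h10 := mul_lt_mul_of_pos_left h9 hu
  nlinarith

lemma genDeriv_angle_neg (hκ : ∀ i, 0 < κ i) (h : ∀ j, 1 < modulus μ j) {j : Fin m}
    (hj : κ 0 * (modulus μ j - 1) < 1) :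
    genDeriv (order κ) (degree κ) (pole μ) (angle μ j) < 0 := by
  have hr := h j
  rw [genDeriv_eq_sub h, sub_neg]
  have h1 : ∀ l ∈ Finset.univ, 0 ≤ order κ l * poisson (pole μ l) (angle μ j) := fun l _ =>
    mul_nonneg (Nat.cast_nonneg _) (poisson_pos (norm_pole_lt (h l)) _).le
  refine lt_of_lt_of_le ?_ (Finset.single_le_sum h1 (Finset.mem_univ j))
  have hk : (1 : ℝ) ≤ order κ j := by unfold order; exact_mod_cast hκ _
  have h2 : (κ 0 : ℝ) < poisson (pole μ j) (angle μ j) := by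
    rw [poisson_pole hr]
    unfold numSq
    rw [sub_self, mul_zero, Real.cos_zero, lt_div_iff₀ (by nlinarith)]
    nlinarith
  nlinarith [poisson_pos (norm_pole_lt (h j)) (angle μ j)]

lemma tendsto_poisson {η t : ℝ} (h : Real.cos (2 * Real.pi * (t - η)) ≠ 1) :
    Tendsto (fun r : ℝ => (r ^ 2 - 1) / numSq r η 1 t) (𝓝 1) (𝓝 0) := by
  have h1 : ContinuousAt (fun r : ℝ => (r ^ 2 - 1) / numSq r η 1 t) 1 := by
    unfold numSq
    refine ContinuousAt.div (by fun_prop) (by fun_prop) ?_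
    intro h0
    exact h (by linarith)
  simpa using h1.tendsto

/-- If the derivative has the signs of a multimodal map at the points `(i - 1) / (2 * m)`, then
there are turning points between them. -/
lemma exists_alternates {g : ℝ → ℝ} (hm : 0 < m) (hg : Continuous g)
    (hper : ∀ t (n : ℤ), g (t + n) = g t) (hneg : ∀ j : Fin m, g (((j : ℕ) : ℝ) / m) < 0)
    (hpos : ∀ j : Fin m, 0 < g ((2 * ((j : ℕ) : ℝ) + 1) / (2 * m))) :
    ∃ C, Alternates m g C ∧
      ∀ j : Fin m, ((j : ℕ) : ℝ) / m ∈ Ioo (C (2 * j + 1)) (C (2 * j + 2)) := by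
  have hm0 : (0 : ℝ) < m := by exact_mod_cast hm
  have hm2 : (0 : ℤ) < 2 * m := by omega
  set q : ℤ → ℝ := fun i => i / (2 * m) with hq
  have hqp : ∀ i n : ℤ, q (i + 2 * m * n) = q i + n := fun i n => by
    simp only [hq]; push_cast; field_simp
  have hqlt : ∀ i, q i < q (i + 1) := fun i => by
    simp only [hq]; push_cast; gcongr; linarith
  have hred : ∀ j : ℤ, ∃ (l : Fin m) (n : ℤ), j = l + m * n := fun j => by
    have h1 := Int.emod_nonneg j (show (m : ℤ) ≠ 0 by omega)
    have h2 := Int.emod_lt_of_pos j (show (0 : ℤ) < m by omega)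
    have h3 := Int.emod_add_mul_ediv j m
    exact ⟨⟨(j % m).toNat, by omega⟩, j / m, by dsimp only; omega⟩
  have hqneg : ∀ j : ℤ, g (q (2 * j)) < 0 := fun j => by
    obtain ⟨l, n, rfl⟩ := hred j
    rw [show 2 * ((l : ℤ) + m * n) = 2 * l + 2 * m * n by ring, hqp, hper]
    convert hneg l using 2
    simp only [hq]; push_cast; field_simp
  have hqpos : ∀ j : ℤ, 0 < g (q (2 * j + 1)) := fun j => by
    obtain ⟨l, n, rfl⟩ := hred j
    rw [show 2 * ((l : ℤ) + m * n) + 1 = 2 * l + 1 + 2 * m * n by ring, hqp, hper]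
    convert hpos l using 2
    simp only [hq]; push_cast; rfl
  -- The index is displaced so that the decreasing arc from `C (2j + 1)` to `C (2j + 2)` contains `q
  -- (2j) = j / m`.
  have hz : ∀ i : ℤ, ∃ z ∈ Ioo (q (i - 2)) (q (i - 1)), g z = 0 := fun i => by
    have hlt : q (i - 2) ≤ q (i - 1) := by
      have := hqlt (i - 2)
      rw [show i - 2 + 1 = i - 1 by ring] at this
      exact this.le
    rcases Int.even_or_odd' i with ⟨k, rfl | rfl⟩
    · have h1 := hqneg (k - 1)
      have h2 := hqpos (k - 1)
      rw [show 2 * (k - 1) + 1 = 2 * k - 1 by ring] at h2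
      rw [show 2 * (k - 1) = 2 * k - 2 by ring] at h1
      exact intermediate_value_Ioo hlt hg.continuousOn ⟨h1, h2⟩
    · have h1 := hqneg k
      have h2 := hqpos (k - 1)
      rw [show 2 * (k - 1) + 1 = 2 * k + 1 - 2 by ring] at h2
      rw [show 2 * k = 2 * k + 1 - 1 by ring] at h1
      exact intermediate_value_Ioo' hlt hg.continuousOn ⟨h1, h2⟩
  choose z hz hz0 using hz
  set C : ℤ → ℝ := fun i => z (i % (2 * m)) + (i / (2 * m) : ℤ) with hC
  have hCq : ∀ i, C i ∈ Ioo (q (i - 2)) (q (i - 1)) := fun i => by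
    have h1 := hz (i % (2 * m))
    have h2 := Int.emod_add_mul_ediv i (2 * m)
    have h3 := hqp (i % (2 * m) - 2) (i / (2 * m))
    have h4 := hqp (i % (2 * m) - 1) (i / (2 * m))
    rw [show i % (2 * m) - 2 + 2 * m * (i / (2 * m)) = i - 2 by linarith] at h3
    rw [show i % (2 * m) - 1 + 2 * m * (i / (2 * m)) = i - 1 by linarith] at h4
    rw [h3, h4]
    exact ⟨by simp only [hC]; linarith [h1.1], by simp only [hC]; linarith [h1.2]⟩
  have hmem : ∀ i, q (i - 1) ∈ Ioo (C i) (C (i + 1)) := fun i => by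
    have h1 := (hCq (i + 1)).1
    rw [show i + 1 - 2 = i - 1 by ring] at h1
    exact ⟨(hCq i).2, h1⟩
  refine ⟨C, alternates_of_periodic 0 hm (fun i => ?_) hper (fun i _ => ?_) (fun j _ => ?_)
    fun j _ => ?_, fun j => ?_⟩
  · simp only [hC]
    rw [Int.add_emod_right, Int.add_ediv_of_dvd_right dvd_rfl, Int.ediv_self hm2.ne']
    push_cast; ring
  · simp only [hC]; rw [hper, hz0]
  · have h1 := hmem (2 * j - 1)
    rw [sub_add_cancel, show 2 * j - 1 - 1 = 2 * (j - 1) by ring] at h1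
    exact ⟨_, h1, hqneg _⟩
  · have h1 := hmem (2 * j)
    rw [show 2 * j - 1 = 2 * (j - 1) + 1 by ring] at h1
    exact ⟨_, h1, hqpos _⟩
  · have h1 := hmem (2 * j + 1)
    rw [show 2 * (j : ℤ) + 1 - 1 = 2 * j by ring, show 2 * (j : ℤ) + 1 + 1 = 2 * j + 2 by ring] at h1
    rwa [show ((j : ℕ) : ℝ) / m = q (2 * j) by simp only [hq]; push_cast; field_simp]

/-- Zeros of a common modulus close to `1` are placed at the angles `j / m`. There the kernels are
large and the derivative is negative; halfway between them all kernels are small and the derivative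
is close to `k_0 > 0`. By `collar_angle` each disk contains the radius below its zero, so it touches
the arc around its own angle. -/
lemma OrderedDelta_nonempty (hm : 0 < m) (hκ : ∀ i, 0 < κ i) : (OrderedDelta κ).Nonempty := by
  have hm0 : (0 : ℝ) < m := by exact_mod_cast hm
  set η : Fin m → ℝ := fun j => ((j : ℕ) : ℝ) / m with hη
  set t : Fin m → ℝ := fun j => (2 * ((j : ℕ) : ℝ) + 1) / (2 * m) with ht
  have hcos : ∀ j l, Real.cos (2 * Real.pi * (t j - η l)) ≠ 1 := by
    intro j l h
    obtain ⟨n, hn⟩ := (Real.cos_eq_one_iff _).1 h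
    have h1 : (n : ℝ) = t j - η l := by
      have := Real.pi_pos
      exact mul_right_cancel₀ (b := 2 * Real.pi) (by positivity) (by linarith)
    simp only [hη, ht] at h1
    field_simp at h1
    have h2 : n * (2 * m) = 2 * ((j : ℕ) : ℤ) + 1 - 2 * ((l : ℕ) : ℤ) := by
      have h2 : ((n * (2 * m) : ℤ) : ℝ) = ((2 * ((j : ℕ) : ℤ) + 1 - 2 * ((l : ℕ) : ℤ) : ℤ) : ℝ) := by
        push_cast; linarith
      exact_mod_cast h2
    have h3 : 2 * (n * m) = 2 * ((j : ℕ) : ℤ) + 1 - 2 * ((l : ℕ) : ℤ) := by rw [← h2]; ring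
    omega
  have hk0 : (0 : ℝ) < κ 0 := by exact_mod_cast hκ 0
  have h1 : ∀ j, ∀ᶠ r : ℝ in 𝓝[>] 1,
      (0 : ℝ) < κ 0 - ∑ l, order κ l * ((r ^ 2 - 1) / numSq r (η l) 1 (t j)) := fun j => by
    have h2 : Tendsto (fun r : ℝ => (κ 0 : ℝ) - ∑ l, order κ l * ((r ^ 2 - 1) / numSq r (η l) 1 (t j)))
        (𝓝 1) (𝓝 ((κ 0 : ℝ) - ∑ l : Fin m, order κ l * 0)) :=
      tendsto_const_nhds.sub (tendsto_finsetSum _ fun l _ =>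
        (tendsto_poisson (hcos j l)).const_mul _)
    refine nhdsWithin_le_nhds (h2.eventually (lt_mem_nhds ?_))
    simpa using hk0
  have h2 : ∀ᶠ r : ℝ in 𝓝[>] 1, κ 0 * (r - 1) < 1 := by
    have : Tendsto (fun r : ℝ => κ 0 * (r - 1)) (𝓝 1) (𝓝 (κ 0 * (1 - 1))) :=
      Continuous.tendsto (by fun_prop) 1
    exact nhdsWithin_le_nhds (this.eventually (gt_mem_nhds (by simp)))
  obtain ⟨r, ⟨h3, h4⟩, hr⟩ := ((eventually_all.2 h1).and h2 |>.and self_mem_nhdsWithin).exists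
  set μ : Fin (2 * m) → ℝ := mkParam 0 (fun _ => r) η with hμ
  have hmod : ∀ j, modulus μ j = r := fun j => modulus_mkParam _ _ _ j
  have hang : ∀ j, angle μ j = η j := fun j => angle_mkParam _ _ _ (fun j hj => by simp [hη, hj]) j
  have hone : ∀ j, 1 < modulus μ j := fun j => by rw [hmod]; exact hr
  have hj : ∀ j, κ 0 * (modulus μ j - 1) < 1 := fun j => by rw [hmod]; exact h4
  obtain ⟨C, hA, hmem⟩ := exists_alternates (g := genDeriv (order κ) (degree κ) (pole μ)) hm
    (continuous_iff_continuousAt.2 fun x =>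
      (contDiffAt_genDeriv (n := 0) (p := (pole μ, x)) fun j => norm_pole_lt (hone j)).continuousAt.comp
        (f := fun x => (pole μ, x)) (by fun_prop))
    (fun t n => genDeriv_add_int _ _ _ _ _)
    (fun j => by
      have := genDeriv_angle_neg hκ hone (hj j)
      rwa [hang] at this)
    fun j => by
      rw [genDeriv_eq_sub hone]
      simp only [poisson_pole (hone _), hmod, hang]
      exact h3 j
  refine ⟨μ, C, isLabelling_iff.2 ⟨hone, hA, fun j => ⟨_, ?_, collar_angle hκ hone (hj j)⟩⟩⟩
  rw [hang, show 2 * ((j : ℤ) + 1) - 1 = 2 * j + 1 by ring, show 2 * ((j : ℤ) + 1) = 2 * j + 2 by ring]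
  exact hmem j

end existence

end BlaschkeMultimodal

theorem mainTheorem7 (m : ℕ) (d : ℤ) (τ : Fin (2 * m - 1) → ℤ) (κ : Fin (m + 1) → ℕ)
    (G : ℝ → ℝ) (c : ℤ → ℝ)
    (hG : BlaschkeMultimodal.IsMultimodalLift m d G c)
    (hτ : BlaschkeMultimodal.HasType m G c τ)
    (hpos : ∀ i, 0 < κ i)
    (habove : ∀ j : Fin m, -τ ⟨2 * j, by omega⟩ + 2 ≤ (κ j.succ : ℤ))
    (hdeg : (κ 0 : ℤ) = d + ∑ j : Fin m, (κ j.succ : ℤ)) :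
    (∃ M : ℝ, 0 < M ∧ ∀ μ ∈ BlaschkeMultimodal.DeltaTau κ τ, ∀ t : ℝ,
      |deriv (BlaschkeMultimodal.lift κ μ) t| < M ∧
      |deriv (deriv (BlaschkeMultimodal.lift κ μ)) t| < M) ∧
    (∃ δ : ℝ, 0 < δ ∧ ∀ μ ∈ BlaschkeMultimodal.DeltaTau κ τ, ∀ j : Fin m,
      1 + δ < BlaschkeMultimodal.modulus μ j) ∧
    (∃ C, BlaschkeMultimodal.IsCriticalFamily κ C) ∧
    (∀ C, BlaschkeMultimodal.IsCriticalFamily κ C →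
      BlaschkeMultimodal.VTau κ τ C ⊆ BlaschkeMultimodal.V κ ∧
      ∀ μ₀ ∈ BlaschkeMultimodal.DeltaTau κ τ,
        BlaschkeMultimodal.IsDiffeoOnto (BlaschkeMultimodal.critValues κ C)
          (connectedComponentIn (BlaschkeMultimodal.DeltaTau κ τ) μ₀)
          (BlaschkeMultimodal.VTau κ τ C)) ∧
    (BlaschkeMultimodal.DeltaTau κ τ).Nonempty ∧
    (∀ μ₀ ∈ BlaschkeMultimodal.DeltaTau κ τ,
      SimplyConnectedSpace ↥(connectedComponentIn (BlaschkeMultimodal.DeltaTau κ τ) μ₀)) ∧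
    (∀ μ₀ ∈ BlaschkeMultimodal.OrderedDelta κ,
      SimplyConnectedSpace ↥(BlaschkeMultimodal.DeltaTau κ τ ∩
        connectedComponentIn (BlaschkeMultimodal.Delta κ) μ₀)) := by
  have hm : 0 < m := by
    rcases Nat.eq_zero_or_pos m with rfl | h
    · have := hG.periodic 0
      simp at this
    · exact h
  have habove' : ∀ (j : Fin m) (i : Fin (2 * m - 1)), (i : ℕ) = 2 * j →
      -τ i + 2 ≤ (κ j.succ : ℤ) := fun j i hi => by
    rw [show i = ⟨2 * j, hi ▸ i.2⟩ from Fin.ext hi]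
    exact habove j
  have hne : (BlaschkeMultimodal.typeSet κ τ).Nonempty :=
    BlaschkeMultimodal.typeSet_nonempty hG hτ habove' hdeg
  obtain ⟨δ, hδ, hmod⟩ := BlaschkeMultimodal.exists_modulus_bound_DeltaTau (τ := τ) hpos habove'
  obtain ⟨M, hM, hder⟩ := BlaschkeMultimodal.exists_deriv_bound κ hδ
  refine ⟨⟨M, hM, fun μ hμ => hder μ (hmod μ hμ)⟩, ⟨δ, hδ, hmod⟩,
    BlaschkeMultimodal.exists_isCriticalFamily hpos, fun C hC => ⟨?_, fun μ₀ hμ => ?_⟩, ?_,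
    fun μ₀ hμ => ?_, fun μ₀ hμ => ?_⟩
  · rintro _ ⟨μ, hμ, rfl⟩
    exact BlaschkeMultimodal.typeSet_subset (hC.critValues_mem_typeSet hpos hμ)
  · exact hC.isDiffeoOnto hpos hμ
  -- One ordered parameter, of whatever type, yields a section over all of `V`, and the section
  -- takes `typeSet` into `Δ_τ`.
  · obtain ⟨μ, hμ⟩ := BlaschkeMultimodal.OrderedDelta_nonempty hm hpos
    obtain ⟨ψ, h, -⟩ := BlaschkeMultimodal.exists_isNormSection hpos hμ
    have h1 := hne.image ψ
    rw [← h.image_inter_DeltaTau hpos] at h1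
    exact h1.mono Set.inter_subset_left
  · have hμO := BlaschkeMultimodal.DeltaTau_subset hμ
    obtain ⟨ψ, h, hψ⟩ := BlaschkeMultimodal.exists_isNormSection hpos hμO
    rw [h.component_DeltaTau hpos
      ⟨_, (BlaschkeMultimodal.mem_DeltaTau_iff hpos hμO).1 hμ, hψ⟩]
    exact h.simplyConnectedSpace hpos hne
  · obtain ⟨ψ, h, hψ⟩ := BlaschkeMultimodal.exists_isNormSection hpos hμ
    rw [h.component_Delta hpos ⟨_, BlaschkeMultimodal.normValues_mem_V hpos hμ, hψ⟩,
      h.image_inter_DeltaTau hpos]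
    exact h.simplyConnectedSpace hpos hne
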